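/- **Setting.** Let $\Omega\subset\mathbb R^2$ be a bounded Lipschitz domain with a regular (conforming) triangulation $\mathcal T$ into triangles whose shape regularity is controlled by $\gamma$: every $T\in\mathcal T$ contains a disc of radius $r_T$ with $h_T:=\operatorname{diam}T\le\gamma r_T$. Let $\nu>0$, $f\in L^2(\Omega)^2$ with $f|_T\in H(\mathrm{curl},T)$ for all $T\in\mathcal T$, and let $(u,p)\in H^1(\Omega)^2\times L^2_0(\Omega)$ be a weak solution of the Stokes equations with Dirichlet data $u=u_D$ on $\partial\Omega$, i.e. $$\nu(\nabla u,\nabla v)-(p,\operatorname{div}v)=(f,v)\quad\text{for all }v\in H^1_0(\Omega)^2,\qquad (q,\operatorname{div}u)=0\quad\text{for all }q\in L^2_0(\Omega).$$ Let $u_h\in P_m(\mathcal T)^2\cap H^1(\Omega)^2$ be a continuous piecewise polynomial velocity of degree at most $m$ (in particular, the discrete velocity of a conforming piecewise polynomial finite element method of that degree). $\Delta_{\mathcal T}$ and $\mathrm{curl}_{\mathcal T}$ are the elementwise Laplacian and curl, $\mathrm{curl}(\phi_1,\phi_2)=\partial_x\phi_2-\partial_y\phi_1$. For an inner edge $E\in\mathcal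 E^\circ$ with length $h_E$ and unit tangent $\tau_E$, let $\mathcal T(E)$ be the set of the two triangles that share $E$, $\omega_E$ their union, and $[\,\cdot\,]$ the jump across $E$. For $k\ge0$ let $\pi_{P_k(\omega)}$ be the $L^2$ best approximation by polynomials of degree at most $k$ on $\omega$, and $$\mathrm{osc}_k(g,T):=h_T\|(1-\pi_{P_k(T)})g\|_{L^2(T)},\qquad \mathrm{osc}_k(g,\mathcal T(E))^2:=\sum_{T\in\mathcal T(E)}\mathrm{osc}_k(g,T)^2,\qquad \mathrm{osc}_k(g,E):=h_E^{1/2}\|(1-\pi_{P_k(E)})g\|_{L^2(E)}.$$ **Theorem (Efficiency for $\sigma=\nabla u_h$).** For all $k,m\ge 0$ and $\gamma$ there is a constant $C>0$, depending only on $k$, $m$ and $\gamma$, such that in every such setting the following holds. (a) For all $T\in\mathcal T$, $$\nu^{-1}h_T^2\|\mathrm{curl}_{\mathcal T}(f+\nu\Delta_{\mathcal T}u_h)\|_{L^2(T)}\le C\Big(\|\nabla(u-u_h)\|_{L^2(T)}+\nu^{-1}h_T\,\mathrm{osc}_k\big(\mathrm{curl}(f+\nu\Delta_{\mathcal T}u_h),T\big)\Big).$$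 (b) For all $E\in\mathcal E^\circ$ such that the tangential traces of $f$ on $E$ from both sides lie in $L^2(E)$ and $p|_T\in H^1(T)$ for $T\in\mathcal T(E)$, $$\begin{aligned}\nu^{-1}h_E^{3/2}\|[(f+\nu\Delta_{\mathcal T}u_h)\cdot\tau_E]\|_{L^2(E)}\le C\Big(&\|\nabla(u-u_h)\|_{L^2(\omega_E)}+\nu^{-1}h_E\,\mathrm{osc}_k\big(\mathrm{curl}_{\mathcal T}(f+\nu\Delta_{\mathcal T}u_h),\mathcal T(E)\big)\\&+\nu^{-1}h_E\,\mathrm{osc}_k([f\cdot\tau_E],E)+\min\{1,\nu^{-1}\}\,\mathrm{osc}_k(f-\nabla p,\mathcal T(E))\Big).\end{aligned}$$ Here the tangential trace on $E$ of $f|_T\in H(\mathrm{curl},T)$ is the $L^2(E)$-limit of $\psi_n\cdot\tau_E$ for smooth fields $\psi_n$ that converge to $f$ in $H(\mathrm{curl},T)$. -/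

import Mathlib

open MeasureTheory Filter Topology
open scoped ContDiff

namespace StokesEff

noncomputable section

/-- The Euclidean plane. -/
abbrev Pt := EuclideanSpace ℝ (Fin 2)

/-- Real `2 × 2` matrices with the Frobenius norm; the `(i, j)` entry of `∇v` is `∂_j v_i`. -/
abbrev Mat := EuclideanSpace ℝ (Fin 2 × Fin 2)

/-! ### Differential operators on smooth functions -/

/-- The partial derivative `∂_j φ` of a scalar function. -/
def pd (j : Fin 2) (φ : Pt → ℝ) (x : Pt) : ℝ :=
  fderiv ℝ φ x (EuclideanSpace.single j 1)

/-- The gradient of a smooth vector field. -/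
def gradC (v : Pt → Pt) (x : Pt) : Mat :=
  WithLp.toLp 2 fun ij => pd ij.2 (fun y => v y ij.1) x

/-- `curl ψ = ∂_x ψ_2 - ∂_y ψ_1` for a smooth vector field. -/
def curlC (v : Pt → Pt) (x : Pt) : ℝ :=
  pd 0 (fun y => v y 1) x - pd 1 (fun y => v y 0) x

/-- `curl φ = (-∂_y φ, ∂_x φ)` for a smooth scalar function. -/
def rotC (φ : Pt → ℝ) (x : Pt) : Pt := !₂[-pd 1 φ x, pd 0 φ x]

/-! ### Weak derivatives and Sobolev spaces on an open set `U` -/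

/-- `φ` belongs to `C_c^∞(U)`. -/
structure IsTest {F : Type*} [NormedAddCommGroup F] [NormedSpace ℝ F]
    (U : Set Pt) (φ : Pt → F) : Prop where
  smooth : ContDiff ℝ ∞ φ
  compact : HasCompactSupport φ
  supp : tsupport φ ⊆ U

/-- Lebesgue measure on `U`. -/
def vol (U : Set Pt) : Measure Pt := (volume : Measure Pt).restrict U

/-- `g` is the weak partial derivative `∂_j v` on `U` (used only for `v, g ∈ L²(U)`). -/
def IsWeakDeriv (U : Set Pt) (j : Fin 2) (v g : Pt → ℝ) : Prop :=
  ∀ φ : Pt → ℝ, IsTest U φ →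
    ∫ x, v x * pd j φ x ∂(vol U) = -∫ x, g x * φ x ∂(vol U)

/-- The scalar function `q` lies in `H¹(U)` and has the weak gradient `Dq`. -/
structure MemH1s (U : Set Pt) (q : Pt → ℝ) (Dq : Pt → Pt) : Prop where
  memLp : MemLp q 2 (vol U)
  memLp_grad : MemLp Dq 2 (vol U)
  weak : ∀ j, IsWeakDeriv U j q (fun x => Dq x j)

/-- The vector field `v` lies in `H¹(U)²` and has the weak gradient `Dv`. -/
structure MemH1 (U : Set Pt) (v : Pt → Pt) (Dv : Pt → Mat) : Prop where
  memLp : MemLp v 2 (vol U)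
  memLp_grad : MemLp Dv 2 (vol U)
  weak : ∀ i j, IsWeakDeriv U j (fun x => v x i) (fun x => Dv x (i, j))

/-- The vector field `v` lies in `H¹₀(U)²`, the closure of `C_c^∞(U)²` in `H¹(U)²`, and has the
weak gradient `Dv`. -/
structure MemH10 (U : Set Pt) (v : Pt → Pt) (Dv : Pt → Mat) : Prop where
  memLp : MemLp v 2 (vol U)
  memLp_grad : MemLp Dv 2 (vol U)
  approx : ∃ φ : ℕ → Pt → Pt, (∀ n, IsTest U (φ n)) ∧
    Tendsto (fun n => eLpNorm (φ n - v) 2 (vol U)) atTop (𝓝 0) ∧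
    Tendsto (fun n => eLpNorm (gradC (φ n) - Dv) 2 (vol U)) atTop (𝓝 0)

/-- The vector field `f` lies in `H(curl, U)` and has the weak curl `c`. -/
structure MemHcurl (U : Set Pt) (f : Pt → Pt) (c : Pt → ℝ) : Prop where
  memLp : MemLp f 2 (vol U)
  memLp_curl : MemLp c 2 (vol U)
  weak : ∀ φ : Pt → ℝ, IsTest U φ →
    ∫ x, inner ℝ (f x) (rotC φ x) ∂(vol U) = -∫ x, c x * φ x ∂(vol U)

/-- The divergence, read off from the gradient. -/
def divOf (D : Mat) : ℝ := D (0, 0) + D (1, 1)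

/-- `q` lies in `L²₀(U)`. -/
structure MemL20 (U : Set Pt) (q : Pt → ℝ) : Prop where
  memLp : MemLp q 2 (vol U)
  mean : ∫ x, q x ∂(vol U) = 0

/-- `(u, p)`, with `Du = ∇u`, is a weak solution of the Stokes equations
`-ν Δu + ∇p = f`, `div u = 0` in `U` with Dirichlet data `u = u_D` along `∂U`, where the data are
given as the boundary values of some `uD ∈ H¹(U)²` with `DuD = ∇uD`. -/
structure IsStokesSolution (U : Set Pt) (ν : ℝ) (f : Pt → Pt) (uD : Pt → Pt) (DuD : Pt → Mat)
    (u : Pt → Pt) (Du : Pt → Mat) (p : Pt → ℝ) : Prop where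
  data : MemH1 U uD DuD
  velocity : MemH1 U u Du
  boundary : MemH10 U (u - uD) (Du - DuD)
  pressure : MemL20 U p
  momentum : ∀ (v : Pt → Pt) (Dv : Pt → Mat), MemH10 U v Dv →
    ν * ∫ x, inner ℝ (Du x) (Dv x) ∂(vol U) - ∫ x, p x * divOf (Dv x) ∂(vol U)
      = ∫ x, inner ℝ (f x) (v x) ∂(vol U)
  incompressible : ∀ q : Pt → ℝ, MemL20 U q → ∫ x, q x * divOf (Du x) ∂(vol U) = 0

/-! ### Triangulations -/

/-- A finite conforming triangulation: a finite simplicial complex in the plane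
in which every simplex belongs to a triangle. -/
structure IsTriangulation (K : Geometry.SimplicialComplex ℝ Pt) : Prop where
  finite : K.faces.Finite
  pure : ∀ s ∈ K.faces, ∃ T ∈ K.faces, T.card = 3 ∧ s ⊆ T

/-- The triangles of the triangulation, given by their vertices. -/
def triangles (K : Geometry.SimplicialComplex ℝ Pt) : Set (Finset Pt) :=
  {T | T ∈ K.faces ∧ T.card = 3}

/-- The triangulated domain. A bounded Lipschitz domain is the interior of its closure, and its
closure is the union of the triangles. -/
def domain (K : Geometry.SimplicialComplex ℝ Pt) : Set Pt := interior K.space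

/-- The open triangle with the vertices `T`. -/
def elem (T : Finset Pt) : Set Pt := interior (convexHull ℝ (T : Set Pt))

/-- The diameter `h_T` or `h_E` of the simplex with the given vertices. -/
def diam (s : Finset Pt) : ℝ := Metric.diam (convexHull ℝ (s : Set Pt))

/-- Shape regularity: every triangle contains a disc of radius `r` with `h_T ≤ γ r`. -/
def ShapeRegular (K : Geometry.SimplicialComplex ℝ Pt) (γ : ℝ) : Prop :=
  ∀ T ∈ triangles K, ∃ (x : Pt) (r : ℝ), 0 < r ∧
    Metric.closedBall x r ⊆ convexHull ℝ (T : Set Pt) ∧ diam T ≤ γ * r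

/-- `E` (given by its two vertices) is an inner edge of the triangulation, shared by the two
different triangles `T₁` and `T₂`. -/
structure IsInnerEdge (K : Geometry.SimplicialComplex ℝ Pt) (E T₁ T₂ : Finset Pt) : Prop where
  card : E.card = 2
  mem₁ : T₁ ∈ triangles K
  mem₂ : T₂ ∈ triangles K
  ne : T₁ ≠ T₂
  sub₁ : E ⊆ T₁
  sub₂ : E ⊆ T₂

/-- `τ` is one of the two unit tangential vectors of the edge `E`. -/
def IsUnitTangent (E : Finset Pt) (τ : Pt) : Prop :=
  ‖τ‖ = 1 ∧ τ ∈ vectorSpan ℝ (E : Set Pt)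

/-- Arc length on the edge `E`. -/
def arc (E : Finset Pt) : Measure Pt :=
  (Measure.hausdorffMeasure 1 : Measure Pt).restrict (convexHull ℝ (E : Set Pt))

/-- `g ∈ L²(E)` is the tangential trace `f|_T · τ` on the edge `E` of a field `f ∈ H(curl, T)`
with `curl f = c`: the limit of the traces of smooth fields that converge to `f` in `H(curl, T)`. -/
structure HasTangentialTrace (T E : Finset Pt) (τ : Pt) (f : Pt → Pt) (c g : Pt → ℝ) : Prop where
  memLp : MemLp g 2 (arc E)
  approx : ∃ ψ : ℕ → Pt → Pt, (∀ n, ContDiff ℝ ∞ (ψ n)) ∧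
    Tendsto (fun n => eLpNorm (ψ n - f) 2 (vol (elem T))) atTop (𝓝 0) ∧
    Tendsto (fun n => eLpNorm (curlC (ψ n) - c) 2 (vol (elem T))) atTop (𝓝 0) ∧
    Tendsto (fun n => eLpNorm (fun x => inner ℝ (ψ n x) τ - g x) 2 (arc E)) atTop (𝓝 0)

/-! ### Polynomials -/

/-- Polynomials in two variables. -/
abbrev Poly := MvPolynomial (Fin 2) ℝ

/-- The value of a polynomial at a point of the plane. -/
def val (P : Poly) (x : Pt) : ℝ := MvPolynomial.eval (fun i => x i) P

/-- The Laplacian of a polynomial. -/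
def lap (P : Poly) : Poly :=
  MvPolynomial.pderiv 0 (MvPolynomial.pderiv 0 P) +
    MvPolynomial.pderiv 1 (MvPolynomial.pderiv 1 P)

/-- The Laplacian `Δ P` of a polynomial vector field, as a function. -/
def lapVec (P : Fin 2 → Poly) (x : Pt) : Pt := !₂[val (lap (P 0)) x, val (lap (P 1)) x]

/-- `curl Δ P` of a polynomial vector field, as a function. -/
def curlLap (P : Fin 2 → Poly) (x : Pt) : ℝ :=
  val (MvPolynomial.pderiv 0 (lap (P 1)) - MvPolynomial.pderiv 1 (lap (P 0))) x

/-- `uh`, with `Duh = ∇uh`, lies in `P_m(𝒯)² ∩ H¹(Ω)²`, and `P T` is the polynomial vector field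
that agrees with `uh` on `T`. -/
structure IsDiscreteVelocity (K : Geometry.SimplicialComplex ℝ Pt) (m : ℕ)
    (uh : Pt → Pt) (Duh : Pt → Mat) (P : Finset Pt → Fin 2 → Poly) : Prop where
  memH1 : MemH1 (domain K) uh Duh
  degree : ∀ T ∈ triangles K, ∀ i, (P T i).totalDegree ≤ m
  eq : ∀ T ∈ triangles K, ∀ x ∈ elem T, ∀ i, uh x i = val (P T i) x

/-! ### Norms and oscillations -/

/-- The `L²` distance `‖(1 - π_{P_k}) g‖_{L²(μ)} = min_{q ∈ P_k} ‖g - q‖_{L²(μ)}` of a scalar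
function to the polynomials of degree at most `k`. -/
def distPoly (k : ℕ) (μ : Measure Pt) (g : Pt → ℝ) : ℝ :=
  ⨅ q : {q : Poly // q.totalDegree ≤ k}, lpNorm (fun x => g x - val q.1 x) 2 μ

/-- The same distance for vector fields. -/
def distPolyVec (k : ℕ) (μ : Measure Pt) (g : Pt → Pt) : ℝ :=
  Real.sqrt (∑ i, distPoly k μ (fun x => g x i) ^ 2)

/-- `osc_k(g, T) = h_T ‖(1 - π_{P_k(T)}) g‖_{L²(T)}`. -/
def osc (k : ℕ) (T : Finset Pt) (g : Pt → ℝ) : ℝ :=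
  diam T * distPoly k (vol (elem T)) g

/-- `osc_k(g, T)` for vector fields. -/
def oscVec (k : ℕ) (T : Finset Pt) (g : Pt → Pt) : ℝ :=
  diam T * distPolyVec k (vol (elem T)) g

/-- `osc_k(g, E) = h_E^{1/2} ‖(1 - π_{P_k(E)}) g‖_{L²(E)}`; the polynomials on `E` are the
restrictions of the polynomials on the plane. -/
def oscEdge (k : ℕ) (E : Finset Pt) (g : Pt → ℝ) : ℝ :=
  diam E ^ (1 / 2 : ℝ) * distPoly k (arc E) g

/-- The curl of the residual `f + ν Δ_𝒯 u_h` on an element on which `u_h` equals the polynomial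
field `P`, where `c` is the elementwise curl of `f`. -/
def curlRes (ν : ℝ) (c : Pt → ℝ) (P : Fin 2 → Poly) (x : Pt) : ℝ := c x + ν * curlLap P x

end

end StokesEff

open StokesEff

/-!
The divergence-free test functions `v = rot φ` (`rotC φ`), with `φ` smooth and compactly supported,
remove the pressure from the momentum equation. Integrating by parts twice turns `∫ ∇uh : ∇ rot φ`
into `∫ curl uh Δφ`, which needs no traces of `∇uh` (`integral_inner_gradC_rotC`), so that
`ν ∫ ∇(u - uh) : ∇ rot φ = ∫ f · rot φ - ν ∫ curl uh Δφ` (`error_identity`). Integrating back on the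
triangles exhibits the residual `f + ν Δ uh` tested with `rot φ`: its curl on a triangle
(`elem_identity`), and additionally its tangential jump on an edge (`edge_identity`).

As `rot φ` contains a derivative of `φ` and `∇ rot φ` two, the estimates follow from these
identities for a function `φ` that resembles the residual, has size `B` and second derivatives of
size `h⁻² B`, where `B` is the scaled norm of a polynomial approximation of the residual. Such
functions are polynomials times the square of a smooth cut-off function on a disc
(`exists_cell_bubble`, `exists_edge_bubble`), and equivalence of norms on the polynomials of bounded
degree provides their constants. The disc may be much smaller than the triangle, as a polynomial is
controlled on a large disc by its values on a small one; hence only the geometry of discs and half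
discs enters. On a triangle the disc is half of the inscribed one (`exists_elem_efficiency`). On an
edge it is centred at the midpoint and so small that each of the two triangles contains half of it
(`isOnSide_or`), and integration by parts is needed in half-planes only
(`integral_halfPlane_pd`).

On the edge, `φ` is chosen with vanishing normal derivative, so that the jump of `curl uh` drops out.
What remains is the jump of the normal derivative of `curl uh`, which is the jump of the tangential
derivative of `div uh` minus that of the tangential part of `Δ uh` (`fderiv_curlPoly_nrm`). The
former is controlled by an inverse estimate, since `div u` is constant (`exists_div_eq_const`) and
`div uh` thus differs from a constant by at most `2 |∇(u - uh)|` (`exists_fderiv_divPoly_bound`).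
The curl residuals of the two triangles are bounded by the estimate on triangles.
-/

namespace StokesEff

/-! ### Partial derivatives and polynomial functions -/

lemma fderiv_apply_eq (φ : Pt → ℝ) (x v : Pt) :
    fderiv ℝ φ x v = v 0 * pd 0 φ x + v 1 * pd 1 φ x := by
  have hv : v = v 0 • EuclideanSpace.single 0 (1 : ℝ) + v 1 • EuclideanSpace.single 1 (1 : ℝ) := by
    ext i; fin_cases i <;> simp
  conv_lhs => rw [hv]
  simp [pd]

lemma contDiff_pd {φ : Pt → ℝ} (h : ContDiff ℝ ∞ φ) (j : Fin 2) : ContDiff ℝ ∞ (pd j φ) := by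
  unfold pd
  exact (h.fderiv_right (m := ∞) (by simp)).clm_apply contDiff_const

lemma contDiff_differentiable {φ : Pt → ℝ} (h : ContDiff ℝ ∞ φ) : Differentiable ℝ φ :=
  h.differentiable (by simp)

lemma pd_add {φ ψ : Pt → ℝ} (hφ : Differentiable ℝ φ) (hψ : Differentiable ℝ ψ) (j : Fin 2)
    (x : Pt) : pd j (fun y => φ y + ψ y) x = pd j φ x + pd j ψ x := by
  simp [pd, fderiv_fun_add (hφ x) (hψ x)]

lemma pd_sub {φ ψ : Pt → ℝ} (hφ : Differentiable ℝ φ) (hψ : Differentiable ℝ ψ) (j : Fin 2)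
    (x : Pt) : pd j (fun y => φ y - ψ y) x = pd j φ x - pd j ψ x := by
  simp [pd, fderiv_fun_sub (hφ x) (hψ x)]

lemma pd_mul {φ ψ : Pt → ℝ} (hφ : Differentiable ℝ φ) (hψ : Differentiable ℝ ψ) (j : Fin 2)
    (x : Pt) : pd j (fun y => φ y * ψ y) x = φ x * pd j ψ x + pd j φ x * ψ x := by
  simp [pd, fderiv_fun_mul (hφ x) (hψ x)]; ring

lemma pd_neg (φ : Pt → ℝ) (j : Fin 2) (x : Pt) : pd j (fun y => -φ y) x = -pd j φ x := by
  simp [pd]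

lemma pd_const_mul {φ : Pt → ℝ} (hφ : Differentiable ℝ φ) (a : ℝ) (j : Fin 2)
    (x : Pt) : pd j (fun y => a * φ y) x = a * pd j φ x := by
  simp [pd, fderiv_const_mul (hφ x)]

lemma pd_comm {φ : Pt → ℝ} (h : ContDiff ℝ ∞ φ) (i j : Fin 2) (x : Pt) :
    pd i (pd j φ) x = pd j (pd i φ) x := by
  have key : ∀ a b : Fin 2, pd a (pd b φ) x =
      fderiv ℝ (fderiv ℝ φ) x (EuclideanSpace.single a 1) (EuclideanSpace.single b 1) := by
    intro a b
    have hd : DifferentiableAt ℝ (fderiv ℝ φ) x :=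
      ((h.fderiv_right (m := ∞) (by simp)).differentiable (by simp)) x
    unfold pd
    rw [fderiv_clm_apply hd (differentiableAt_const _)]
    simp
  rw [key, key]
  exact (h.contDiffAt.isSymmSndFDerivAt (by simpa using WithTop.coe_le_coe.2 (le_top : (2 : ℕ∞) ≤ ⊤))) _ _

lemma val_add (P Q : Poly) : val (P + Q) = fun x => val P x + val Q x := by
  funext x; simp [val]

lemma val_sub (P Q : Poly) : val (P - Q) = fun x => val P x - val Q x := by
  funext x; simp [val]

lemma val_mul_X (P : Poly) (i : Fin 2) : val (P * MvPolynomial.X i) = fun x => val P x * x i := by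
  funext x; simp [val]

lemma contDiff_val (P : Poly) : ContDiff ℝ ∞ (val P) := by
  induction P using MvPolynomial.induction_on with
  | C a =>
    have : val (MvPolynomial.C a) = fun _ => a := by funext x; simp [val]
    rw [this]; exact contDiff_const
  | add P Q hP hQ => rw [val_add]; exact hP.add hQ
  | mul_X P i hP => rw [val_mul_X]; exact hP.mul (by fun_prop)

lemma pd_coord (i j : Fin 2) (x : Pt) : pd j (fun y : Pt => y i) x = if i = j then 1 else 0 := by
  have : (fun y : Pt => y i) = fun y => (EuclideanSpace.proj (𝕜 := ℝ) i : Pt →L[ℝ] ℝ) y := rfl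
  rw [pd, this, ContinuousLinearMap.fderiv]
  simp

lemma pd_val (P : Poly) (j : Fin 2) : pd j (val P) = val (MvPolynomial.pderiv j P) := by
  induction P using MvPolynomial.induction_on with
  | C a =>
    have : val (MvPolynomial.C a) = fun _ => a := by funext x; simp [val]
    funext x
    rw [this]; simp [pd, val]
  | add P Q hP hQ =>
    funext x
    rw [val_add, pd_add (contDiff_differentiable (contDiff_val P))
      (contDiff_differentiable (contDiff_val Q)), hP, hQ, map_add, val_add]
  | mul_X P i hP =>
    funext x
    rw [val_mul_X, pd_mul (contDiff_differentiable (contDiff_val P)) (by fun_prop), hP, pd_coord,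
      Derivation.leibniz, val_add]
    simp [val, MvPolynomial.pderiv_X, Pi.single_apply]
    by_cases hij : i = j
    · subst hij; simp; ring
    · simp [hij]; ring

/-- The chain rule for an affine similarity of the plane. -/
lemma fderiv_comp_similarity {g : Pt → ℝ} (hg : Differentiable ℝ g) (e : Pt ≃ₗᵢ[ℝ] Pt) (x0 : Pt)
    (a : ℝ) (x v : Pt) :
    fderiv ℝ (fun x => g (a • e.symm (x - x0))) x v =
      a * fderiv ℝ g (a • e.symm (x - x0)) (e.symm v) := by
  have h1 : HasFDerivAt (fun x : Pt => a • e.symm (x - x0))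
      (a • (e.symm.toContinuousLinearEquiv : Pt →L[ℝ] Pt)) x := by
    have h2 : HasFDerivAt (fun x : Pt => e.symm (x - x0))
        (e.symm.toContinuousLinearEquiv : Pt →L[ℝ] Pt) x := by
      have := (e.symm.toContinuousLinearEquiv : Pt →L[ℝ] Pt).hasFDerivAt (x := x - x0)
      exact this.comp x ((hasFDerivAt_id x).sub_const x0)
    exact h2.const_smul a
  have h3 := (hg (a • e.symm (x - x0))).hasFDerivAt.comp x h1
  rw [show (fun x => g (a • e.symm (x - x0))) = g ∘ (fun x => a • e.symm (x - x0)) from rfl,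
    h3.fderiv]
  simp

lemma pd_comp_similarity {g : Pt → ℝ} (hg : Differentiable ℝ g) (e : Pt ≃ₗᵢ[ℝ] Pt) (x0 : Pt)
    (a : ℝ) (i : Fin 2) (x : Pt) :
    pd i (fun x => g (a • e.symm (x - x0))) x =
      a * ((e.symm (EuclideanSpace.single i 1)) 0 * pd 0 g (a • e.symm (x - x0))
        + (e.symm (EuclideanSpace.single i 1)) 1 * pd 1 g (a • e.symm (x - x0))) := by
  rw [pd, fderiv_comp_similarity hg, fderiv_apply_eq]

lemma abs_coord_le_norm (x : Pt) (i : Fin 2) : |x i| ≤ ‖x‖ := by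
  simpa using PiLp.norm_apply_le x i

lemma abs_isometry_single_le (e : Pt ≃ₗᵢ[ℝ] Pt) (i k : Fin 2) :
    |(e (EuclideanSpace.single i 1)) k| ≤ 1 := by
  refine (abs_coord_le_norm _ _).trans ?_
  simp

lemma abs_lincomb_le {a b p q K : ℝ} (ha : |a| ≤ 1) (hb : |b| ≤ 1) (hp : |p| ≤ K) (hq : |q| ≤ K) :
    |a * p + b * q| ≤ 2 * K := by
  have h1 : |a * p| ≤ K := by
    rw [abs_mul]; nlinarith [abs_nonneg a, abs_nonneg p]
  have h2 : |b * q| ≤ K := by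
    rw [abs_mul]; nlinarith [abs_nonneg b, abs_nonneg q]
  linarith [abs_add_le (a * p) (b * q)]

lemma abs_pd_comp_similarity_le {g : Pt → ℝ} (hg : Differentiable ℝ g) (e : Pt ≃ₗᵢ[ℝ] Pt)
    (x0 : Pt) {a K : ℝ} (ha : 0 ≤ a) (x : Pt)
    (hK : ∀ k, |pd k g (a • e.symm (x - x0))| ≤ K) (i : Fin 2) :
    |pd i (fun x => g (a • e.symm (x - x0))) x| ≤ a * (2 * K) := by
  rw [pd_comp_similarity hg, abs_mul, abs_of_nonneg ha]
  exact mul_le_mul_of_nonneg_left (abs_lincomb_le (abs_isometry_single_le _ _ _)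
    (abs_isometry_single_le _ _ _) (hK 0) (hK 1)) ha

lemma abs_pd_pd_comp_similarity_le {g : Pt → ℝ} (hg : ContDiff ℝ ∞ g) (e : Pt ≃ₗᵢ[ℝ] Pt)
    (x0 : Pt) {a K : ℝ} (ha : 0 ≤ a) (x : Pt)
    (hK : ∀ k l, |pd k (pd l g) (a • e.symm (x - x0))| ≤ K) (i j : Fin 2) :
    |pd i (pd j (fun x => g (a • e.symm (x - x0)))) x| ≤ a ^ 2 * (4 * K) := by
  have h1 : pd j (fun x => g (a • e.symm (x - x0))) = fun x =>
      (fun y => a * ((e.symm (EuclideanSpace.single j 1)) 0 * pd 0 g y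
        + (e.symm (EuclideanSpace.single j 1)) 1 * pd 1 g y)) (a • e.symm (x - x0)) := by
    funext x
    exact pd_comp_similarity (contDiff_differentiable hg) e x0 a j x
  have d0 := contDiff_differentiable (contDiff_pd hg 0)
  have d1 := contDiff_differentiable (contDiff_pd hg 1)
  rw [h1]
  have := abs_pd_comp_similarity_le (g := fun y => a * ((e.symm (EuclideanSpace.single j 1)) 0 *
    pd 0 g y + (e.symm (EuclideanSpace.single j 1)) 1 * pd 1 g y)) (by fun_prop) e x0 ha x
    (K := a * (2 * K)) ?_ i
  · calc _ ≤ _ := this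
      _ = _ := by ring
  · intro k
    rw [pd_const_mul (by fun_prop), pd_add (by fun_prop) (by fun_prop), pd_const_mul d0,
      pd_const_mul d1, abs_mul, abs_of_nonneg ha]
    exact mul_le_mul_of_nonneg_left (abs_lincomb_le (abs_isometry_single_le _ _ _)
      (abs_isometry_single_le _ _ _) (hK k 0) (hK k 1)) ha

/-! ### Equivalence of norms on finite-dimensional spaces of functions -/

lemma exists_norm_le_of_injective {V W₁ W₂ : Type*} [AddCommGroup V] [Module ℝ V]
    [FiniteDimensional ℝ V] [NormedAddCommGroup W₁] [NormedSpace ℝ W₁] [NormedAddCommGroup W₂]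
    [NormedSpace ℝ W₂] (F : V →ₗ[ℝ] W₁) (G : V →ₗ[ℝ] W₂) (hG : Function.Injective G) :
    ∃ C : ℝ, 0 < C ∧ ∀ v, ‖F v‖ ≤ C * ‖G v‖ := by
  let L := LinearEquiv.ofInjective G hG
  let H : LinearMap.range G →L[ℝ] W₁ := (F ∘ₗ L.symm.toLinearMap).toContinuousLinearMap
  refine ⟨‖H‖ + 1, by positivity, fun v => ?_⟩
  have h1 : H (L v) = F v := by simp [H]
  have h2 := H.le_opNorm (L v)
  rw [h1] at h2
  have h3 : ‖L v‖ = ‖G v‖ := by simp [L]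
  rw [h3] at h2
  nlinarith [norm_nonneg (G v)]

lemma norm_toLp_eq_sqrt {Y : Type*} [MeasurableSpace Y] {μ : Measure Y} {g : Y → ℝ}
    (hg : MemLp g 2 μ) : ‖hg.toLp g‖ = √(∫ y, g y ^ 2 ∂μ) := by
  rw [Lp.norm_toLp, toReal_eLpNorm hg.1,
    lpNorm_eq_integral_norm_rpow_toReal (by simp) (by simp) hg.1, Real.sqrt_eq_rpow]
  norm_num

/-- On a finite-dimensional space of functions, any linear family of continuous functions is
controlled, uniformly on a compact set, by any quadratic norm. -/
lemma exists_sup_le_L2 {V X Y : Type*} [AddCommGroup V] [Module ℝ V] [FiniteDimensional ℝ V]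
    [TopologicalSpace X] [MeasurableSpace Y] (μ : Measure Y) {S : Set X} (hS : IsCompact S)
    (F : V →ₗ[ℝ] X → ℝ) (hF : ∀ v, Continuous (F v)) (G : V →ₗ[ℝ] Y → ℝ)
    (hG : ∀ v, MemLp (G v) 2 μ) (hinj : ∀ v, G v =ᵐ[μ] 0 → v = 0) :
    ∃ C : ℝ, 0 < C ∧ ∀ v, ∀ x ∈ S, |F v x| ≤ C * √(∫ y, G v y ^ 2 ∂μ) := by
  have : CompactSpace S := isCompact_iff_compactSpace.1 hS
  let F' : V →ₗ[ℝ] C(S, ℝ) :=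
    { toFun := fun v => ⟨fun x => F v x, (hF v).comp continuous_subtype_val⟩
      map_add' := fun v w => by ext x; simp
      map_smul' := fun a v => by ext x; simp }
  let G' : V →ₗ[ℝ] Lp ℝ 2 μ :=
    { toFun := fun v => (hG v).toLp (G v)
      map_add' := fun v w => by
        rw [← MemLp.toLp_add]
        exact MemLp.toLp_congr _ _ (by rw [map_add])
      map_smul' := fun a v => by
        rw [RingHom.id_apply, ← MemLp.toLp_const_smul]
        exact MemLp.toLp_congr _ _ (by rw [map_smul]) }
  have hG' : Function.Injective G' := by
    rw [← LinearMap.ker_eq_bot, LinearMap.ker_eq_bot']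
    intro v hv
    refine hinj v ?_
    have : (hG v).toLp (G v) = 0 := hv
    exact (Lp.eq_zero_iff_ae_eq_zero.1 this) |>.symm.trans ((hG v).coeFn_toLp) |>.symm
  obtain ⟨C, hC, h⟩ := exists_norm_le_of_injective F' G' hG'
  refine ⟨C, hC, fun v x hx => ?_⟩
  have h1 := h v
  have h2 : ‖G' v‖ = √(∫ y, G v y ^ 2 ∂μ) := norm_toLp_eq_sqrt (hG v)
  rw [h2] at h1
  exact ((F' v).norm_coe_le_norm ⟨x, hx⟩).trans h1

/-! ### Bubble functions -/

/-- A radial smooth bump function that is positive exactly on the open unit disc. -/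
noncomputable def bump (y : Pt) : ℝ := Real.smoothTransition (1 - ‖y‖ ^ 2)

lemma contDiff_bump : ContDiff ℝ ∞ bump :=
  Real.smoothTransition.contDiff.comp (contDiff_const.sub (contDiff_norm_sq ℝ))

lemma bump_nonneg (y : Pt) : 0 ≤ bump y := Real.smoothTransition.nonneg _

lemma bump_le_one (y : Pt) : bump y ≤ 1 := Real.smoothTransition.le_one _

lemma bump_eq_zero {y : Pt} (h : 1 ≤ ‖y‖) : bump y = 0 :=
  Real.smoothTransition.zero_of_nonpos (by nlinarith)

lemma bump_pos {y : Pt} (h : ‖y‖ < 1) : 0 < bump y :=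
  Real.smoothTransition.pos_of_pos (by nlinarith [norm_nonneg y])

lemma bump_sq_le_one (y : Pt) : bump y ^ 2 ≤ 1 := pow_le_one₀ (bump_nonneg y) (bump_le_one y)

lemma hasCompactSupport_bump : HasCompactSupport bump :=
  HasCompactSupport.intro (isCompact_closedBall (0 : Pt) 1) fun y hy =>
    bump_eq_zero (by simpa using (not_le.1 (mt mem_closedBall_zero_iff.2 hy)).le)

/-- The partial derivative of a linear family of smooth functions. -/
noncomputable def pdLin {V : Type*} [AddCommGroup V] [Module ℝ V] (g : V →ₗ[ℝ] Pt → ℝ)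
    (hg : ∀ v, ContDiff ℝ ∞ (g v)) (j : Fin 2) : V →ₗ[ℝ] Pt → ℝ where
  toFun v := pd j (g v)
  map_add' v w := by
    funext x
    rw [map_add]
    exact pd_add (contDiff_differentiable (hg v)) (contDiff_differentiable (hg w)) j x
  map_smul' a v := by
    funext x
    rw [map_smul]
    exact pd_const_mul (contDiff_differentiable (hg v)) a j x

/-- Multiplication of a linear family of functions by a fixed function. -/
def mulLin {V X : Type*} [AddCommGroup V] [Module ℝ V] (b : X → ℝ) (g : V →ₗ[ℝ] X → ℝ) :
    V →ₗ[ℝ] X → ℝ where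
  toFun v x := b x * g v x
  map_add' v w := by funext x; simp [mul_add]
  map_smul' a v := by funext x; simp; ring

lemma pd_pd_eq_zero_of_norm_gt {g : Pt → ℝ} (hg : ∀ y, 1 ≤ ‖y‖ → g y = 0) (k l : Fin 2) {y : Pt}
    (hy : 1 < ‖y‖) : pd k (pd l g) y = 0 := by
  have ho : IsOpen {y : Pt | 1 < ‖y‖} := isOpen_lt continuous_const continuous_norm
  have h1 : ∀ z ∈ {y : Pt | 1 < ‖y‖}, pd l g z = 0 := by
    intro z hz
    have : g =ᶠ[𝓝 z] fun _ => 0 := by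
      filter_upwards [ho.mem_nhds hz] with w hw using hg w (le_of_lt hw)
    simp [pd, this.fderiv_eq]
  have : pd l g =ᶠ[𝓝 y] fun _ => 0 := by
    filter_upwards [ho.mem_nhds hy] with w hw using h1 w hw
  rw [pd, this.fderiv_eq]; simp

/-- The norm equivalences behind every bubble function argument, on the reference disc. The family
`g` consists of bubble functions, the family `q` of polynomials. -/
lemma exists_reference_bounds {V Y Z : Type*} [AddCommGroup V] [Module ℝ V]
    [FiniteDimensional ℝ V] [MeasurableSpace Y] (μ : Measure Y) [TopologicalSpace Z]
    {S : Set Z} (hS : IsCompact S) (q : V →ₗ[ℝ] Z → ℝ) (hq : ∀ v, Continuous (q v))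
    (g : V →ₗ[ℝ] Pt → ℝ) (hg : ∀ v, ContDiff ℝ ∞ (g v)) (hg0 : ∀ v y, 1 ≤ ‖y‖ → g v y = 0)
    (G : V →ₗ[ℝ] Y → ℝ) (hG : ∀ v, MemLp (G v) 2 μ) (hinj : ∀ v, G v =ᵐ[μ] 0 → v = 0) :
    ∃ C : ℝ, 0 < C ∧ ∀ v, (∀ z ∈ S, |q v z| ≤ C * √(∫ y, G v y ^ 2 ∂μ)) ∧
      (∀ y, |g v y| ≤ C * √(∫ y, G v y ^ 2 ∂μ)) ∧
      ∀ k l y, |pd k (pd l (g v)) y| ≤ C * √(∫ y, G v y ^ 2 ∂μ) := by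
  obtain ⟨C₁, hC₁, h₁⟩ := exists_sup_le_L2 μ hS q hq G hG hinj
  obtain ⟨C₂, hC₂, h₂⟩ := exists_sup_le_L2 μ (isCompact_closedBall (0 : Pt) 1) g
    (fun v => (hg v).continuous) G hG hinj
  have h₃ : ∀ k l : Fin 2, ∃ C : ℝ, 0 < C ∧ ∀ v, ∀ y ∈ Metric.closedBall (0 : Pt) 1,
      |pd k (pd l (g v)) y| ≤ C * √(∫ y, G v y ^ 2 ∂μ) := fun k l =>
    exists_sup_le_L2 μ (isCompact_closedBall (0 : Pt) 1)
      (pdLin (pdLin g hg l) (fun v => contDiff_pd (hg v) l) k)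
      (fun v => (contDiff_pd (contDiff_pd (hg v) l) k).continuous) G hG hinj
  choose C₃ hC₃ h₃ using h₃
  have hs : ∀ k l, C₃ k l ≤ ∑ k, ∑ l, C₃ k l := fun k l =>
    (Finset.single_le_sum (f := fun l => C₃ k l) (fun l _ => (hC₃ k l).le) (Finset.mem_univ l)).trans
      (Finset.single_le_sum (f := fun k => ∑ l, C₃ k l)
        (fun k _ => Finset.sum_nonneg fun l _ => (hC₃ k l).le) (Finset.mem_univ k))
  have hs0 : 0 ≤ ∑ k, ∑ l, C₃ k l :=
    Finset.sum_nonneg fun k _ => Finset.sum_nonneg fun l _ => (hC₃ k l).le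
  refine ⟨C₁ + C₂ + ∑ k, ∑ l, C₃ k l, by positivity, fun v => ⟨fun z hz => ?_, fun y => ?_,
    fun k l y => ?_⟩⟩
  · refine (h₁ v z hz).trans (mul_le_mul_of_nonneg_right ?_ (Real.sqrt_nonneg _))
    linarith
  · rcases le_or_gt 1 ‖y‖ with hy | hy
    · rw [hg0 v y hy, abs_zero]; positivity
    · refine (h₂ v y (by simpa using hy.le)).trans
        (mul_le_mul_of_nonneg_right ?_ (Real.sqrt_nonneg _))
      linarith
  · rcases lt_or_ge 1 ‖y‖ with hy | hy
    · rw [pd_pd_eq_zero_of_norm_gt (hg0 v) k l hy, abs_zero]; positivity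
    · refine (h₃ k l v y (by simpa using hy)).trans
        (mul_le_mul_of_nonneg_right ?_ (Real.sqrt_nonneg _))
      linarith [hs k l]

/-- Polynomials of bounded total degree as functions on the plane. -/
noncomputable def valLin (N : ℕ) : MvPolynomial.restrictTotalDegree (Fin 2) ℝ N →ₗ[ℝ] Pt → ℝ where
  toFun P := val P.1
  map_add' P Q := by funext x; simp [val]
  map_smul' a P := by funext x; simp [val]

/-- A polynomial that vanishes on the unit disc vanishes on a square inside it, hence is zero. -/
lemma eq_zero_of_val_eq_zero {P : Poly} (h : ∀ x : Pt, ‖x‖ < 1 → val P x = 0) : P = 0 := by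
  refine MvPolynomial.funext_set (fun _ => Set.Ioo (-1 / 2 : ℝ) (1 / 2))
    (fun _ => Set.Ioo_infinite (by norm_num)) fun x hx => ?_
  have h0 := hx 0 trivial
  have h1 := hx 1 trivial
  have hn : ‖(WithLp.toLp 2 x : Pt)‖ < 1 := by
    rw [EuclideanSpace.norm_eq, Real.sqrt_lt' one_pos]
    simp only [Fin.sum_univ_two, Real.norm_eq_abs, sq_abs]
    have a0 : x 0 ^ 2 < 1 / 4 := by nlinarith [h0.1, h0.2]
    have a1 : x 1 ^ 2 < 1 / 4 := by nlinarith [h1.1, h1.2]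
    norm_num; linarith
  simpa [val] using h _ hn

/-- The reference bounds for the bubble functions `bump² P` on the unit disc, with the norm
`‖bump P‖` of `L²`, the square root of the integral of `bump² P` against `P`. -/
lemma exists_cell_reference_bounds (N : ℕ) (R : ℝ) :
    ∃ C : ℝ, 0 < C ∧ ∀ P : Poly, P.totalDegree ≤ N →
      (∀ y ∈ Metric.closedBall (0 : Pt) R,
        |val P y| ≤ C * √(∫ y, (bump y * val P y) ^ 2)) ∧
      (∀ i, ∀ y ∈ Metric.closedBall (0 : Pt) R,
        |pd i (val P) y| ≤ C * √(∫ y, (bump y * val P y) ^ 2)) ∧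
      (∀ y, |bump y ^ 2 * val P y| ≤ C * √(∫ y, (bump y * val P y) ^ 2)) ∧
      ∀ k l y, |pd k (pd l (fun y => bump y ^ 2 * val P y)) y| ≤
        C * √(∫ y, (bump y * val P y) ^ 2) := by
  have hq : ∀ v, ContDiff ℝ ∞ (valLin N v) := fun v => contDiff_val v.1
  have hg : ∀ v, ContDiff ℝ ∞ (mulLin (fun y => bump y ^ 2) (valLin N) v) := fun v =>
    (contDiff_bump.pow 2).mul (hq v)
  have hg0 : ∀ v y, 1 ≤ ‖y‖ → mulLin (fun y => bump y ^ 2) (valLin N) v y = 0 := fun v y hy => by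
    simp [mulLin, bump_eq_zero hy]
  have hGc : ∀ v, Continuous (mulLin bump (valLin N) v) := fun v =>
    contDiff_bump.continuous.mul (hq v).continuous
  have hG : ∀ v, MemLp (mulLin bump (valLin N) v) 2 volume := fun v =>
    (hGc v).memLp_of_hasCompactSupport (hasCompactSupport_bump.mul_right)
  have hinj : ∀ v, mulLin bump (valLin N) v =ᵐ[volume] 0 → v = 0 := by
    intro v hv
    have h0 : mulLin bump (valLin N) v = 0 :=
      (Continuous.ae_eq_iff_eq volume (hGc v) continuous_const).1 hv
    refine Subtype.ext (eq_zero_of_val_eq_zero fun x hx => ?_)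
    have := congrFun h0 x
    exact (mul_eq_zero.1 this).resolve_left (bump_pos hx).ne'
  have hb : ∀ q : _ →ₗ[ℝ] Pt → ℝ, (∀ v, Continuous (q v)) → _ := fun q hq' =>
    exists_reference_bounds volume (isCompact_closedBall (0 : Pt) R) q hq' _ hg hg0 _ hG hinj
  obtain ⟨C, hC, h⟩ := hb (valLin N) fun v => (hq v).continuous
  obtain ⟨C₀, hC₀, h₀⟩ := hb (pdLin (valLin N) hq 0) fun v => (contDiff_pd (hq v) 0).continuous
  obtain ⟨C₁, hC₁, h₁⟩ := hb (pdLin (valLin N) hq 1) fun v => (contDiff_pd (hq v) 1).continuous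
  refine ⟨C + C₀ + C₁, by positivity, fun P hP => ?_⟩
  let v : MvPolynomial.restrictTotalDegree (Fin 2) ℝ N :=
    ⟨P, (MvPolynomial.mem_restrictTotalDegree _ _ _).2 hP⟩
  have hs := Real.sqrt_nonneg (∫ y, (bump y * val P y) ^ 2)
  have e1 : C * √(∫ y, (bump y * val P y) ^ 2) ≤
    (C + C₀ + C₁) * √(∫ y, (bump y * val P y) ^ 2) :=
    mul_le_mul_of_nonneg_right (by linarith) hs
  refine ⟨fun y hy => ((h v).1 y hy).trans e1, fun i y hy => ?_, fun y => ((h v).2.1 y).trans e1,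
    fun k l y => ((h v).2.2 k l y).trans e1⟩
  fin_cases i
  · exact ((h₀ v).1 y hy).trans (mul_le_mul_of_nonneg_right (by linarith) hs)
  · exact ((h₁ v).1 y hy).trans (mul_le_mul_of_nonneg_right (by linarith) hs)

/-- Univariate polynomials of bounded degree as functions on the line. -/
noncomputable def evalLin (N : ℕ) : Polynomial.degreeLT ℝ (N + 1) →ₗ[ℝ] ℝ → ℝ where
  toFun p s := p.1.eval s
  map_add' P Q := by funext x; simp
  map_smul' a P := by funext x; simp

/-- Univariate polynomials in the first coordinate as functions on the plane. -/
noncomputable def evalFstLin (N : ℕ) : Polynomial.degreeLT ℝ (N + 1) →ₗ[ℝ] Pt → ℝ where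
  toFun p y := p.1.eval (y 0)
  map_add' P Q := by funext x; simp
  map_smul' a P := by funext x; simp

lemma norm_fst (s : ℝ) : ‖(!₂[s, 0] : Pt)‖ = |s| := by
  simp [EuclideanSpace.norm_eq, Real.sqrt_sq_eq_abs]

lemma continuous_fst : Continuous fun s : ℝ => (!₂[s, 0] : Pt) := by
  refine (PiLp.continuous_toLp 2 _).comp (continuous_pi fun i => ?_)
  fin_cases i <;> simp <;> fun_prop

/-- The reference bounds for the extensions to the plane of the bubble functions `bump² p` on the
first coordinate axis, with the norm `‖bump p‖` of `L²` on this axis. -/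
lemma exists_edge_reference_bounds (N : ℕ) (R : ℝ) :
    ∃ C : ℝ, 0 < C ∧ ∀ p : Polynomial ℝ, p.natDegree ≤ N →
      (∀ s ∈ Set.Icc (-R) R, |p.eval s| ≤ C * √(∫ s : ℝ, (bump !₂[s, 0] * p.eval s) ^ 2)) ∧
      (∀ y : Pt, |bump y ^ 2 * p.eval (y 0)| ≤ C * √(∫ s : ℝ, (bump !₂[s, 0] * p.eval s) ^ 2)) ∧
      ∀ k l y, |pd k (pd l (fun y : Pt => bump y ^ 2 * p.eval (y 0))) y| ≤
        C * √(∫ s : ℝ, (bump !₂[s, 0] * p.eval s) ^ 2) := by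
  have : FiniteDimensional ℝ (Polynomial.degreeLT ℝ (N + 1)) :=
    Module.Finite.equiv (Polynomial.degreeLTEquiv ℝ (N + 1)).symm
  have hg : ∀ v, ContDiff ℝ ∞ (mulLin (fun y => bump y ^ 2) (evalFstLin N) v) := fun v => by
    refine (contDiff_bump.pow 2).mul ?_
    change ContDiff ℝ ∞ fun y : Pt => v.1.eval (y 0)
    have : ContDiff ℝ ∞ fun s : ℝ => v.1.eval s := by
      simpa using Polynomial.contDiff_aeval (𝕜 := ℝ) v.1 ∞
    exact this.comp (by fun_prop)
  have hg0 : ∀ v y, 1 ≤ ‖y‖ → mulLin (fun y => bump y ^ 2) (evalFstLin N) v y = 0 :=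
    fun v y hy => by simp [mulLin, bump_eq_zero hy]
  have hGc : ∀ v, Continuous (mulLin (fun s : ℝ => bump !₂[s, 0]) (evalLin N) v) := fun v =>
    (contDiff_bump.continuous.comp continuous_fst).mul v.1.continuous
  have hG : ∀ v, MemLp (mulLin (fun s : ℝ => bump !₂[s, 0]) (evalLin N) v) 2 volume := fun v => by
    refine (hGc v).memLp_of_hasCompactSupport
      (HasCompactSupport.intro (isCompact_Icc (a := (-1 : ℝ)) (b := 1)) fun s hs => ?_)
    have : 1 ≤ |s| := by
      by_contra! h
      exact hs ⟨by linarith [(abs_lt.1 h).1], (abs_lt.1 h).2.le⟩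
    simp [mulLin, bump_eq_zero ((norm_fst s).symm ▸ this)]
  have hinj : ∀ v, mulLin (fun s : ℝ => bump !₂[s, 0]) (evalLin N) v =ᵐ[volume] 0 → v = 0 := by
    intro v hv
    have h0 : mulLin (fun s : ℝ => bump !₂[s, 0]) (evalLin N) v = 0 :=
      (Continuous.ae_eq_iff_eq volume (hGc v) continuous_const).1 hv
    refine Subtype.ext (Polynomial.eq_zero_of_infinite_isRoot _
      ((Set.Ioo_infinite (show (-1 : ℝ) < 1 by norm_num)).mono fun s hs => ?_))
    have := congrFun h0 s
    exact (mul_eq_zero.1 this).resolve_left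
      (bump_pos ((norm_fst s).symm ▸ abs_lt.2 hs)).ne'
  obtain ⟨C, hC, h⟩ := exists_reference_bounds volume (isCompact_Icc (a := -R) (b := R))
    (evalLin N) (fun v => v.1.continuous) _ hg hg0 _ hG hinj
  refine ⟨C, hC, fun p hp => h ⟨p, Polynomial.mem_degreeLT.2 ?_⟩⟩
  exact (Polynomial.degree_le_natDegree).trans_lt (by exact_mod_cast Nat.lt_succ_of_le hp)

/-! ### Bubble functions on discs of arbitrary size -/

lemma totalDegree_aeval_le {N : ℕ} (P : Poly) (hP : P.totalDegree ≤ N) (f : Fin 2 → Poly)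
    (hf : ∀ i, (f i).totalDegree ≤ 1) : (MvPolynomial.aeval f P).totalDegree ≤ N := by
  rw [MvPolynomial.aeval_def, MvPolynomial.eval₂]
  refine (MvPolynomial.totalDegree_finsetSum _ _).trans (Finset.sup_le fun d hd => ?_)
  refine (MvPolynomial.totalDegree_mul _ _).trans ?_
  have h1 : (algebraMap ℝ Poly (P.coeff d)).totalDegree = 0 := by
    rw [MvPolynomial.algebraMap_eq, MvPolynomial.totalDegree_C]
  have h2 : (∏ i ∈ d.support, f i ^ d i).totalDegree ≤ ∑ i ∈ d.support, d i := by
    refine (MvPolynomial.totalDegree_finsetProd _ _).trans (Finset.sum_le_sum fun i _ => ?_)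
    refine (MvPolynomial.totalDegree_pow _ _).trans ?_
    simpa using Nat.mul_le_mul_left (d i) (hf i)
  have h3 : ∑ i ∈ d.support, d i ≤ P.totalDegree :=
    Finset.le_sup (f := fun s : Fin 2 →₀ ℕ => s.sum fun _ e => e) hd
  change (algebraMap ℝ Poly (P.coeff d)).totalDegree + _ ≤ N
  rw [h1, zero_add]
  exact h2.trans (h3.trans hP)

lemma val_aeval (P : Poly) (f : Fin 2 → Poly) (y : Pt) :
    val (MvPolynomial.aeval f P) y = val P (WithLp.toLp 2 fun i => val (f i) y) := by
  simp only [val]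
  induction P using MvPolynomial.induction_on with
  | C a => simp
  | add P Q hP hQ => simp only [map_add, hP, hQ]
  | mul_X P i hP => simp only [map_mul, MvPolynomial.aeval_X, MvPolynomial.eval_X, hP]

/-- Polynomials of degree at most `N` are stable under homotheties. -/
lemma exists_poly_comp_homothety {N : ℕ} (P : Poly) (hP : P.totalDegree ≤ N) (x0 : Pt) (l : ℝ) :
    ∃ Q : Poly, Q.totalDegree ≤ N ∧ ∀ y, val Q y = val P (x0 + l • y) := by
  refine ⟨MvPolynomial.aeval
    (fun i => MvPolynomial.C (x0 i) + MvPolynomial.C l * MvPolynomial.X i) P,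
    totalDegree_aeval_le P hP _ fun i => ?_, fun y => ?_⟩
  · refine (MvPolynomial.totalDegree_add _ _).trans (max_le (by simp) ?_)
    refine (MvPolynomial.totalDegree_mul _ _).trans (by simp)
  · rw [val_aeval]
    congr 1
    ext i
    simp [val]

/-- Polynomials of degree at most `N` restrict to such polynomials on every line. -/
lemma exists_poly_comp_line {N : ℕ} (P : Poly) (hP : P.totalDegree ≤ N) (x0 v : Pt) :
    ∃ p : Polynomial ℝ, p.natDegree ≤ N ∧ ∀ s, p.eval s = val P (x0 + s • v) := by
  refine ⟨MvPolynomial.aeval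
    (fun i => Polynomial.C (x0 i) + Polynomial.C (v i) * Polynomial.X) P, ?_, fun s => ?_⟩
  · simpa using MvPolynomial.aeval_natDegree_le P hP
      (fun i => Polynomial.C (x0 i) + Polynomial.C (v i) * Polynomial.X) (n := 1) fun i => by
        compute_degree
  · simp only [val]
    clear hP
    induction P using MvPolynomial.induction_on with
    | C a => simp
    | add P Q hP hQ => simp only [map_add, Polynomial.eval_add, hP, hQ]
    | mul_X P i hP =>
      simp only [map_mul, Polynomial.eval_mul, MvPolynomial.aeval_X, MvPolynomial.eval_X, hP]
      congr 1
      simp only [Polynomial.eval_add, Polynomial.eval_mul, Polynomial.eval_C, Polynomial.eval_X,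
        PiLp.add_apply, PiLp.smul_apply, smul_eq_mul]
      ring

lemma integral_comp_homothety (F : Pt → ℝ) (x0 : Pt) {l : ℝ} (hl : 0 < l) :
    ∫ x, F x = l ^ 2 * ∫ y, F (x0 + l • y) := by
  have h1 := Measure.integral_comp_smul (volume : Measure Pt) (fun y => F (x0 + y)) l
  rw [h1, integral_add_left_eq_self (fun x => F x) x0]
  have : Module.finrank ℝ Pt = 2 := by simp
  rw [this, abs_of_nonneg (by positivity), smul_eq_mul, ← mul_assoc,
    mul_inv_cancel₀ (by positivity), one_mul]

lemma integral_comp_scale (F : ℝ → ℝ) {l : ℝ} (hl : 0 < l) :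
    ∫ x, F x = l * ∫ y, F (l * y) := by
  have h1 := Measure.integral_comp_mul_left F l
  rw [h1, abs_of_nonneg (by positivity), smul_eq_mul, ← mul_assoc,
    mul_inv_cancel₀ (by positivity), one_mul]

lemma contDiff_comp_similarity {g : Pt → ℝ} (hg : ContDiff ℝ ∞ g) (e : Pt ≃ₗᵢ[ℝ] Pt) (x0 : Pt)
    (a : ℝ) : ContDiff ℝ ∞ fun x => g (a • e.symm (x - x0)) :=
  hg.comp ((e.symm.contDiff.comp (contDiff_id.sub contDiff_const)).const_smul a)

lemma tsupport_comp_similarity_subset {g : Pt → ℝ} (hg : ∀ y, 1 ≤ ‖y‖ → g y = 0)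
    (e : Pt ≃ₗᵢ[ℝ] Pt) (x0 : Pt) {l : ℝ} (hl : 0 < l) :
    tsupport (fun x => g (l⁻¹ • e.symm (x - x0))) ⊆ Metric.closedBall x0 l := by
  refine closure_minimal (fun x hx => ?_) Metric.isClosed_closedBall
  by_contra h
  refine hx (hg _ ?_)
  rw [Metric.mem_closedBall, dist_eq_norm, not_le] at h
  rw [norm_smul, e.symm.norm_map, norm_inv, Real.norm_of_nonneg hl.le, ← div_eq_inv_mul,
    le_div_iff₀ hl, one_mul]
  exact h.le

/-- Bubble functions on a disc of radius `l`, attached to polynomials of bounded degree: with the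
scaled size `B` of the polynomial, all scaled norms in question are controlled by `B`. -/
lemma exists_cell_bubble (N : ℕ) (R : ℝ) :
    ∃ C : ℝ, 0 < C ∧ ∀ (x0 : Pt) (l : ℝ) (P : Poly), 0 < l → P.totalDegree ≤ N →
      ∃ (φ : Pt → ℝ) (B : ℝ), 0 ≤ B ∧ ContDiff ℝ ∞ φ ∧ tsupport φ ⊆ Metric.closedBall x0 l ∧
        (∀ x, 0 ≤ φ x * val P x ∧ φ x * val P x ≤ val P x ^ 2) ∧
        ∫ x, φ x * val P x = l ^ 2 * B ^ 2 ∧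
        (∀ x ∈ Metric.closedBall x0 (R * l), |val P x| ≤ C * B) ∧
        (∀ i, ∀ x ∈ Metric.closedBall x0 (R * l), |pd i (val P) x| ≤ C * l⁻¹ * B) ∧
        (∀ x, |φ x| ≤ C * B) ∧ ∀ i j x, |pd i (pd j φ) x| ≤ C * l⁻¹ ^ 2 * B := by
  obtain ⟨C, hC, h⟩ := exists_cell_reference_bounds N R
  refine ⟨4 * C, by positivity, fun x0 l P hl hP => ?_⟩
  obtain ⟨Q, hQ, hQP⟩ := exists_poly_comp_homothety P hP x0 l
  obtain ⟨h1, h2, h3, h4⟩ := h Q hQ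
  let e : Pt ≃ₗᵢ[ℝ] Pt := LinearIsometryEquiv.refl ℝ Pt
  have he : ∀ y, e.symm y = y := fun _ => rfl
  set B := √(∫ y, (bump y * val Q y) ^ 2) with hB
  have hB0 : 0 ≤ B := Real.sqrt_nonneg _
  have hPQ : val P = fun x => val Q (l⁻¹ • e.symm (x - x0)) := by
    funext x
    rw [hQP, smul_smul, mul_inv_cancel₀ hl.ne', one_smul]
    rw [he, add_sub_cancel]
  have hin : ∀ x ∈ Metric.closedBall x0 (R * l),
      l⁻¹ • e.symm (x - x0) ∈ Metric.closedBall (0 : Pt) R := by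
    intro x hx
    rw [mem_closedBall_zero_iff, norm_smul, e.symm.norm_map, norm_inv, Real.norm_of_nonneg hl.le,
      ← div_eq_inv_mul, div_le_iff₀ hl]
    simpa [dist_eq_norm] using hx
  have hg : ContDiff ℝ ∞ fun y => bump y ^ 2 * val Q y :=
    (contDiff_bump.pow 2).mul (contDiff_val Q)
  let φ : Pt → ℝ := fun x => (fun y => bump y ^ 2 * val Q y) (l⁻¹ • e.symm (x - x0))
  have hφP : ∀ x, φ x * val P x = bump (l⁻¹ • e.symm (x - x0)) ^ 2 * val P x ^ 2 := by
    intro x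
    simp only [φ, hPQ]; ring
  refine ⟨φ, B, hB0, contDiff_comp_similarity hg e x0 _,
    tsupport_comp_similarity_subset (g := fun y => bump y ^ 2 * val Q y)
      (fun y hy => by simp [bump_eq_zero hy]) e x0 hl, fun x => ?_, ?_, fun x hx => ?_,
    fun i x hx => ?_, fun x => ?_, fun i j x => ?_⟩
  · rw [hφP]
    exact ⟨by positivity, mul_le_of_le_one_left (sq_nonneg _) (bump_sq_le_one _)⟩
  · rw [integral_comp_homothety _ x0 hl, hB,
      Real.sq_sqrt (integral_nonneg fun y => sq_nonneg _)]
    congr 1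
    refine integral_congr_ae (Eventually.of_forall fun y => ?_)
    simp only [φ, ← hQP, add_sub_cancel_left, map_smul, smul_smul, inv_mul_cancel₀ hl.ne',
      one_smul]
    rw [he]
    ring
  · rw [hPQ]
    refine (h1 _ (hin x hx)).trans ?_
    nlinarith [mul_nonneg hC.le hB0]
  · have := abs_pd_comp_similarity_le (contDiff_differentiable (contDiff_val Q)) e x0
      (inv_nonneg.2 hl.le) x (fun k => h2 k _ (hin x hx)) i
    rw [hPQ]
    refine this.trans ?_
    have : 0 ≤ l⁻¹ * (C * B) := by positivity
    nlinarith
  · refine (h3 _).trans ?_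
    nlinarith [mul_nonneg hC.le hB0]
  · refine (abs_pd_pd_comp_similarity_le hg e x0 (inv_nonneg.2 hl.le) x
      (fun k l => h4 k l _) i j).trans (le_of_eq (by ring))

lemma pd_one_eq_zero_of_even {g : Pt → ℝ} (hg : Differentiable ℝ g)
    (heven : ∀ s t : ℝ, g !₂[s, -t] = g !₂[s, t]) (s : ℝ) : pd 1 g !₂[s, 0] = 0 := by
  let γ : ℝ → Pt := fun t => !₂[s, 0] + t • EuclideanSpace.single 1 (1 : ℝ)
  have hγ : ∀ t, γ t = !₂[s, t] := by
    intro t; ext i; fin_cases i <;> simp [γ]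
  have h1 : HasDerivAt (fun t => g (γ t)) (pd 1 g !₂[s, 0]) 0 := by
    have h2 : HasDerivAt γ (EuclideanSpace.single 1 (1 : ℝ)) 0 := by
      have := ((hasDerivAt_id (0 : ℝ)).smul_const
        (EuclideanSpace.single 1 (1 : ℝ) : Pt)).const_add (!₂[s, 0] : Pt)
      simpa only [one_smul] using! this
    have h3 := (hg (γ 0)).hasFDerivAt.comp_hasDerivAt 0 h2
    rw [hγ 0] at h3
    exact h3
  have h4 : HasDerivAt (fun t => g (γ t)) (-pd 1 g !₂[s, 0]) 0 := by
    have h5 : HasDerivAt (fun t => g (γ t)) (pd 1 g !₂[s, 0]) (-0) := by rwa [neg_zero]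
    have h6 := h5.comp (0 : ℝ) (hasDerivAt_neg (0 : ℝ))
    have h7 : ((fun t => g (γ t)) ∘ fun t => -t) = fun t => g (γ t) := by
      funext t; simp only [Function.comp_apply, hγ, heven]
    rw [← h7]
    simpa using h6
  linarith [h1.unique h4]

/-- Bubble functions on an edge, extended to a disc of radius `l` around its midpoint. They are
constant in the normal direction up to a radial cut-off, so that their normal derivative vanishes
on the edge. -/
lemma exists_edge_bubble (N : ℕ) (R : ℝ) :
    ∃ C : ℝ, 0 < C ∧ ∀ (M : Pt) (e : Pt ≃ₗᵢ[ℝ] Pt) (l : ℝ) (P : Poly), 0 < l →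
      P.totalDegree ≤ N →
      ∃ (φ : Pt → ℝ) (B : ℝ), 0 ≤ B ∧ ContDiff ℝ ∞ φ ∧ tsupport φ ⊆ Metric.closedBall M l ∧
        ∫ s : ℝ, φ (M + s • e (EuclideanSpace.single 0 1)) *
          val P (M + s • e (EuclideanSpace.single 0 1)) = l * B ^ 2 ∧
        (∀ s ∈ Set.Icc (-(R * l)) (R * l), |val P (M + s • e (EuclideanSpace.single 0 1))| ≤ C * B) ∧
        (∀ x, |φ x| ≤ C * B) ∧ (∀ i j x, |pd i (pd j φ) x| ≤ C * l⁻¹ ^ 2 * B) ∧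
        ∀ s : ℝ, fderiv ℝ φ (M + s • e (EuclideanSpace.single 0 1))
          (e (EuclideanSpace.single 1 1)) = 0 := by
  obtain ⟨C, hC, h⟩ := exists_edge_reference_bounds N R
  refine ⟨4 * C, by positivity, fun M e l P hl hP => ?_⟩
  set τ := e (EuclideanSpace.single 0 1) with hτ
  obtain ⟨p, hp, hpP⟩ := exists_poly_comp_line P hP M (l • τ)
  obtain ⟨h1, h2, h3⟩ := h p hp
  set B := √(∫ s : ℝ, (bump !₂[s, 0] * p.eval s) ^ 2) with hB
  have hB0 : 0 ≤ B := Real.sqrt_nonneg _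
  let g : Pt → ℝ := fun y => bump y ^ 2 * p.eval (y 0)
  have hg : ContDiff ℝ ∞ g := by
    refine (contDiff_bump.pow 2).mul ?_
    have : ContDiff ℝ ∞ fun s : ℝ => p.eval s := by
      simpa using Polynomial.contDiff_aeval (𝕜 := ℝ) p ∞
    exact this.comp (by fun_prop)
  let φ : Pt → ℝ := fun x => g (l⁻¹ • e.symm (x - M))
  have hline : ∀ s : ℝ, l⁻¹ • e.symm (M + s • τ - M) = !₂[l⁻¹ * s, 0] := by
    intro s
    rw [add_sub_cancel_left, map_smul, hτ, e.symm_apply_apply]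
    ext i; fin_cases i <;> simp
  refine ⟨φ, B, hB0, contDiff_comp_similarity hg e M _,
    tsupport_comp_similarity_subset (fun y hy => by simp [g, bump_eq_zero hy]) e M hl, ?_,
    fun s hs => ?_, fun x => ?_, fun i j x => ?_, fun s => ?_⟩
  · rw [integral_comp_scale _ hl, hB, Real.sq_sqrt (integral_nonneg fun y => sq_nonneg _)]
    congr 1
    refine integral_congr_ae (Eventually.of_forall fun s => ?_)
    have e1 : val P (M + (l * s) • τ) = p.eval s := by rw [hpP, smul_smul, mul_comm]
    simp only [φ, hline, e1, g]
    rw [← mul_assoc, inv_mul_cancel₀ hl.ne', one_mul]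
    simp only [Matrix.cons_val_zero]
    ring
  · have e1 : val P (M + s • τ) = p.eval (l⁻¹ * s) := by
      rw [hpP, smul_smul]; congr 3; field_simp
    rw [e1]
    refine (h1 _ ?_).trans (by nlinarith [mul_nonneg hC.le hB0])
    rw [← div_eq_inv_mul]
    exact ⟨by rw [le_div_iff₀ hl]; linarith [hs.1], by rw [div_le_iff₀ hl]; exact hs.2⟩
  · exact (h2 _).trans (by nlinarith [mul_nonneg hC.le hB0])
  · exact (abs_pd_pd_comp_similarity_le hg e M (inv_nonneg.2 hl.le) x
      (fun k l => h3 k l _) i j).trans (le_of_eq (by ring))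
  · set n := e (EuclideanSpace.single 1 1) with hn
    have hd := contDiff_differentiable hg
    have key : fderiv ℝ φ (M + s • τ) n = l⁻¹ * pd 1 g !₂[l⁻¹ * s, 0] := by
      rw [fderiv_comp_similarity hd, hline, hn, e.symm_apply_apply, pd]
    -- `g` is even in the second coordinate, since the cut-off is radial
    rw [key, pd_one_eq_zero_of_even hd, mul_zero]
    intro s t
    simp [g, bump, EuclideanSpace.norm_eq]

/-! ### The divergence theorem in a half-plane -/

/-- The rotation that maps the first coordinate vector to the unit vector `τ`. -/
noncomputable def rotEquiv (τ : Pt) (hτ : ‖τ‖ = 1) : Pt ≃ₗᵢ[ℝ] Pt :=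
  LinearIsometry.toLinearIsometryEquiv
    { toFun := fun y => !₂[y 0 * τ 0 - y 1 * τ 1, y 0 * τ 1 + y 1 * τ 0]
      map_add' := fun x y => by ext i; fin_cases i <;> simp <;> ring
      map_smul' := fun a y => by ext i; fin_cases i <;> simp <;> ring
      norm_map' := fun y => by
        have h : τ 0 ^ 2 + τ 1 ^ 2 = 1 := by
          have := EuclideanSpace.norm_sq_eq τ
          rw [hτ] at this
          simpa using this.symm
        simp only [LinearMap.coe_mk, AddHom.coe_mk, EuclideanSpace.norm_eq, Fin.sum_univ_two,
          Real.norm_eq_abs, sq_abs]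
        congr 1
        simp only [Matrix.cons_val_zero, Matrix.cons_val_one]
        linear_combination (y 0 ^ 2 + y 1 ^ 2) * h } rfl

/-- The unit vector obtained from `τ` by a counterclockwise rotation by a right angle. -/
noncomputable def nrm (τ : Pt) : Pt := !₂[-τ 1, τ 0]

lemma rotEquiv_apply (τ : Pt) (hτ : ‖τ‖ = 1) (y : Pt) :
    rotEquiv τ hτ y = y 0 • τ + y 1 • nrm τ := by
  change (!₂[y 0 * τ 0 - y 1 * τ 1, y 0 * τ 1 + y 1 * τ 0] : Pt) = _
  ext i; fin_cases i <;> simp [nrm]; ring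

lemma rotEquiv_single_zero (τ : Pt) (hτ : ‖τ‖ = 1) :
    rotEquiv τ hτ (EuclideanSpace.single 0 1) = τ := by
  simp [rotEquiv_apply]

lemma rotEquiv_single_one (τ : Pt) (hτ : ‖τ‖ = 1) :
    rotEquiv τ hτ (EuclideanSpace.single 1 1) = nrm τ := by
  simp [rotEquiv_apply]

lemma sq_add_sq_of_norm {τ : Pt} (hτ : ‖τ‖ = 1) : τ 0 ^ 2 + τ 1 ^ 2 = 1 := by
  have := EuclideanSpace.norm_sq_eq τ
  rw [hτ] at this
  simpa using this.symm

lemma inner_eq (x y : Pt) : inner ℝ x y = x 0 * y 0 + x 1 * y 1 := by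
  simp [PiLp.inner_apply]; ring

/-- Integration in the coordinates of the frame `τ, nrm τ` centred at `M`. -/
lemma measurePreserving_frame (M τ : Pt) (hτ : ‖τ‖ = 1) :
    MeasurePreserving (fun z : ℝ × ℝ => M + (z.1 • τ + z.2 • nrm τ)) := by
  have h1 : MeasurePreserving (fun z : ℝ × ℝ => (WithLp.toLp 2 ![z.1, z.2] : Pt)) := by
    have a := (volume_preserving_finTwoArrow ℝ).symm
    have b := PiLp.volume_preserving_toLp (Fin 2)
    exact b.comp a
  have h2 := (rotEquiv τ hτ).measurePreserving.comp h1
  have h3 := (measurePreserving_add_left (volume : Measure Pt) M).comp h2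
  convert! h3 using 1
  funext z
  simp [rotEquiv_apply]

lemma frame_measurableEmbedding (M τ : Pt) (hτ : ‖τ‖ = 1) :
    MeasurableEmbedding (fun z : ℝ × ℝ => M + (z.1 • τ + z.2 • nrm τ)) := by
  have h1 : MeasurableEmbedding (fun z : ℝ × ℝ => (WithLp.toLp 2 ![z.1, z.2] : Pt)) :=
    (MeasurableEquiv.toLp 2 (Fin 2 → ℝ)).measurableEmbedding.comp
      (MeasurableEquiv.finTwoArrow (α := ℝ)).symm.measurableEmbedding
  have h2 := (rotEquiv τ hτ).toHomeomorph.measurableEmbedding.comp h1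
  have h3 := (measurableEmbedding_addLeft M).comp h2
  convert! h3 using 1
  funext z
  simp [rotEquiv_apply]

/-- The open half-plane on the side of `n` of the line through `M` that is orthogonal to `n`. -/
def halfPlane (M n : Pt) : Set Pt := {x | 0 < inner ℝ (x - M) n}

lemma isOpen_halfPlane (M n : Pt) : IsOpen (halfPlane M n) :=
  isOpen_lt continuous_const ((continuous_id.sub continuous_const).inner continuous_const)

lemma norm_nrm {τ : Pt} (hτ : ‖τ‖ = 1) : ‖nrm τ‖ = 1 := by
  rw [← rotEquiv_single_one τ hτ, LinearIsometryEquiv.norm_map]; simp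

lemma inner_frame {τ : Pt} (hτ : ‖τ‖ = 1) (s t : ℝ) :
    inner ℝ (s • τ + t • nrm τ) (nrm τ) = t := by
  have := sq_add_sq_of_norm hτ
  simp only [inner_eq, nrm, PiLp.add_apply, PiLp.smul_apply, smul_eq_mul, Matrix.cons_val_zero,
    Matrix.cons_val_one]
  linear_combination t * this

lemma setIntegral_halfPlane (M τ : Pt) (hτ : ‖τ‖ = 1) (F : Pt → ℝ) :
    ∫ x in halfPlane M (nrm τ), F x =
      ∫ z in (Set.univ : Set ℝ) ×ˢ Set.Ioi (0 : ℝ), F (M + (z.1 • τ + z.2 • nrm τ)) := by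
  rw [← (measurePreserving_frame M τ hτ).setIntegral_preimage_emb
    (frame_measurableEmbedding M τ hτ) F]
  congr 2
  ext z
  simp [halfPlane, inner_frame hτ]

lemma isClosedEmbedding_frame {M τ : Pt} (hτ : ‖τ‖ = 1) :
    IsClosedEmbedding (fun z : ℝ × ℝ => M + (z.1 • τ + z.2 • nrm τ)) := by
  have h1 : (fun z : ℝ × ℝ => M + (z.1 • τ + z.2 • nrm τ)) =
      (Homeomorph.addLeft M) ∘ (rotEquiv τ hτ).toHomeomorph ∘
        (PiLp.homeomorph 2 (fun _ : Fin 2 => ℝ)).symm ∘ (Homeomorph.finTwoArrow (X := ℝ)).symm := by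
    funext z
    change _ = M + rotEquiv τ hτ (WithLp.toLp 2 ![z.1, z.2])
    simp [rotEquiv_apply]
  rw [h1]
  exact ((Homeomorph.finTwoArrow (X := ℝ)).symm.trans
    ((PiLp.homeomorph 2 (fun _ : Fin 2 => ℝ)).symm.trans ((rotEquiv τ hτ).toHomeomorph.trans
      (Homeomorph.addLeft M)))).isClosedEmbedding

lemma isometry_line (M : Pt) {τ : Pt} (hτ : ‖τ‖ = 1) : Isometry fun s : ℝ => M + s • τ := by
  refine Isometry.of_dist_eq fun s t => ?_
  rw [dist_add_left, dist_eq_norm, ← sub_smul, norm_smul, hτ, mul_one, Real.dist_eq,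
    Real.norm_eq_abs]

/-- The divergence theorem in a half-plane, in the direction of the frame. -/
lemma integral_halfPlane_frame {M τ : Pt} (hτ : ‖τ‖ = 1) {G : Pt → ℝ} (hG : ContDiff ℝ ∞ G)
    (hc : HasCompactSupport G) :
    ∫ x in halfPlane M (nrm τ), fderiv ℝ G x τ = 0 ∧
      ∫ x in halfPlane M (nrm τ), fderiv ℝ G x (nrm τ) = -∫ s : ℝ, G (M + s • τ) := by
  have hce := isClosedEmbedding_frame (M := M) hτ
  have hD : Continuous (fderiv ℝ G) := hG.continuous_fderiv (by simp)
  have hint : ∀ v : Pt, Integrable fun z : ℝ × ℝ => fderiv ℝ G (M + (z.1 • τ + z.2 • nrm τ)) v := by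
    intro v
    have h1 : Continuous fun x => fderiv ℝ G x v := hD.clm_apply continuous_const
    have h2 : HasCompactSupport fun x => fderiv ℝ G x v := hc.fderiv_apply (𝕜 := ℝ) v
    exact (h1.comp hce.continuous).integrable_of_hasCompactSupport (h2.comp_isClosedEmbedding hce)
  have hGd := hG.differentiable (by simp)
  constructor
  · rw [setIntegral_halfPlane M τ hτ, Measure.volume_eq_prod,
      ← Measure.prod_restrict, integral_prod_symm _ (by
        rw [Measure.prod_restrict, ← Measure.volume_eq_prod]; exact (hint τ).integrableOn)]
    refine integral_eq_zero_of_ae (Eventually.of_forall fun t => ?_)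
    have h1 : HasCompactSupport fun s : ℝ => G (M + (s • τ + t • nrm τ)) := by
      simpa only [Function.comp_def, add_assoc, add_comm (t • nrm τ)] using
        hc.comp_isClosedEmbedding (isometry_line (M + t • nrm τ) hτ).isClosedEmbedding
    have h2 : ContDiff ℝ 1 fun s : ℝ => G (M + (s • τ + t • nrm τ)) :=
      (hG.of_le (by simp)).comp (by fun_prop)
    have h3 : ∀ s : ℝ, deriv (fun s : ℝ => G (M + (s • τ + t • nrm τ))) s =
        fderiv ℝ G (M + (s • τ + t • nrm τ)) τ := by
      intro s
      have h4 : HasDerivAt (fun s : ℝ => M + (s • τ + t • nrm τ)) τ s := by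
        have := (((hasDerivAt_id s).smul_const τ).add_const (t • nrm τ)).const_add M
        simpa only [one_smul] using! this
      exact ((hGd _).hasFDerivAt.comp_hasDerivAt s h4).deriv
    simp only [Measure.restrict_univ, Pi.zero_apply, ← h3]
    exact integral_eq_zero_of_hasDerivAt_of_integrable
      (fun s => (h2.differentiable (by simp) s).hasDerivAt)
      ((h2.continuous_deriv (by simp)).integrable_of_hasCompactSupport h1.deriv)
      (h2.continuous.integrable_of_hasCompactSupport h1)
  · rw [setIntegral_halfPlane M τ hτ, Measure.volume_eq_prod,
      setIntegral_prod _ (by rw [← Measure.volume_eq_prod]; exact (hint _).integrableOn),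
      ← integral_neg, Measure.restrict_univ]
    congr 1
    funext s
    have h1 : HasCompactSupport fun t : ℝ => G (M + (s • τ + t • nrm τ)) := by
      simpa only [Function.comp_def, add_assoc] using
        hc.comp_isClosedEmbedding (isometry_line (M + s • τ) (norm_nrm hτ)).isClosedEmbedding
    have h2 : ContDiff ℝ 1 fun t : ℝ => G (M + (s • τ + t • nrm τ)) :=
      (hG.of_le (by simp)).comp (by fun_prop)
    have h3 : ∀ t : ℝ, deriv (fun t : ℝ => G (M + (s • τ + t • nrm τ))) t =
        fderiv ℝ G (M + (s • τ + t • nrm τ)) (nrm τ) := by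
      intro t
      have h4 : HasDerivAt (fun t : ℝ => M + (s • τ + t • nrm τ)) (nrm τ) t := by
        have := (((hasDerivAt_id t).smul_const (nrm τ)).const_add (s • τ)).const_add M
        simpa only [one_smul] using! this
      exact ((hGd _).hasFDerivAt.comp_hasDerivAt t h4).deriv
    simp only [← h3]
    rw [h1.integral_Ioi_deriv_eq h2 0]
    simp

/-- The divergence theorem in a half-plane, in the direction of the coordinates. -/
lemma integral_halfPlane_pd {M τ : Pt} (hτ : ‖τ‖ = 1) {G : Pt → ℝ} (hG : ContDiff ℝ ∞ G)
    (hc : HasCompactSupport G) (j : Fin 2) :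
    ∫ x in halfPlane M (nrm τ), pd j G x = -(nrm τ j * ∫ s : ℝ, G (M + s • τ)) := by
  obtain ⟨h0, h1⟩ := integral_halfPlane_frame (M := M) hτ hG hc
  have hD : Continuous (fderiv ℝ G) := hG.continuous_fderiv (by simp)
  have hint : ∀ v : Pt, Integrable fun x => fderiv ℝ G x v := fun v =>
    (hD.clm_apply continuous_const).integrable_of_hasCompactSupport (hc.fderiv_apply (𝕜 := ℝ) v)
  have hs := sq_add_sq_of_norm hτ
  have key : ∀ x, pd j G x = τ j * fderiv ℝ G x τ + nrm τ j * fderiv ℝ G x (nrm τ) := by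
    intro x
    rw [fderiv_apply_eq, fderiv_apply_eq]
    fin_cases j
    · simp [nrm]; linear_combination (-pd 0 G x) * hs
    · simp [nrm]; linear_combination (-pd 1 G x) * hs
  simp_rw [key]
  rw [integral_add ((hint τ).integrableOn.const_mul _) ((hint _).integrableOn.const_mul _),
    integral_const_mul, integral_const_mul, h0, h1]
  ring

lemma nrm_neg (τ : Pt) : nrm (-τ) = -nrm τ := by
  ext i; fin_cases i <;> simp [nrm]

/-! ### Geometry of edges and triangles -/

/-- `E` is the segment of length `h` with the midpoint `M` in the direction of `τ`. -/
structure IsEdgeFrame (E : Finset Pt) (M τ : Pt) (h : ℝ) : Prop where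
  pos : 0 < h
  norm : ‖τ‖ = 1
  diam_eq : diam E = h
  coe_eq : (E : Set Pt) = {M - (h / 2) • τ, M + (h / 2) • τ}

lemma IsEdgeFrame.neg {E : Finset Pt} {M τ : Pt} {h : ℝ} (H : IsEdgeFrame E M τ h) :
    IsEdgeFrame E M (-τ) h := by
  refine ⟨H.pos, by rw [norm_neg, H.norm], H.diam_eq, ?_⟩
  rw [H.coe_eq, smul_neg, sub_neg_eq_add, ← sub_eq_add_neg, Set.pair_comm]

lemma diam_pair (a b : Pt) : Metric.diam (convexHull ℝ ({a, b} : Set Pt)) = dist a b := by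
  rw [convexHull_diam, Metric.diam_pair]

lemma exists_isEdgeFrame {E : Finset Pt} (hE : E.card = 2) {τ : Pt} (hτ : IsUnitTangent E τ) :
    ∃ M h, IsEdgeFrame E M τ h := by
  classical
  obtain ⟨a, b, hab, rfl⟩ := Finset.card_eq_two.1 hE
  obtain ⟨h1, h2⟩ := hτ
  rw [Finset.coe_pair, mem_vectorSpan_pair] at h2
  obtain ⟨c, hc⟩ := h2
  rw [vsub_eq_sub] at hc
  have hd : 0 < dist a b := dist_pos.2 hab
  have hc1 : |c| * dist a b = 1 := by
    rw [← h1, ← hc, norm_smul, Real.norm_eq_abs, dist_eq_norm]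
  refine ⟨midpoint ℝ a b, dist a b, hd, h1, ?_, ?_⟩
  · rw [diam, Finset.coe_pair, diam_pair]
  · have hmid : midpoint ℝ a b = (2⁻¹ : ℝ) • (a + b) := by
      rw [midpoint_eq_smul_add, invOf_eq_inv]
    rw [Finset.coe_pair, hmid, ← hc]
    rcases abs_cases c with ⟨h3, h4⟩ | ⟨h3, h4⟩
    · have h5 : dist a b / 2 * c = 1 / 2 := by rw [h3] at hc1; linarith
      rw [smul_smul, h5, Set.pair_comm]
      congr 1
      · module
      · congr 1; module
    · have h5 : dist a b / 2 * c = -1 / 2 := by rw [h3] at hc1; linarith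
      rw [smul_smul, h5]
      congr 1
      · module
      · congr 1; module

lemma IsEdgeFrame.convexHull_eq {E : Finset Pt} {M τ : Pt} {h : ℝ} (H : IsEdgeFrame E M τ h) :
    convexHull ℝ (E : Set Pt) = (fun s : ℝ => M + s • τ) '' Set.Icc (-(h / 2)) (h / 2) := by
  have hp := H.pos
  rw [H.coe_eq, convexHull_pair, segment_eq_image]
  ext x
  constructor
  · rintro ⟨t, ⟨h0, h1⟩, rfl⟩
    refine ⟨(2 * t - 1) * (h / 2), ⟨by nlinarith, by nlinarith⟩, ?_⟩
    simp only
    module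
  · rintro ⟨s, ⟨h0, h1⟩, rfl⟩
    refine ⟨s / h + 1 / 2, ⟨?_, ?_⟩, ?_⟩
    · have : -(1 / 2) ≤ s / h := by rw [le_div_iff₀ hp]; linarith
      linarith
    · have : s / h ≤ 1 / 2 := by rw [div_le_iff₀ hp]; linarith
      linarith
    · have : s = s / h * h := by field_simp
      simp only
      conv_rhs => rw [this]
      module

/-- The arc length on an edge is the image of the Lebesgue measure on an interval. -/
lemma IsEdgeFrame.arc_eq {E : Finset Pt} {M τ : Pt} {h : ℝ} (H : IsEdgeFrame E M τ h) :
    arc E = Measure.map (fun s : ℝ => M + s • τ)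
      (volume.restrict (Set.Icc (-(h / 2)) (h / 2))) := by
  have hi := isometry_line M H.norm
  have hm := hi.isClosedEmbedding.measurableEmbedding
  have h1 := hi.map_hausdorffMeasure (d := 1) (Or.inl zero_le_one)
  rw [hausdorffMeasure_real] at h1
  have h2 := hm.restrict_map volume ((fun s : ℝ => M + s • τ) '' Set.Icc (-(h / 2)) (h / 2))
  rw [Set.preimage_image_eq _ hi.injective, h1,
    Measure.restrict_restrict (hm.measurableSet_image.2 measurableSet_Icc),
    Set.inter_eq_self_of_subset_left (Set.image_subset_range _ _)] at h2
  rw [arc, H.convexHull_eq, h2]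

lemma IsEdgeFrame.integral_arc {E : Finset Pt} {M τ : Pt} {h : ℝ} (H : IsEdgeFrame E M τ h)
    (F : Pt → ℝ) : ∫ x, F x ∂(arc E) = ∫ s in Set.Icc (-(h / 2)) (h / 2), F (M + s • τ) := by
  rw [H.arc_eq, (isometry_line M H.norm).isClosedEmbedding.measurableEmbedding.integral_map]

/-- The triangle `T` lies on the side of the normal `n` of its edge with the midpoint `M` and the
length `h`, and contains the half disc of radius `l` around `M` on this side. Its discs have
diameters at most `h`, so that for shape-regular triangles `h` is comparable to the diameter. -/
structure IsOnSide (T : Finset Pt) (M n : Pt) (h l : ℝ) : Prop where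
  halfDisc_subset : ∀ y ∈ Metric.closedBall M l, 0 ≤ inner ℝ (y - M) n →
    y ∈ convexHull ℝ (T : Set Pt)
  inner_nonneg : ∀ y ∈ convexHull ℝ (T : Set Pt), 0 ≤ inner ℝ (y - M) n
  inradius_le : ∀ x r, 0 ≤ r → Metric.closedBall x r ⊆ convexHull ℝ (T : Set Pt) → 2 * r ≤ h

lemma convex_affine_nonneg (M v w : Pt) (a b c : ℝ) :
    Convex ℝ {y : Pt | 0 ≤ a * inner ℝ (y - M) v + b * inner ℝ (y - M) w + c} := by
  intro x hx y hy p q hp hq hpq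
  simp only [Set.mem_ofPred_eq, inner_sub_left, inner_add_left, real_inner_smul_left] at *
  have hq' : q = 1 - p := by linarith
  subst hq'
  nlinarith [mul_nonneg hp hx, mul_nonneg hq hy]

lemma inner_nrm_self {τ : Pt} : inner ℝ τ (nrm τ) = 0 := by
  simp only [inner_eq, nrm, Matrix.cons_val_zero, Matrix.cons_val_one]; ring

lemma frame_decomp {τ : Pt} (hτ : ‖τ‖ = 1) (v : Pt) :
    v = (inner ℝ v τ) • τ + (inner ℝ v (nrm τ)) • nrm τ := by
  have h := sq_add_sq_of_norm hτ
  ext i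
  fin_cases i
  · simp [inner_eq, nrm]; linear_combination (-v 0) * h
  · simp [inner_eq, nrm]; linear_combination (-v 1) * h

/-- The opposite vertex `z` has at least the distance `2 r` from the edge, and its projection has at
most the distance `γ r` from `M`. Therefore the half disc of radius `h / (4 + 4 γ)` around `M` lies
in the triangle. -/
lemma isOnSide_of_vertex {T : Finset Pt} {M τ z x : Pt} {h r γ : ℝ} (hτ : ‖τ‖ = 1) (hh : 0 < h)
    (hT : (T : Set Pt) = {M - (h / 2) • τ, M + (h / 2) • τ, z}) (hr : 0 < r)
    (hball : Metric.closedBall x r ⊆ convexHull ℝ (T : Set Pt)) (hγ : diam T ≤ γ * r)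
    (hz : 0 ≤ inner ℝ (z - M) (nrm τ)) : IsOnSide T M (nrm τ) h (h / (4 + 4 * γ)) := by
  set α := inner ℝ (z - M) τ with hα
  set β := inner ℝ (z - M) (nrm τ) with hβ
  have hn := norm_nrm hτ
  have hττ : inner ℝ τ τ = (1 : ℝ) := by rw [real_inner_self_eq_norm_sq, hτ]; norm_num
  have hnn : inner ℝ (nrm τ) (nrm τ) = (1 : ℝ) := by
    rw [real_inner_self_eq_norm_sq, hn]; norm_num
  have hτn : inner ℝ τ (nrm τ) = (0 : ℝ) := inner_nrm_self
  have hnτ : inner ℝ (nrm τ) τ = (0 : ℝ) := by rw [real_inner_comm]; exact hτn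
  -- affine functions that are nonnegative at the vertices are nonnegative on the triangle
  have hverts : ∀ a b c : ℝ, 0 ≤ -(a * (h / 2)) + c → 0 ≤ a * (h / 2) + c →
      0 ≤ a * α + b * β + c → ∀ y ∈ convexHull ℝ (T : Set Pt),
      0 ≤ a * inner ℝ (y - M) τ + b * inner ℝ (y - M) (nrm τ) + c := by
    intro a b c h1 h2 h3 y hy
    refine convexHull_min ?_ (convex_affine_nonneg M τ (nrm τ) a b c) hy
    rw [hT]
    rintro w (rfl | rfl | rfl)
    · simp only [Set.mem_ofPred_eq, sub_sub_cancel_left, inner_neg_left, real_inner_smul_left, hττ,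
        hτn]; linarith
    · simp only [Set.mem_ofPred_eq, add_sub_cancel_left, real_inner_smul_left, hττ,
        hτn]; linarith
    · exact h3
  have hmem : ∀ v : Pt, ‖v‖ = 1 → ∀ r', 0 ≤ r' → ∀ x', x' + r' • v ∈ Metric.closedBall x' r' := by
    intro v hv r' hr' x'
    rw [Metric.mem_closedBall, dist_eq_norm, add_sub_cancel_left, norm_smul, hv, mul_one,
      Real.norm_of_nonneg hr']
  have hmem' : ∀ v : Pt, ‖v‖ = 1 → ∀ r', 0 ≤ r' → ∀ x', x' - r' • v ∈ Metric.closedBall x' r' := by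
    intro v hv r' hr' x'
    rw [sub_eq_add_neg, ← smul_neg]
    exact hmem (-v) (by rw [norm_neg, hv]) r' hr' x'
  -- the triangle lies in the strip between the line through the edge and the parallel through `z`
  have hβr : 2 * r ≤ β := by
    have h1 := hverts 0 1 0 (by simp) (by simp) (by simpa using hz) _
      (hball (hmem' _ hn r hr.le x))
    have h2 := hverts 0 (-1) β (by simpa using hz) (by simpa using hz) (by simp) _
      (hball (hmem _ hn r hr.le x))
    rw [sub_right_comm, inner_sub_left (x - M), inner_sub_left (x - M), real_inner_smul_left,
      real_inner_smul_left, hnn, hnτ] at h1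
    rw [add_sub_right_comm, inner_add_left (x - M), inner_add_left (x - M), real_inner_smul_left,
      real_inner_smul_left, hnn, hnτ] at h2
    linarith
  have hβ0 : 0 < β := by linarith
  have hbd : Bornology.IsBounded (convexHull ℝ (T : Set Pt)) :=
    (isBounded_convexHull (s := (T : Set Pt))).2 T.finite_toSet.isBounded
  have hsub := subset_convexHull ℝ (T : Set Pt)
  have ha : M - (h / 2) • τ ∈ convexHull ℝ (T : Set Pt) := hsub (by rw [hT]; simp)
  have hb : M + (h / 2) • τ ∈ convexHull ℝ (T : Set Pt) := hsub (by rw [hT]; simp)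
  have hzT : z ∈ convexHull ℝ (T : Set Pt) := hsub (by rw [hT]; simp)
  have hMT : M ∈ convexHull ℝ (T : Set Pt) := by
    have := convex_convexHull ℝ (T : Set Pt) ha hb (by norm_num : (0 : ℝ) ≤ 1 / 2)
      (by norm_num : (0 : ℝ) ≤ 1 / 2) (by norm_num)
    convert this using 1
    module
  have hαγ : |α| ≤ γ * r := by
    refine le_trans ?_ ((Metric.dist_le_diam_of_mem hbd hzT hMT).trans hγ)
    rw [dist_eq_norm]
    simpa [hτ] using abs_real_inner_le_norm (z - M) τ
  have hhγ : h ≤ γ * r := by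
    refine le_trans ?_ ((Metric.dist_le_diam_of_mem hbd hb ha).trans hγ)
    rw [dist_eq_norm, show M + (h / 2) • τ - (M - (h / 2) • τ) = h • τ by module, norm_smul, hτ,
      Real.norm_of_nonneg hh.le, mul_one]
  have hγ0 : 0 < γ := by
    by_contra! hneg
    nlinarith
  refine ⟨fun y hy ht => ?_, fun y hy => ?_, fun x' r' hr' hb' => ?_⟩
  · set s := inner ℝ (y - M) τ with hs
    set t := inner ℝ (y - M) (nrm τ) with htt
    have hy' : ‖y - M‖ ≤ h / (4 + 4 * γ) := by simpa [dist_eq_norm] using hy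
    have hsl : |s| ≤ h / (4 + 4 * γ) := by
      refine le_trans ?_ hy'
      simpa [hτ] using abs_real_inner_le_norm (y - M) τ
    have htl : t ≤ h / (4 + 4 * γ) := by
      refine (le_abs_self t).trans (le_trans ?_ hy')
      simpa [hn] using abs_real_inner_le_norm (y - M) (nrm τ)
    have hl : h / (4 + 4 * γ) * (4 + 4 * γ) = h := div_mul_cancel₀ _ (by positivity)
    set l := h / (4 + 4 * γ) with hldef
    have hl0 : 0 < l := by positivity
    set w := t / β with hw
    have hw0 : 0 ≤ w := div_nonneg ht hβ0.le
    have hwβ : w * β = t := div_mul_cancel₀ _ hβ0.ne'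
    have hαw : |w * α| ≤ γ * t := by
      rw [abs_mul, abs_of_nonneg hw0]
      have : |α| ≤ γ * β := by nlinarith
      calc w * |α| ≤ w * (γ * β) := mul_le_mul_of_nonneg_left this hw0
        _ = γ * t := by rw [← hwβ]; ring
    have hhw : h * w ≤ γ * t := by
      have : h ≤ γ * β := by nlinarith
      calc h * w ≤ γ * β * w := mul_le_mul_of_nonneg_right this hw0
        _ = γ * t := by rw [← hwβ]; ring
    have hγt : γ * t ≤ γ * l := mul_le_mul_of_nonneg_left htl hγ0.le
    have hA := abs_le.1 hαw
    have hS := abs_le.1 hsl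
    have hk1 : 0 ≤ h / 2 * (1 - w) + (s - w * α) := by nlinarith
    have hk2 : 0 ≤ h / 2 * (1 - w) - (s - w * α) := by nlinarith
    have hyz : y = M + (s • τ + t • nrm τ) := by
      rw [← frame_decomp hτ (y - M)]; abel
    have hzz : z = M + (α • τ + β • nrm τ) := by
      rw [← frame_decomp hτ (z - M)]; abel
    -- the barycentric coordinates of `y`
    have hcomb : y = ((h / 2 * (1 - w) - (s - w * α)) / h) • (M - (h / 2) • τ)
        + ((h / 2 * (1 - w) + (s - w * α)) / h) • (M + (h / 2) • τ) + w • z := by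
      rw [hzz, hyz, ← hwβ]
      match_scalars <;> field_simp <;> ring
    have hsum := (convex_convexHull ℝ (T : Set Pt)).sum_mem (t := Finset.univ)
      (w := ![(h / 2 * (1 - w) - (s - w * α)) / h, (h / 2 * (1 - w) + (s - w * α)) / h, w])
      (z := ![M - (h / 2) • τ, M + (h / 2) • τ, z])
      (by
        intro i _
        fin_cases i
        · exact div_nonneg hk2 hh.le
        · exact div_nonneg hk1 hh.le
        · exact hw0)
      (by simp [Fin.sum_univ_three]; field_simp; ring)
      (by
        intro i _
        fin_cases i
        · exact ha
        · exact hb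
        · exact hzT)
    rw [hcomb]
    simpa [Fin.sum_univ_three] using hsum
  · simpa using hverts 0 1 0 (by simp) (by simp) (by simpa using hz) y hy
  -- the section parallel to the edge through the centre of a disc is not longer than the edge
  · have h1 := hverts (-β) (α - h / 2) (h / 2 * β) (by nlinarith) (by nlinarith) (by nlinarith) _
      (hb' (hmem _ hτ r' hr' x'))
    have h2 := hverts β (-α - h / 2) (h / 2 * β) (by nlinarith) (by nlinarith) (by nlinarith) _
      (hb' (hmem' _ hτ r' hr' x'))
    have h3 := hverts 0 1 0 (by simp) (by simp) (by simpa using hz) _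
      (hb' (Metric.mem_closedBall_self hr'))
    rw [add_sub_right_comm, inner_add_left (x' - M), inner_add_left (x' - M),
      real_inner_smul_left τ τ, real_inner_smul_left τ (nrm τ), hττ, hτn] at h1
    rw [sub_right_comm, inner_sub_left (x' - M), inner_sub_left (x' - M),
      real_inner_smul_left τ τ, real_inner_smul_left τ (nrm τ), hττ, hτn] at h2
    nlinarith

lemma exists_vertex {E T : Finset Pt} {M τ : Pt} {h : ℝ} (H : IsEdgeFrame E M τ h)
    (hE : E.card = 2) (hT : T.card = 3) (hET : E ⊆ T) :
    ∃ z, (T : Set Pt) = {M - (h / 2) • τ, M + (h / 2) • τ, z} := by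
  classical
  have h1 : (T \ E).card = 1 := by rw [Finset.card_sdiff_of_subset hET, hE, hT]
  obtain ⟨z, hz⟩ := Finset.card_eq_one.1 h1
  refine ⟨z, ?_⟩
  have h2 : T = E ∪ {z} := by rw [← hz, Finset.union_sdiff_of_subset hET]
  rw [h2, Finset.coe_union, H.coe_eq, Finset.coe_singleton, Set.insert_union,
    Set.singleton_union]

/-- Every triangle lies on one of the two sides of each of its edges. -/
lemma isOnSide_or {K : Geometry.SimplicialComplex ℝ Pt} {γ : ℝ} (hK : ShapeRegular K γ)
    {E T : Finset Pt} {M τ : Pt} {h : ℝ} (H : IsEdgeFrame E M τ h)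
    (hE : E.card = 2) (hT : T ∈ triangles K) (hET : E ⊆ T) :
    IsOnSide T M (nrm τ) h (h / (4 + 4 * γ)) ∨ IsOnSide T M (nrm (-τ)) h (h / (4 + 4 * γ)) := by
  obtain ⟨x, r, hr, hball, hγ⟩ := hK T hT
  obtain ⟨z, hz⟩ := exists_vertex H hE hT.2 hET
  rcases le_total 0 (inner ℝ (z - M) (nrm τ)) with h0 | h0
  · exact Or.inl (isOnSide_of_vertex H.norm H.pos hz hr hball hγ h0)
  · obtain ⟨z', hz'⟩ := exists_vertex H.neg hE hT.2 hET
    refine Or.inr (isOnSide_of_vertex H.neg.norm H.pos (z := z) ?_ hr hball hγ ?_)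
    · rw [hz, smul_neg, sub_neg_eq_add, ← sub_eq_add_neg, Set.insert_comm]
    · rw [nrm_neg, inner_neg_right]; linarith

/-- Two different triangles lie on different sides of a common edge. -/
lemma not_isOnSide_both {K : Geometry.SimplicialComplex ℝ Pt} {E T₁ T₂ : Finset Pt} {M τ : Pt}
    {h l : ℝ} (H : IsEdgeFrame E M τ h) (hl : 0 < l) (hI : IsInnerEdge K E T₁ T₂)
    (h₁ : IsOnSide T₁ M (nrm τ) h l) (h₂ : IsOnSide T₂ M (nrm τ) h l) : False := by
  classical
  have hn := norm_nrm H.norm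
  have hin : inner ℝ (M + l • nrm τ - M) (nrm τ) = l := by
    rw [add_sub_cancel_left, real_inner_smul_left, real_inner_self_eq_norm_sq, hn]; ring
  have hmem : M + l • nrm τ ∈ Metric.closedBall M l := by
    rw [Metric.mem_closedBall, dist_eq_norm, add_sub_cancel_left, norm_smul, hn, mul_one,
      Real.norm_of_nonneg hl.le]
  -- a point off the edge would lie in both triangles, which meet in the edge only
  have hx := K.inter_subset_convexHull hI.mem₁.1 hI.mem₂.1
    ⟨h₁.halfDisc_subset _ hmem (hin.symm.subst hl.le),
      h₂.halfDisc_subset _ hmem (hin.symm.subst hl.le)⟩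
  have hEsub : E ⊆ T₁ ∩ T₂ := Finset.subset_inter hI.sub₁ hI.sub₂
  have hcard : (T₁ ∩ T₂).card ≤ 2 := by
    by_contra! hc
    have a : T₁ ∩ T₂ = T₁ := Finset.eq_of_subset_of_card_le Finset.inter_subset_left
      (by rw [hI.mem₁.2]; omega)
    have b : T₁ ∩ T₂ = T₂ := Finset.eq_of_subset_of_card_le Finset.inter_subset_right
      (by rw [hI.mem₂.2]; omega)
    exact hI.ne (a.symm.trans b)
  have hEq : E = T₁ ∩ T₂ := Finset.eq_of_subset_of_card_le hEsub (by rw [hI.card]; exact hcard)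
  rw [← Finset.coe_inter, ← hEq, H.convexHull_eq] at hx
  obtain ⟨s, -, hs⟩ := hx
  simp only at hs
  rw [← hs, add_sub_cancel_left, real_inner_smul_left, inner_nrm_self, mul_zero] at hin
  exact hl.ne hin

lemma elem_subset_halfPlane {T : Finset Pt} {M n : Pt} {h l : ℝ} (hn : ‖n‖ = 1)
    (H : IsOnSide T M n h l) : elem T ⊆ halfPlane M n := by
  intro x hx
  obtain ⟨ε, hε, hb⟩ := Metric.mem_nhds_iff.1 (mem_interior_iff_mem_nhds.1 hx)
  have h1 : x - (ε / 2) • n ∈ Metric.ball x ε := by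
    rw [Metric.mem_ball, dist_eq_norm, sub_sub_cancel_left, norm_neg, norm_smul, hn, mul_one,
      Real.norm_of_nonneg (by positivity)]
    linarith
  have h2 := H.inner_nonneg _ (hb h1)
  rw [sub_right_comm, inner_sub_left, real_inner_smul_left, real_inner_self_eq_norm_sq, hn] at h2
  change 0 < inner ℝ (x - M) n
  linarith

lemma halfPlane_inter_ball_subset {T : Finset Pt} {M n : Pt} {h l : ℝ}
    (H : IsOnSide T M n h l) : halfPlane M n ∩ Metric.ball M l ⊆ elem T :=
  interior_maximal (fun x hx => H.halfDisc_subset x (Metric.ball_subset_closedBall hx.2) hx.1.le)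
    ((isOpen_halfPlane M n).inter Metric.isOpen_ball)

lemma setIntegral_elem_eq_halfPlane {T : Finset Pt} {M n : Pt} {h l : ℝ} (hn : ‖n‖ = 1)
    (H : IsOnSide T M n h l) {F : Pt → ℝ} (hF : ∀ x ∉ Metric.ball M l, F x = 0) :
    ∫ x in elem T, F x = ∫ x in halfPlane M n, F x := by
  symm
  refine setIntegral_eq_of_subset_of_forall_sdiff_eq_zero (isOpen_halfPlane M n).measurableSet
    (elem_subset_halfPlane hn H) fun x hx => hF x fun hb => hx.2 ?_
  exact halfPlane_inter_ball_subset H ⟨hx.1, hb⟩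

lemma elem_subset_domain {K : Geometry.SimplicialComplex ℝ Pt} {T : Finset Pt}
    (hT : T ∈ triangles K) : elem T ⊆ domain K :=
  interior_mono (K.convexHull_subset_space hT.1)

lemma isOpen_domain (K : Geometry.SimplicialComplex ℝ Pt) : IsOpen (domain K) := isOpen_interior

lemma isOpen_elem (T : Finset Pt) : IsOpen (elem T) := isOpen_interior

lemma ball_subset_domain {K : Geometry.SimplicialComplex ℝ Pt} {T₁ T₂ : Finset Pt} {M n : Pt}
    {h l : ℝ} (hT₁ : T₁ ∈ triangles K) (hT₂ : T₂ ∈ triangles K)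
    (h₁ : IsOnSide T₁ M n h l) (h₂ : IsOnSide T₂ M (-n) h l) : Metric.ball M l ⊆ domain K := by
  refine interior_maximal (fun x hx => ?_) Metric.isOpen_ball
  rcases le_total 0 (inner ℝ (x - M) n) with h0 | h0
  · exact K.convexHull_subset_space hT₁.1
      (h₁.halfDisc_subset x (Metric.ball_subset_closedBall hx) h0)
  · exact K.convexHull_subset_space hT₂.1
      (h₂.halfDisc_subset x (Metric.ball_subset_closedBall hx) (by rw [inner_neg_right]; linarith))

lemma disjoint_elem {T₁ T₂ : Finset Pt} {M n : Pt} {h l : ℝ} (hn : ‖n‖ = 1)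
    (h₁ : IsOnSide T₁ M n h l) (h₂ : IsOnSide T₂ M (-n) h l) : Disjoint (elem T₁) (elem T₂) := by
  refine Set.disjoint_left.2 fun x hx₁ hx₂ => ?_
  have a : 0 < inner ℝ (x - M) n := elem_subset_halfPlane hn h₁ hx₁
  have b : 0 < inner ℝ (x - M) (-n) := elem_subset_halfPlane (by rwa [norm_neg]) h₂ hx₂
  rw [inner_neg_right] at b
  linarith

lemma volume_line_eq_zero (M : Pt) {τ : Pt} (hτ : ‖τ‖ = 1) :
    volume {x : Pt | inner ℝ (x - M) (nrm τ) = 0} = 0 := by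
  rw [← (measurePreserving_frame M τ hτ).measure_preimage_emb (frame_measurableEmbedding M τ hτ)]
  have : (fun z : ℝ × ℝ => M + (z.1 • τ + z.2 • nrm τ)) ⁻¹'
      {x : Pt | inner ℝ (x - M) (nrm τ) = 0} = Set.univ ×ˢ {0} := by
    ext z
    simp [inner_frame hτ]
  rw [this, Measure.volume_eq_prod, Measure.prod_prod]
  simp

/-- Integrals over the domain of functions that vanish off the disc around the midpoint of an edge
split into integrals over the two adjacent triangles. -/
lemma setIntegral_domain_eq_elem_union {K : Geometry.SimplicialComplex ℝ Pt} {T₁ T₂ : Finset Pt}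
    {M τ : Pt} {h l : ℝ} (hτ : ‖τ‖ = 1) (hT₁ : T₁ ∈ triangles K) (hT₂ : T₂ ∈ triangles K)
    (h₁ : IsOnSide T₁ M (nrm τ) h l) (h₂ : IsOnSide T₂ M (-nrm τ) h l) {F : Pt → ℝ}
    (hF : ∀ x ∉ Metric.ball M l, F x = 0) :
    ∫ x in domain K, F x = ∫ x in elem T₁ ∪ elem T₂, F x := by
  refine setIntegral_eq_of_subset_of_ae_sdiff_eq_zero
    (isOpen_domain K).measurableSet.nullMeasurableSet
    (Set.union_subset (elem_subset_domain hT₁) (elem_subset_domain hT₂)) ?_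
  have hz : ∀ᵐ x : Pt, inner ℝ (x - M) (nrm τ) ≠ 0 := by
    rw [ae_iff]; simpa using volume_line_eq_zero M hτ
  filter_upwards [hz] with x hx0 hx
  by_contra hFx
  have hb : x ∈ Metric.ball M l := by
    by_contra hb; exact hFx (hF x hb)
  rcases lt_or_gt_of_ne hx0 with h0 | h0
  · refine hx.2 (Or.inr (halfPlane_inter_ball_subset h₂ ⟨?_, hb⟩))
    change 0 < inner ℝ (x - M) (-nrm τ)
    rw [inner_neg_right]; linarith
  · exact hx.2 (Or.inl (halfPlane_inter_ball_subset h₁ ⟨h0, hb⟩))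

/-! ### Cauchy-Schwarz inequalities -/

lemma lpNorm_le_of_bound {Y F : Type*} [MeasurableSpace Y] {μ : Measure Y}
    [NormedAddCommGroup F] {g : Y → F} {s : Set Y} {k : ℝ} (hg : MemLp g 2 μ)
    (hs : MeasurableSet s) (hμ : μ s ≠ ⊤) (hk : 0 ≤ k) (hb : ∀ x ∈ s, ‖g x‖ ≤ k)
    (h0 : ∀ x ∉ s, g x = 0) : lpNorm g 2 μ ≤ k * √(μ.real s) := by
  rw [lpNorm_eq_integral_norm_rpow_toReal (by simp) (by simp) hg.1]
  have h1 : ∫ x, ‖g x‖ ^ (2 : ENNReal).toReal ∂μ ≤ ∫ x, s.indicator (fun _ => k ^ 2) x ∂μ := by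
    refine integral_mono_of_nonneg (Eventually.of_forall fun x => by positivity) ?_
      (Eventually.of_forall fun x => ?_)
    · exact (integrable_indicator_iff hs).2 (integrableOn_const hμ)
    · by_cases hx : x ∈ s
      · simp only [Set.indicator_of_mem hx, ENNReal.toReal_ofNat, Real.rpow_two]
        exact pow_le_pow_left₀ (norm_nonneg _) (hb x hx) 2
      · simp [h0 x hx, Set.indicator_of_notMem hx]
  rw [integral_indicator hs, setIntegral_const, smul_eq_mul] at h1
  calc _ ≤ (μ.real s * k ^ 2) ^ (2 : ENNReal).toReal⁻¹ := by
        refine Real.rpow_le_rpow (integral_nonneg fun x => by positivity) h1 (by simp)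
    _ = k * √(μ.real s) := by
        rw [Real.sqrt_eq_rpow, Real.mul_rpow measureReal_nonneg (sq_nonneg k), mul_comm,
          ← Real.rpow_natCast, ← Real.rpow_mul hk]
        norm_num

section CauchySchwarz

variable {Y F : Type*} [MeasurableSpace Y] {μ : Measure Y} [NormedAddCommGroup F]
  [InnerProductSpace ℝ F]

lemma integrable_inner_of_memLp {f g : Y → F} (hf : MemLp f 2 μ) (hg : MemLp g 2 μ) :
    Integrable (fun x => inner ℝ (f x) (g x)) μ := by
  refine (L2.integrable_inner (𝕜 := ℝ) (hf.toLp f) (hg.toLp g)).congr ?_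
  filter_upwards [hf.coeFn_toLp, hg.coeFn_toLp] with x h1 h2
  rw [h1, h2]

lemma abs_integral_inner_le {f g : Y → F} (hf : MemLp f 2 μ) (hg : MemLp g 2 μ) :
    |∫ x, inner ℝ (f x) (g x) ∂μ| ≤ lpNorm f 2 μ * lpNorm g 2 μ := by
  have h1 : ∫ x, inner ℝ (f x) (g x) ∂μ = inner ℝ (hf.toLp f) (hg.toLp g) := by
    rw [L2.inner_def]
    refine integral_congr_ae ?_
    filter_upwards [hf.coeFn_toLp, hg.coeFn_toLp] with x h1 h2
    rw [h1, h2]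
  have h2 : ∀ {g : Y → F} (hg : MemLp g 2 μ), lpNorm g 2 μ = ‖hg.toLp g‖ := fun hg => by
    rw [Lp.norm_toLp, toReal_eLpNorm hg.1]
  rw [h1, h2 hf, h2 hg]
  exact abs_real_inner_le_norm _ _

/-- The Cauchy-Schwarz inequality against a function that is bounded by `k` on a set and vanishes
off that set. -/
lemma abs_integral_inner_le_of_bound {f g : Y → F} {s : Set Y} {k : ℝ} (hf : MemLp f 2 μ)
    (hg : MemLp g 2 μ) (hs : MeasurableSet s) (hμ : μ s ≠ ⊤) (hk : 0 ≤ k)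
    (hb : ∀ x ∈ s, ‖g x‖ ≤ k) (h0 : ∀ x ∉ s, g x = 0) :
    |∫ x, inner ℝ (f x) (g x) ∂μ| ≤ lpNorm f 2 μ * (k * √(μ.real s)) :=
  (abs_integral_inner_le hf hg).trans
    (mul_le_mul_of_nonneg_left (lpNorm_le_of_bound hg hs hμ hk hb h0) lpNorm_nonneg)

lemma tendsto_integral_inner {f : ℕ → Y → F} {f' g : Y → F} (hf : ∀ n, AEStronglyMeasurable (f n) μ)
    (hf' : MemLp f' 2 μ) (hg : MemLp g 2 μ)
    (h : Tendsto (fun n => eLpNorm (f n - f') 2 μ) atTop (𝓝 0)) :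
    Tendsto (fun n => ∫ x, inner ℝ (f n x) (g x) ∂μ) atTop (𝓝 (∫ x, inner ℝ (f' x) (g x) ∂μ)) := by
  have h1 : ∀ᶠ n in atTop, MemLp (f n - f') 2 μ := by
    filter_upwards [h.eventually_lt_const (show (0 : ENNReal) < 1 by simp)] with n hn
    exact ⟨(hf n).sub hf'.1, hn.trans (by simp)⟩
  have h2 : Tendsto (fun n => (eLpNorm (f n - f') 2 μ).toReal * lpNorm g 2 μ) atTop (𝓝 0) := by
    have := ((ENNReal.tendsto_toReal (by simp)).comp h).mul_const (lpNorm g 2 μ)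
    simpa using this
  rw [tendsto_iff_dist_tendsto_zero]
  refine squeeze_zero' (Eventually.of_forall fun n => dist_nonneg) ?_ h2
  filter_upwards [h1] with n hn
  have h3 : MemLp (f n) 2 μ := by
    have := hn.add hf'
    simpa using this
  rw [Real.dist_eq, ← integral_sub (integrable_inner_of_memLp h3 hg) (integrable_inner_of_memLp hf' hg),
    toReal_eLpNorm hn.1]
  simpa only [Pi.sub_apply, inner_sub_left] using abs_integral_inner_le hn hg

end CauchySchwarz

/-! ### Test functions and weak derivatives -/

lemma integrable_mul_of_memLp {Y : Type*} [MeasurableSpace Y] {μ : Measure Y} {f g : Y → ℝ}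
    (hf : MemLp f 2 μ) (hg : MemLp g 2 μ) : Integrable (fun x => f x * g x) μ := by
  simpa [mul_comm] using integrable_inner_of_memLp hf hg

lemma memLp_coord {Y ι : Type*} [Fintype ι] [MeasurableSpace Y] {μ : Measure Y}
    {f : Y → EuclideanSpace ℝ ι} (hf : MemLp f 2 μ) (i : ι) : MemLp (fun x => f x i) 2 μ :=
  (EuclideanSpace.proj (𝕜 := ℝ) i : EuclideanSpace ℝ ι →L[ℝ] ℝ).comp_memLp' hf

lemma IsTest.memLp {F : Type*} [NormedAddCommGroup F] [NormedSpace ℝ F] {U : Set Pt} {φ : Pt → F}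
    (h : IsTest U φ) (S : Set Pt) : MemLp φ 2 (vol S) :=
  (h.smooth.continuous.memLp_of_hasCompactSupport (μ := volume) h.compact).restrict S

lemma tsupport_pd_subset (φ : Pt → ℝ) (j : Fin 2) : tsupport (pd j φ) ⊆ tsupport φ :=
  tsupport_fderiv_apply_subset ℝ (EuclideanSpace.single j 1)

lemma IsTest.pd {U : Set Pt} {φ : Pt → ℝ} (h : IsTest U φ) (j : Fin 2) : IsTest U (pd j φ) where
  smooth := contDiff_pd h.smooth j
  compact := h.compact.fderiv_apply (𝕜 := ℝ) _
  supp := (tsupport_pd_subset φ j).trans h.supp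

lemma IsTest.mono {F : Type*} [NormedAddCommGroup F] [NormedSpace ℝ F] {U V : Set Pt} {φ : Pt → F}
    (h : IsTest U φ) (hUV : U ⊆ V) : IsTest V φ := ⟨h.smooth, h.compact, h.supp.trans hUV⟩

lemma IsTest.eq_zero {F : Type*} [NormedAddCommGroup F] [NormedSpace ℝ F] {U : Set Pt} {φ : Pt → F}
    (h : IsTest U φ) {x : Pt} (hx : x ∉ U) : φ x = 0 :=
  image_eq_zero_of_notMem_tsupport fun hx' => hx (h.supp hx')

lemma isTest_toLp {ι : Type*} [Fintype ι] {U : Set Pt} {φ : Pt → EuclideanSpace ℝ ι}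
    (h : ∀ i, IsTest U fun x => φ x i) : IsTest U φ := by
  have hs : tsupport φ ⊆ ⋃ i, tsupport fun x => φ x i := by
    refine closure_minimal (fun x hx => ?_) (isClosed_iUnion_of_finite fun i => isClosed_tsupport _)
    by_contra hcon
    refine hx (PiLp.ext fun i => ?_)
    exact image_eq_zero_of_notMem_tsupport (f := fun x => φ x i) fun hx' => hcon (Set.mem_iUnion_of_mem i hx')
  refine ⟨contDiff_euclidean.2 fun i => (h i).smooth, ?_,
    hs.trans (Set.iUnion_subset fun i => (h i).supp)⟩
  exact (isCompact_iUnion fun i => (h i).compact).of_isClosed_subset (isClosed_tsupport _) hs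

lemma IsTest.neg {U : Set Pt} {φ : Pt → ℝ} (h : IsTest U φ) : IsTest U fun x => -φ x := by
  have he : tsupport (fun x => -φ x) = tsupport φ := by
    simp [tsupport, Function.support_fun_neg]
  exact ⟨h.smooth.neg, by rw [HasCompactSupport, he]; exact h.compact, by rw [he]; exact h.supp⟩

lemma isTest_rotC {U : Set Pt} {φ : Pt → ℝ} (h : IsTest U φ) : IsTest U (rotC φ) := by
  refine isTest_toLp fun i => ?_
  fin_cases i
  · exact (h.pd 1).neg
  · exact h.pd 0

lemma gradC_rotC (φ : Pt → ℝ) (x : Pt) :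
    gradC (rotC φ) x (0, 0) = -pd 0 (pd 1 φ) x ∧ gradC (rotC φ) x (0, 1) = -pd 1 (pd 1 φ) x ∧
      gradC (rotC φ) x (1, 0) = pd 0 (pd 0 φ) x ∧ gradC (rotC φ) x (1, 1) = pd 1 (pd 0 φ) x := by
  refine ⟨?_, ?_, rfl, rfl⟩ <;> exact pd_neg _ _ _

lemma isTest_gradC_rotC {U : Set Pt} {φ : Pt → ℝ} (h : IsTest U φ) :
    IsTest U (gradC (rotC φ)) := by
  refine isTest_toLp fun ij => ?_
  obtain ⟨i, j⟩ := ij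
  fin_cases i <;> fin_cases j
  · convert ((h.pd 1).pd 0).neg using 2 with x; exact (gradC_rotC φ x).1
  · convert ((h.pd 1).pd 1).neg using 2 with x; exact (gradC_rotC φ x).2.1
  · exact (h.pd 0).pd 0
  · exact (h.pd 0).pd 1

lemma norm_gradC_rotC_le {φ : Pt → ℝ} {x : Pt} {k : ℝ} (hk : 0 ≤ k)
    (h : ∀ i j, |pd i (pd j φ) x| ≤ k) : ‖gradC (rotC φ) x‖ ≤ 2 * k := by
  obtain ⟨h1, h2, h3, h4⟩ := gradC_rotC φ x
  have hsq : ∀ i j, pd i (pd j φ) x ^ 2 ≤ k ^ 2 := fun i j => by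
    rw [← sq_abs]; exact pow_le_pow_left₀ (abs_nonneg _) (h i j) 2
  rw [EuclideanSpace.norm_eq, Real.sqrt_le_left (by positivity)]
  simp only [Fintype.sum_prod_type, Fin.sum_univ_two, h1, h2, h3, h4, Real.norm_eq_abs, sq_abs]
  nlinarith [hsq 0 0, hsq 0 1, hsq 1 0, hsq 1 1]

/-- The Laplacian of a smooth function. -/
noncomputable def lapC (φ : Pt → ℝ) (x : Pt) : ℝ := pd 0 (pd 0 φ) x + pd 1 (pd 1 φ) x

lemma integral_four {Y : Type*} [MeasurableSpace Y] {μ : Measure Y} {a b c d : Y → ℝ}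
    (ha : Integrable a μ) (hb : Integrable b μ) (hc : Integrable c μ) (hd : Integrable d μ)
    {p q r s : ℝ} : ∫ x, (p * a x + q * b x + r * c x + s * d x) ∂μ =
      p * ∫ x, a x ∂μ + q * ∫ x, b x ∂μ + r * ∫ x, c x ∂μ + s * ∫ x, d x ∂μ := by
  rw [integral_add (f := fun x => p * a x + q * b x + r * c x)
      (((ha.const_mul p).add (hb.const_mul q)).add (hc.const_mul r)) (hd.const_mul s),
    integral_add (f := fun x => p * a x + q * b x)
      ((ha.const_mul p).add (hb.const_mul q)) (hc.const_mul r),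
    integral_add (ha.const_mul p) (hb.const_mul q)]
  simp only [integral_const_mul]

/-- Tested with a rotated gradient, a weak gradient acts only through its curl. -/
lemma integral_inner_gradC_rotC {U : Set Pt} {v : Pt → Pt} {Dv : Pt → Mat} (hv : MemH1 U v Dv)
    {φ : Pt → ℝ} (h : IsTest U φ) :
    ∫ x, inner ℝ (Dv x) (gradC (rotC φ) x) ∂(vol U) =
      ∫ x, (Dv x (1, 0) - Dv x (0, 1)) * lapC φ x ∂(vol U) := by
  have hI : ∀ i j k l, Integrable (fun x => Dv x (i, j) * pd k (pd l φ) x) (vol U) :=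
    fun i j k l => integrable_mul_of_memLp (memLp_coord hv.memLp_grad (i, j))
      (((h.pd l).pd k).memLp U)
  -- the rows of a weak gradient are curl-free: test with second derivatives of `φ`
  have hswap : ∀ i j k l, ∫ x, Dv x (i, j) * pd k (pd l φ) x ∂(vol U) =
      ∫ x, Dv x (i, k) * pd j (pd l φ) x ∂(vol U) := by
    intro i j k l
    have h1 := hv.weak i j _ ((h.pd l).pd k)
    have h2 := hv.weak i k _ ((h.pd l).pd j)
    have h3 : ∀ x, pd j (pd k (pd l φ)) x = pd k (pd j (pd l φ)) x :=
      fun x => pd_comm (h.pd l).smooth j k x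
    simp_rw [h3] at h1
    linarith
  have e1 : ∀ x, inner ℝ (Dv x) (gradC (rotC φ) x) =
      -1 * (Dv x (0, 0) * pd 0 (pd 1 φ) x) + -1 * (Dv x (0, 1) * pd 1 (pd 1 φ) x)
        + 1 * (Dv x (1, 0) * pd 0 (pd 0 φ) x) + 1 * (Dv x (1, 1) * pd 1 (pd 0 φ) x) := by
    intro x
    obtain ⟨h1, h2, h3, h4⟩ := gradC_rotC φ x
    simp only [PiLp.inner_apply, Fintype.sum_prod_type, Fin.sum_univ_two, h1, h2, h3, h4]
    simp
    ring
  have e2 : ∀ x, (Dv x (1, 0) - Dv x (0, 1)) * lapC φ x =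
      1 * (Dv x (1, 0) * pd 0 (pd 0 φ) x) + 1 * (Dv x (1, 0) * pd 1 (pd 1 φ) x)
        + -1 * (Dv x (0, 1) * pd 0 (pd 0 φ) x) + -1 * (Dv x (0, 1) * pd 1 (pd 1 φ) x) := by
    intro x; rw [lapC]; ring
  simp_rw [e1, e2]
  rw [integral_four (hI _ _ _ _) (hI _ _ _ _) (hI _ _ _ _) (hI _ _ _ _),
    integral_four (hI _ _ _ _) (hI _ _ _ _) (hI _ _ _ _) (hI _ _ _ _)]
  have a := hswap 0 0 1 0
  have b := hswap 1 1 0 1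
  have c : ∀ x, pd 0 (pd 1 φ) x = pd 1 (pd 0 φ) x := pd_comm h.smooth 0 1
  simp_rw [c] at b ⊢
  linarith

/-- The momentum equation tested with a solenoidal field: the pressure drops out. -/
lemma momentum_rotC {U : Set Pt} {ν : ℝ} {f uD u : Pt → Pt} {DuD Du : Pt → Mat} {p : Pt → ℝ}
    (hS : IsStokesSolution U ν f uD DuD u Du p) {φ : Pt → ℝ} (h : IsTest U φ) :
    ν * ∫ x, inner ℝ (Du x) (gradC (rotC φ) x) ∂(vol U) =
      ∫ x, inner ℝ (f x) (rotC φ x) ∂(vol U) := by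
  have hH : MemH10 U (rotC φ) (gradC (rotC φ)) :=
    ⟨(isTest_rotC h).memLp U, (isTest_gradC_rotC h).memLp U, fun _ => rotC φ,
      fun _ => isTest_rotC h, by simp, by simp⟩
  have hdiv : ∀ x, divOf (gradC (rotC φ) x) = 0 := by
    intro x
    obtain ⟨h1, -, -, h4⟩ := gradC_rotC φ x
    rw [divOf, h1, h4, pd_comm h.smooth 0 1]; ring
  have := hS.momentum _ _ hH
  simpa [hdiv] using this

/-- The error identity: the gradient of the velocity error, tested with a rotated gradient. -/
lemma error_identity {U : Set Pt} {ν : ℝ} {f uD u uh : Pt → Pt} {DuD Du Duh : Pt → Mat}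
    {p : Pt → ℝ} (hS : IsStokesSolution U ν f uD DuD u Du p) (hh : MemH1 U uh Duh)
    {φ : Pt → ℝ} (h : IsTest U φ) :
    ν * ∫ x, inner ℝ ((Du - Duh) x) (gradC (rotC φ) x) ∂(vol U) =
      ∫ x, inner ℝ (f x) (rotC φ x) ∂(vol U)
        - ν * ∫ x, (Duh x (1, 0) - Duh x (0, 1)) * lapC φ x ∂(vol U) := by
  have hg := (isTest_gradC_rotC h).memLp U
  simp only [Pi.sub_apply, inner_sub_left]
  rw [integral_sub (integrable_inner_of_memLp hS.velocity.memLp_grad hg)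
    (integrable_inner_of_memLp hh.memLp_grad hg), mul_sub, momentum_rotC hS h,
    integral_inner_gradC_rotC hh h]

lemma integral_mul_pd {a b : Pt → ℝ} (ha : ContDiff ℝ ∞ a) (hb : ContDiff ℝ ∞ b)
    (hc : HasCompactSupport b) (j : Fin 2) : ∫ x, a x * pd j b x = -∫ x, pd j a x * b x := by
  have h1 := contDiff_pd ha j
  have h2 := contDiff_pd hb j
  have hc2 : HasCompactSupport (pd j b) := hc.fderiv_apply (𝕜 := ℝ) _
  exact integral_mul_fderiv_eq_neg_fderiv_mul_of_integrable
    ((h1.continuous.mul hb.continuous).integrable_of_hasCompactSupport hc.mul_left)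
    ((ha.continuous.mul h2.continuous).integrable_of_hasCompactSupport hc2.mul_left)
    ((ha.continuous.mul hb.continuous).integrable_of_hasCompactSupport hc.mul_left)
    (fun x _ => contDiff_differentiable ha x) (fun x _ => contDiff_differentiable hb x)

lemma integral_mul_lapC {a b : Pt → ℝ} (ha : ContDiff ℝ ∞ a) (hb : ContDiff ℝ ∞ b)
    (hc : HasCompactSupport b) : ∫ x, a x * lapC b x = ∫ x, lapC a x * b x := by
  have hj : ∀ j, ∫ x, a x * pd j (pd j b) x = ∫ x, pd j (pd j a) x * b x := fun j => by
    rw [integral_mul_pd ha (contDiff_pd hb j) (hc.fderiv_apply (𝕜 := ℝ) _),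
      integral_mul_pd (contDiff_pd ha j) hb hc, neg_neg]
  have hc2 : ∀ j, HasCompactSupport (pd j (pd j b)) := fun j =>
    (hc.fderiv_apply (𝕜 := ℝ) (EuclideanSpace.single j 1)).fderiv_apply (𝕜 := ℝ) _
  simp only [lapC, mul_add, add_mul]
  rw [integral_add, integral_add, hj, hj]
  · exact ((contDiff_pd (contDiff_pd ha 0) 0).continuous.mul
      hb.continuous).integrable_of_hasCompactSupport hc.mul_left
  · exact ((contDiff_pd (contDiff_pd ha 1) 1).continuous.mul
      hb.continuous).integrable_of_hasCompactSupport hc.mul_left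
  · exact (ha.continuous.mul
      (contDiff_pd (contDiff_pd hb 0) 0).continuous).integrable_of_hasCompactSupport (hc2 0).mul_left
  · exact (ha.continuous.mul
      (contDiff_pd (contDiff_pd hb 1) 1).continuous).integrable_of_hasCompactSupport (hc2 1).mul_left

lemma setIntegral_eq_integral_of_support {F : Pt → ℝ} {U : Set Pt} (h : ∀ x ∉ U, F x = 0) :
    ∫ x, F x ∂(vol U) = ∫ x, F x :=
  setIntegral_eq_integral_of_forall_compl_eq_zero fun x hx => h x hx

lemma setIntegral_vol_mono {F : Pt → ℝ} {U V : Set Pt} (hUV : U ⊆ V) (h : ∀ x ∉ U, F x = 0) :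
    ∫ x, F x ∂(vol V) = ∫ x, F x ∂(vol U) := by
  rw [setIntegral_eq_integral_of_support h,
    setIntegral_eq_integral_of_support fun x hx => h x fun hx' => hx (hUV hx')]

/-- On each element the weak gradient of the discrete velocity is the gradient of its polynomial. -/
lemma weakGrad_eq_pd {K : Geometry.SimplicialComplex ℝ Pt} {m : ℕ} {uh : Pt → Pt} {Duh : Pt → Mat}
    {P : Finset Pt → Fin 2 → Poly} (hD : IsDiscreteVelocity K m uh Duh P) {T : Finset Pt}
    (hT : T ∈ triangles K) (i j : Fin 2) :
    ∀ᵐ x ∂(vol (elem T)), Duh x (i, j) = pd j (val (P T i)) x := by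
  have hsub := elem_subset_domain hT
  have hL : MemLp (fun x => Duh x (i, j)) 2 (vol (elem T)) :=
    (memLp_coord hD.memH1.memLp_grad (i, j)).mono_measure (Measure.restrict_mono hsub le_rfl)
  have hc := contDiff_val (P T i)
  have hloc : LocallyIntegrableOn (fun x => Duh x (i, j) - pd j (val (P T i)) x) (elem T) := by
    refine LocallyIntegrableOn.sub ?_
      ((contDiff_pd hc j).continuous.locallyIntegrable.locallyIntegrableOn _)
    exact locallyIntegrableOn_of_locallyIntegrable_restrict
      (MemLp.locallyIntegrable (μ := volume.restrict (elem T)) hL (by norm_num))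
  have := (isOpen_elem T).ae_eq_zero_of_integral_contDiff_smul_eq_zero hloc ?_
  · refine (ae_restrict_iff' (isOpen_elem T).measurableSet).2 ?_
    filter_upwards [this] with x hx hxT
    exact sub_eq_zero.1 (hx hxT)
  · intro χ h1 h2 h3
    have hχ : IsTest (elem T) χ := ⟨h1, h2, h3⟩
    have w := hD.memH1.weak i j χ (hχ.mono hsub)
    rw [setIntegral_vol_mono hsub fun x hx => by rw [(hχ.pd j).eq_zero hx, mul_zero],
      setIntegral_vol_mono hsub fun x hx => by rw [hχ.eq_zero hx, mul_zero]] at w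
    have e : ∫ x, uh x i * pd j χ x ∂(vol (elem T)) =
        ∫ x, val (P T i) x * pd j χ x ∂(vol (elem T)) :=
      setIntegral_congr_fun (isOpen_elem T).measurableSet fun x hx => by
        simp only [hD.eq T hT x hx i]
    rw [e, setIntegral_eq_integral_of_support fun x hx => by rw [(hχ.pd j).eq_zero hx, mul_zero],
      integral_mul_pd hc h1 h2, ← setIntegral_eq_integral_of_support (U := elem T)
        fun x hx => by rw [hχ.eq_zero hx, mul_zero]] at w
    rw [← setIntegral_eq_integral_of_support (U := elem T)
      fun x hx => by rw [hχ.eq_zero hx, zero_smul]]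
    have hpd : Integrable (fun x => pd j (val (P T i)) x * χ x) (vol (elem T)) :=
      (((contDiff_pd hc j).continuous.mul h1.continuous).integrable_of_hasCompactSupport
        h2.mul_left).integrableOn
    simp only [smul_eq_mul, mul_comm (χ _), sub_mul]
    rw [integral_sub (integrable_mul_of_memLp hL (hχ.memLp _)) hpd]
    linarith

/-! ### The residual identities on triangles and edges -/

/-- The curl of a polynomial vector field. -/
noncomputable def curlPoly (P : Fin 2 → Poly) : Poly :=
  MvPolynomial.pderiv 0 (P 1) - MvPolynomial.pderiv 1 (P 0)

/-- The divergence of a polynomial vector field. -/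
noncomputable def divPoly (P : Fin 2 → Poly) : Poly :=
  MvPolynomial.pderiv 0 (P 0) + MvPolynomial.pderiv 1 (P 1)

lemma pderiv_comm (Q : Poly) (i j : Fin 2) :
    MvPolynomial.pderiv i (MvPolynomial.pderiv j Q) =
      MvPolynomial.pderiv j (MvPolynomial.pderiv i Q) := by
  have : ⁅(MvPolynomial.pderiv i : Derivation ℝ Poly Poly),
      (MvPolynomial.pderiv j : Derivation ℝ Poly Poly)⁆ = 0 := by
    refine MvPolynomial.derivation_ext fun k => ?_
    rw [Derivation.commutator_apply]
    simp [MvPolynomial.pderiv_X, Pi.single_apply, apply_ite]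
  have h := DFunLike.congr_fun this Q
  rw [Derivation.commutator_apply] at h
  exact sub_eq_zero.1 h

lemma lapC_val (Q : Poly) : lapC (val Q) = val (lap Q) := by
  funext x
  rw [lapC, pd_val, pd_val, pd_val, pd_val, lap, val_add]

lemma lapC_curlPoly (P : Fin 2 → Poly) : lapC (val (curlPoly P)) = curlLap P := by
  rw [lapC_val]
  funext x
  rw [curlLap]
  congr 1
  simp only [lap, curlPoly, map_sub, map_add]
  rw [pderiv_comm (P 0) 0 1, pderiv_comm (MvPolynomial.pderiv 0 (P 0)) 0 1,
    pderiv_comm (P 1) 1 0, pderiv_comm (MvPolynomial.pderiv 1 (P 1)) 1 0]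
  ring

/-- On a line, the normal derivative of the curl is the tangential derivative of the divergence
minus the tangential component of the Laplacian. -/
lemma fderiv_curlPoly_nrm (P : Fin 2 → Poly) (x τ : Pt) :
    fderiv ℝ (val (curlPoly P)) x (nrm τ) =
      fderiv ℝ (val (divPoly P)) x τ - inner ℝ (lapVec P x) τ := by
  rw [fderiv_apply_eq, fderiv_apply_eq, inner_eq]
  simp only [pd_val]
  simp only [curlPoly, divPoly, lapVec, lap, map_sub, map_add, val_sub, val_add, nrm,
    Matrix.cons_val_zero, Matrix.cons_val_one]
  rw [pderiv_comm (P 0) 0 1, pderiv_comm (P 1) 0 1]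
  ring

/-- The residual identity on a triangle. -/
lemma elem_identity {K : Geometry.SimplicialComplex ℝ Pt} {m : ℕ} {ν : ℝ} {f uD u uh : Pt → Pt}
    {c p : Pt → ℝ} {DuD Du Duh : Pt → Mat} {P : Finset Pt → Fin 2 → Poly}
    (hS : IsStokesSolution (domain K) ν f uD DuD u Du p) (hD : IsDiscreteVelocity K m uh Duh P)
    {T : Finset Pt} (hT : T ∈ triangles K) (hf : MemHcurl (elem T) f c) {φ : Pt → ℝ}
    (h : IsTest (elem T) φ) :
    ∫ x, curlRes ν c (P T) x * φ x ∂(vol (elem T)) =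
      -(ν * ∫ x, inner ℝ ((Du - Duh) x) (gradC (rotC φ) x) ∂(vol (elem T))) := by
  have hsub := elem_subset_domain hT
  have h0 := error_identity hS hD.memH1 (h.mono hsub)
  have hlap : ∀ x ∉ elem T, lapC φ x = 0 := fun x hx => by
    rw [lapC, ((h.pd 0).pd 0).eq_zero hx, ((h.pd 1).pd 1).eq_zero hx, add_zero]
  rw [setIntegral_vol_mono hsub fun x hx => by rw [(isTest_gradC_rotC h).eq_zero hx, inner_zero_right],
    setIntegral_vol_mono hsub fun x hx => by rw [(isTest_rotC h).eq_zero hx, inner_zero_right],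
    setIntegral_vol_mono hsub fun x hx => by rw [hlap x hx, mul_zero], hf.weak φ h] at h0
  have hcurl : ∫ x, (Duh x (1, 0) - Duh x (0, 1)) * lapC φ x ∂(vol (elem T)) =
      ∫ x, curlLap (P T) x * φ x ∂(vol (elem T)) := by
    have e1 : ∫ x, (Duh x (1, 0) - Duh x (0, 1)) * lapC φ x ∂(vol (elem T)) =
        ∫ x, val (curlPoly (P T)) x * lapC φ x ∂(vol (elem T)) := by
      refine integral_congr_ae ?_
      filter_upwards [weakGrad_eq_pd hD hT 1 0, weakGrad_eq_pd hD hT 0 1] with x h1 h2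
      rw [h1, h2, curlPoly, val_sub, pd_val, pd_val]
    rw [e1, setIntegral_eq_integral_of_support fun x hx => by rw [hlap x hx, mul_zero],
      integral_mul_lapC (contDiff_val _) h.smooth h.compact, lapC_curlPoly,
      setIntegral_eq_integral_of_support fun x hx => by rw [h.eq_zero hx, mul_zero]]
  rw [hcurl] at h0
  have hi : Integrable (fun x => curlLap (P T) x * φ x) (vol (elem T)) :=
    (((contDiff_val _).continuous.mul h.smooth.continuous).integrable_of_hasCompactSupport
      h.compact.mul_left).integrableOn
  simp only [curlRes, add_mul, mul_assoc]
  rw [integral_add (integrable_mul_of_memLp hf.memLp_curl (h.memLp _)) (hi.const_mul ν),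
    integral_const_mul]
  linarith

lemma abs_le_of_mem_ball_line {M τ : Pt} (hτ : ‖τ‖ = 1) {s l : ℝ}
    (h : M + s • τ ∈ Metric.ball M l) : |s| < l := by
  rwa [Metric.mem_ball, dist_eq_norm, add_sub_cancel_left, norm_smul, hτ, mul_one,
    Real.norm_eq_abs] at h

lemma integral_line_eq_arc {E : Finset Pt} {M τ : Pt} {h l : ℝ} (H : IsEdgeFrame E M τ h)
    (hl : l ≤ h / 2) {F : Pt → ℝ} (hF : ∀ x ∉ Metric.ball M l, F x = 0) :
    ∫ s : ℝ, F (M + s • τ) = ∫ x, F x ∂(arc E) := by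
  rw [H.integral_arc]
  symm
  refine setIntegral_eq_integral_of_forall_compl_eq_zero fun s hs => hF _ fun hb => hs ?_
  have := abs_lt.1 (abs_le_of_mem_ball_line H.norm hb)
  exact ⟨by linarith, by linarith⟩

lemma isFiniteMeasure_arc {E : Finset Pt} {M τ : Pt} {h : ℝ} (H : IsEdgeFrame E M τ h) :
    IsFiniteMeasure (arc E) := by
  rw [H.arc_eq]; infer_instance

lemma arc_real_univ {E : Finset Pt} {M τ : Pt} {h : ℝ} (H : IsEdgeFrame E M τ h) :
    (arc E).real Set.univ = h := by
  rw [H.arc_eq, map_measureReal_apply (isometry_line M H.norm).continuous.measurable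
    MeasurableSet.univ]
  simp [H.pos.le]

lemma IsTest.memLp_arc {E : Finset Pt} {M τ : Pt} {h : ℝ} (H : IsEdgeFrame E M τ h) {U : Set Pt}
    {φ : Pt → ℝ} (hφ : IsTest U φ) : MemLp φ 2 (arc E) := by
  have := isFiniteMeasure_arc H
  exact hφ.smooth.continuous.memLp_of_hasCompactSupport hφ.compact

/-- Green's formula for the curl in a half-plane. -/
lemma integral_halfPlane_curl {M τ : Pt} (hτ : ‖τ‖ = 1) {ψ : Pt → Pt} (hψ : ContDiff ℝ ∞ ψ)
    {φ : Pt → ℝ} (hφ : ContDiff ℝ ∞ φ) (hc : HasCompactSupport φ) :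
    ∫ x in halfPlane M (nrm τ), (inner ℝ (ψ x) (rotC φ x) + curlC ψ x * φ x) =
      ∫ s : ℝ, inner ℝ (ψ (M + s • τ)) τ * φ (M + s • τ) := by
  have hψi : ∀ i, ContDiff ℝ ∞ fun x => ψ x i := fun i => contDiff_euclidean.1 hψ i
  have hG : ∀ i, ContDiff ℝ ∞ fun x => φ x * ψ x i := fun i => hφ.mul (hψi i)
  have hGc : ∀ i, HasCompactSupport fun x => φ x * ψ x i := fun i => hc.mul_right
  have hpt : ∀ x, inner ℝ (ψ x) (rotC φ x) + curlC ψ x * φ x =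
      pd 0 (fun x => φ x * ψ x 1) x - pd 1 (fun x => φ x * ψ x 0) x := by
    intro x
    rw [pd_mul (contDiff_differentiable hφ) (contDiff_differentiable (hψi 1)),
      pd_mul (contDiff_differentiable hφ) (contDiff_differentiable (hψi 0)), inner_eq, curlC, rotC]
    simp only [Matrix.cons_val_zero, Matrix.cons_val_one]
    ring
  have hI : ∀ i j, Integrable (pd j fun x => φ x * ψ x i) := fun i j =>
    (contDiff_pd (hG i) j).continuous.integrable_of_hasCompactSupport
      ((hGc i).fderiv_apply (𝕜 := ℝ) _)
  have hL : ∀ i, Integrable fun s : ℝ => φ (M + s • τ) * ψ (M + s • τ) i := fun i =>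
    ((hG i).continuous.comp (isometry_line M hτ).continuous).integrable_of_hasCompactSupport
      ((hGc i).comp_isClosedEmbedding (isometry_line M hτ).isClosedEmbedding)
  simp_rw [hpt]
  rw [integral_sub (hI 1 0).integrableOn (hI 0 1).integrableOn,
    integral_halfPlane_pd hτ (hG 1) (hGc 1), integral_halfPlane_pd hτ (hG 0) (hGc 0)]
  simp only [inner_eq, nrm, Matrix.cons_val_zero, Matrix.cons_val_one]
  rw [show (fun s : ℝ => (ψ (M + s • τ) 0 * τ 0 + ψ (M + s • τ) 1 * τ 1) * φ (M + s • τ)) =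
    fun s => τ 0 * (φ (M + s • τ) * ψ (M + s • τ) 0) + τ 1 * (φ (M + s • τ) * ψ (M + s • τ) 1) by
      funext s; ring,
    integral_add ((hL 0).const_mul _) ((hL 1).const_mul _), integral_const_mul, integral_const_mul]
  ring

/-- Green's second formula in a half-plane, for functions with vanishing normal derivative. -/
lemma integral_halfPlane_lapC {M τ : Pt} (hτ : ‖τ‖ = 1) {w φ : Pt → ℝ} (hw : ContDiff ℝ ∞ w)
    (hφ : ContDiff ℝ ∞ φ) (hc : HasCompactSupport φ)
    (hn : ∀ s : ℝ, fderiv ℝ φ (M + s • τ) (nrm τ) = 0) :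
    ∫ x in halfPlane M (nrm τ), w x * lapC φ x =
      (∫ x in halfPlane M (nrm τ), lapC w x * φ x) +
        ∫ s : ℝ, φ (M + s • τ) * fderiv ℝ w (M + s • τ) (nrm τ) := by
  have hφj := fun j => contDiff_pd hφ j
  have hwj := fun j => contDiff_pd hw j
  have hcj : ∀ j, HasCompactSupport (pd j φ) := fun j => hc.fderiv_apply (𝕜 := ℝ) _
  have hG : ∀ j, ContDiff ℝ ∞ fun x => w x * pd j φ x - pd j w x * φ x := fun j =>
    (hw.mul (hφj j)).sub ((hwj j).mul hφ)
  have hGc : ∀ j, HasCompactSupport fun x => w x * pd j φ x - pd j w x * φ x := fun j =>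
    (hcj j).mul_left.sub hc.mul_left
  have hpt : ∀ x, w x * lapC φ x - lapC w x * φ x =
      pd 0 (fun x => w x * pd 0 φ x - pd 0 w x * φ x) x +
        pd 1 (fun x => w x * pd 1 φ x - pd 1 w x * φ x) x := by
    intro x
    have hj : ∀ j, pd j (fun x => w x * pd j φ x - pd j w x * φ x) x =
        w x * pd j (pd j φ) x - pd j (pd j w) x * φ x := fun j => by
      rw [pd_sub (contDiff_differentiable (hw.mul (hφj j)))
        (contDiff_differentiable ((hwj j).mul hφ)), pd_mul (contDiff_differentiable hw)
        (contDiff_differentiable (hφj j)), pd_mul (contDiff_differentiable (hwj j))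
        (contDiff_differentiable hφ)]
      ring
    rw [hj, hj, lapC, lapC]; ring
  have hI : ∀ j, Integrable (pd j fun x => w x * pd j φ x - pd j w x * φ x) := fun j =>
    (contDiff_pd (hG j) j).continuous.integrable_of_hasCompactSupport
      ((hGc j).fderiv_apply (𝕜 := ℝ) _)
  have hL : ∀ j, Integrable fun s : ℝ => w (M + s • τ) * pd j φ (M + s • τ) -
      pd j w (M + s • τ) * φ (M + s • τ) := fun j =>
    ((hG j).continuous.comp (isometry_line M hτ).continuous).integrable_of_hasCompactSupport
      ((hGc j).comp_isClosedEmbedding (isometry_line M hτ).isClosedEmbedding)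
  have hcl : HasCompactSupport (lapC φ) := ((hcj 0).fderiv_apply (𝕜 := ℝ) _).add
    ((hcj 1).fderiv_apply (𝕜 := ℝ) _)
  have hsl : ∀ {a : Pt → ℝ}, ContDiff ℝ ∞ a → Continuous (lapC a) := fun ha =>
    (contDiff_pd (contDiff_pd ha 0) 0).continuous.add (contDiff_pd (contDiff_pd ha 1) 1).continuous
  have i1 : Integrable fun x => w x * lapC φ x :=
    (hw.continuous.mul (hsl hφ)).integrable_of_hasCompactSupport hcl.mul_left
  have i2 : Integrable fun x => lapC w x * φ x :=
    ((hsl hw).mul hφ.continuous).integrable_of_hasCompactSupport hc.mul_left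
  rw [← sub_eq_iff_eq_add', ← integral_sub i1.integrableOn i2.integrableOn]
  simp_rw [hpt]
  rw [integral_add (hI 0).integrableOn (hI 1).integrableOn,
    integral_halfPlane_pd hτ (hG 0) (hGc 0), integral_halfPlane_pd hτ (hG 1) (hGc 1)]
  have e : ∀ s : ℝ, φ (M + s • τ) * fderiv ℝ w (M + s • τ) (nrm τ) =
      -nrm τ 0 * (w (M + s • τ) * pd 0 φ (M + s • τ) - pd 0 w (M + s • τ) * φ (M + s • τ)) +
      -nrm τ 1 * (w (M + s • τ) * pd 1 φ (M + s • τ) - pd 1 w (M + s • τ) * φ (M + s • τ)) := by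
    intro s
    have h0 := hn s
    rw [fderiv_apply_eq] at h0 ⊢
    linear_combination w (M + s • τ) * h0
  simp_rw [e]
  rw [integral_add ((hL 0).const_mul _) ((hL 1).const_mul _), integral_const_mul,
    integral_const_mul]
  ring

lemma HasTangentialTrace.neg {T E : Finset Pt} {τ : Pt} {f : Pt → Pt} {c g : Pt → ℝ}
    (h : HasTangentialTrace T E τ f c g) : HasTangentialTrace T E (-τ) f c fun x => -g x := by
  refine ⟨h.memLp.neg, ?_⟩
  obtain ⟨ψ, h1, h2, h3, h4⟩ := h.approx
  refine ⟨ψ, h1, h2, h3, ?_⟩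
  convert h4 using 2 with n
  rw [← eLpNorm_neg]
  congr 1
  funext x
  simp [inner_neg_right]
  ring

lemma continuous_curlC {ψ : Pt → Pt} (hψ : ContDiff ℝ ∞ ψ) : Continuous (curlC ψ) := by
  have hψi : ∀ i, ContDiff ℝ ∞ fun x => ψ x i := fun i => contDiff_euclidean.1 hψ i
  exact (contDiff_pd (hψi 1) 0).continuous.sub (contDiff_pd (hψi 0) 1).continuous

/-- Green's formula for the tangential trace of a field in `H(curl, T)`. -/
lemma trace_identity {T E : Finset Pt} {M τ : Pt} {h l : ℝ} (H : IsEdgeFrame E M τ h)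
    (hl : l ≤ h / 2) (hO : IsOnSide T M (nrm τ) h l) {f : Pt → Pt} {c g : Pt → ℝ}
    (hf : MemHcurl (elem T) f c) (hg : HasTangentialTrace T E τ f c g) {φ : Pt → ℝ}
    (hφ : IsTest (Metric.ball M l) φ) :
    ∫ x, inner ℝ (f x) (rotC φ x) ∂(vol (elem T)) =
      ∫ x, g x * φ x ∂(arc E) - ∫ x, c x * φ x ∂(vol (elem T)) := by
  obtain ⟨ψ, h1, h2, h3, h4⟩ := hg.approx
  have hmul : ∀ a b : ℝ, inner ℝ a b = a * b := fun a b => by simp [mul_comm]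
  have t1 := tendsto_integral_inner (fun n => (h1 n).continuous.aestronglyMeasurable)
    hf.memLp ((isTest_rotC hφ).memLp _) h2
  have t2 := tendsto_integral_inner (fun n => (continuous_curlC (h1 n)).aestronglyMeasurable)
    hf.memLp_curl (hφ.memLp _) h3
  have t3 := tendsto_integral_inner
    (fun n => ((h1 n).continuous.inner continuous_const).aestronglyMeasurable)
    hg.memLp (hφ.memLp_arc H) (f := fun n x => inner ℝ (ψ n x) τ) h4
  simp only [hmul] at t2 t3
  have key : ∀ n, ∫ x, inner ℝ (ψ n x) (rotC φ x) ∂(vol (elem T)) +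
      ∫ x, curlC (ψ n) x * φ x ∂(vol (elem T)) = ∫ x, inner ℝ (ψ n x) τ * φ x ∂(arc E) := by
    intro n
    have hr := isTest_rotC hφ
    have i1 : Integrable (fun x => inner ℝ (ψ n x) (rotC φ x)) :=
      ((h1 n).continuous.inner hr.smooth.continuous).integrable_of_hasCompactSupport
        (hr.compact.mono fun x hx hx' => hx (by simp only [hx', inner_zero_right]))
    have i2 : Integrable (fun x => curlC (ψ n) x * φ x) :=
      ((continuous_curlC (h1 n)).mul hφ.smooth.continuous).integrable_of_hasCompactSupport
        hφ.compact.mul_left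
    simp only [vol]
    rw [← integral_add i1.integrableOn i2.integrableOn,
      setIntegral_elem_eq_halfPlane (norm_nrm H.norm) hO fun x hx => by
        rw [hr.eq_zero hx, hφ.eq_zero hx, inner_zero_right, mul_zero, add_zero],
      integral_halfPlane_curl H.norm (h1 n) hφ.smooth hφ.compact]
    exact integral_line_eq_arc H hl (F := fun x => inner ℝ (ψ n x) τ * φ x) fun x hx => by
      rw [hφ.eq_zero hx, mul_zero]
  have := tendsto_nhds_unique ((t1.add t2).congr key) t3
  linarith

/-- Green's formula for the curl of the discrete velocity on one side of an edge. -/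
lemma curl_identity {K : Geometry.SimplicialComplex ℝ Pt} {m : ℕ} {uh : Pt → Pt} {Duh : Pt → Mat}
    {P : Finset Pt → Fin 2 → Poly} (hD : IsDiscreteVelocity K m uh Duh P) {T E : Finset Pt}
    (hT : T ∈ triangles K) {M τ : Pt} {h l : ℝ} (H : IsEdgeFrame E M τ h) (hl : l ≤ h / 2)
    (hO : IsOnSide T M (nrm τ) h l) {φ : Pt → ℝ} (hφ : IsTest (Metric.ball M l) φ)
    (hn : ∀ s : ℝ, fderiv ℝ φ (M + s • τ) (nrm τ) = 0) :
    ∫ x, (Duh x (1, 0) - Duh x (0, 1)) * lapC φ x ∂(vol (elem T)) =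
      ∫ x, curlLap (P T) x * φ x ∂(vol (elem T)) +
        ∫ x, φ x * (fderiv ℝ (val (divPoly (P T))) x τ - inner ℝ (lapVec (P T) x) τ) ∂(arc E) := by
  have hlap : ∀ x ∉ Metric.ball M l, lapC φ x = 0 := fun x hx => by
    rw [lapC, ((hφ.pd 0).pd 0).eq_zero hx, ((hφ.pd 1).pd 1).eq_zero hx, add_zero]
  have e1 : ∫ x, (Duh x (1, 0) - Duh x (0, 1)) * lapC φ x ∂(vol (elem T)) =
      ∫ x, val (curlPoly (P T)) x * lapC φ x ∂(vol (elem T)) := by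
    refine integral_congr_ae ?_
    filter_upwards [weakGrad_eq_pd hD hT 1 0, weakGrad_eq_pd hD hT 0 1] with x h1 h2
    rw [h1, h2, curlPoly, val_sub, pd_val, pd_val]
  rw [e1, vol, setIntegral_elem_eq_halfPlane (norm_nrm H.norm) hO fun x hx => by
      rw [hlap x hx, mul_zero],
    integral_halfPlane_lapC H.norm (contDiff_val _) hφ.smooth hφ.compact hn, lapC_curlPoly,
    setIntegral_elem_eq_halfPlane (norm_nrm H.norm) hO fun x hx => by
      rw [hφ.eq_zero hx, mul_zero]]
  congr 1
  simp only [fderiv_curlPoly_nrm]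
  exact integral_line_eq_arc H hl (F := fun x => φ x * (fderiv ℝ (val (divPoly (P T))) x τ -
    inner ℝ (lapVec (P T) x) τ)) fun x hx => by rw [hφ.eq_zero hx, zero_mul]

lemma continuous_lapVec (P : Fin 2 → Poly) : Continuous (lapVec P) := by
  refine (PiLp.continuous_toLp 2 _).comp (continuous_pi fun i => ?_)
  fin_cases i
  · exact (contDiff_val _).continuous
  · exact (contDiff_val _).continuous

/-- The residual identity on an edge, for test functions with vanishing normal derivative. -/
lemma edge_identity {K : Geometry.SimplicialComplex ℝ Pt} {m : ℕ} {ν : ℝ} {f uD u uh : Pt → Pt}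
    {c p g₁ g₂ : Pt → ℝ} {DuD Du Duh : Pt → Mat} {P : Finset Pt → Fin 2 → Poly}
    (hS : IsStokesSolution (domain K) ν f uD DuD u Du p) (hD : IsDiscreteVelocity K m uh Duh P)
    (hfL : MemLp f 2 (vol (domain K)))
    {T₁ T₂ E : Finset Pt} (hT₁ : T₁ ∈ triangles K) (hT₂ : T₂ ∈ triangles K)
    (hf₁ : MemHcurl (elem T₁) f c) (hf₂ : MemHcurl (elem T₂) f c) {M τ : Pt} {h l : ℝ}
    (H : IsEdgeFrame E M τ h) (hl : l ≤ h / 2)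
    (h₁ : IsOnSide T₁ M (nrm τ) h l) (h₂ : IsOnSide T₂ M (nrm (-τ)) h l)
    (hg₁ : HasTangentialTrace T₁ E τ f c g₁) (hg₂ : HasTangentialTrace T₂ E τ f c g₂)
    {φ : Pt → ℝ} (hφ : IsTest (Metric.ball M l) φ)
    (hn : ∀ s : ℝ, fderiv ℝ φ (M + s • τ) (nrm τ) = 0) :
    ∫ x, ((g₁ x + ν * inner ℝ (lapVec (P T₁) x) τ) - (g₂ x + ν * inner ℝ (lapVec (P T₂) x) τ)) *
        φ x ∂(arc E) =
      ν * ∫ x, inner ℝ ((Du - Duh) x) (gradC (rotC φ) x) ∂(vol (elem T₁ ∪ elem T₂)) +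
        ∫ x, curlRes ν c (P T₁) x * φ x ∂(vol (elem T₁)) +
        ∫ x, curlRes ν c (P T₂) x * φ x ∂(vol (elem T₂)) +
        ν * ∫ x, φ x * (fderiv ℝ (val (divPoly (P T₁))) x τ -
          fderiv ℝ (val (divPoly (P T₂))) x τ) ∂(arc E) := by
  have hfin := isFiniteMeasure_arc H
  rw [nrm_neg] at h₂
  have hball := ball_subset_domain hT₁ hT₂ h₁ h₂
  have hdis := disjoint_elem (norm_nrm H.norm) h₁ h₂
  have hsub₁ := elem_subset_domain hT₁
  have hsub₂ := elem_subset_domain hT₂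
  have hr := isTest_rotC hφ
  have hg := isTest_gradC_rotC hφ
  have hlap : ∀ x ∉ Metric.ball M l, lapC φ x = 0 := fun x hx => by
    rw [lapC, ((hφ.pd 0).pd 0).eq_zero hx, ((hφ.pd 1).pd 1).eq_zero hx, add_zero]
  have hmono : ∀ {S : Set Pt} (_ : S ⊆ domain K) {F : Pt → ℝ}, Integrable F (vol (domain K)) →
      IntegrableOn F S := fun hS F hF => IntegrableOn.mono_set hF hS
  have hlapI : Integrable (fun x => (Duh x (1, 0) - Duh x (0, 1)) * lapC φ x) (vol (domain K)) :=
    integrable_mul_of_memLp ((memLp_coord hD.memH1.memLp_grad (1, 0)).sub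
      (memLp_coord hD.memH1.memLp_grad (0, 1)))
      ((((hφ.pd 0).pd 0).memLp _).add (((hφ.pd 1).pd 1).memLp _))
  have hfI : Integrable (fun x => inner ℝ (f x) (rotC φ x)) (vol (domain K)) :=
    integrable_inner_of_memLp hfL (hr.memLp _)
  have hm := (isOpen_elem T₂).measurableSet
  have h0 := error_identity hS hD.memH1 (hφ.mono hball)
  simp only [vol] at h0
  rw [setIntegral_domain_eq_elem_union H.norm hT₁ hT₂ h₁ h₂ fun x hx => by
      rw [hg.eq_zero hx, inner_zero_right],
    setIntegral_domain_eq_elem_union H.norm hT₁ hT₂ h₁ h₂ fun x hx => by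
      rw [hr.eq_zero hx, inner_zero_right],
    setIntegral_domain_eq_elem_union H.norm hT₁ hT₂ h₁ h₂ fun x hx => by
      rw [hlap x hx, mul_zero],
    setIntegral_union hdis hm (hmono hsub₁ hfI) (hmono hsub₂ hfI),
    setIntegral_union hdis hm (hmono hsub₁ hlapI) (hmono hsub₂ hlapI)] at h0
  have a₁ := trace_identity H hl h₁ hf₁ hg₁ hφ
  rw [← nrm_neg] at h₂
  have a₂ := trace_identity H.neg hl h₂ hf₂ hg₂.neg hφ
  have hn' : ∀ s : ℝ, fderiv ℝ φ (M + s • -τ) (nrm (-τ)) = 0 := fun s => by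
    have := hn (-s)
    rw [nrm_neg, map_neg, smul_neg, ← neg_smul, this, neg_zero]
  have b₁ := curl_identity hD hT₁ H hl h₁ hφ hn
  have b₂ := curl_identity hD hT₂ H.neg hl h₂ hφ hn'
  simp only [vol] at a₁ a₂ b₁ b₂ ⊢
  rw [a₁, a₂, b₁, b₂] at h0
  have hφa := hφ.memLp_arc H
  have hcI : ∀ {F : Pt → ℝ}, Continuous F → Integrable (fun x => φ x * F x) (arc E) := fun hF =>
    (hφ.smooth.continuous.mul hF).integrable_of_hasCompactSupport hφ.compact.mul_right
  have hdc : ∀ (Q : Poly) (v : Pt), Continuous fun x => fderiv ℝ (val Q) x v := fun Q v =>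
    ((contDiff_val Q).continuous_fderiv (by simp)).clm_apply continuous_const
  have hlc : ∀ (T : Finset Pt) (v : Pt), Continuous fun x => inner ℝ (lapVec (P T) x) v :=
    fun T v => (continuous_lapVec (P T)).inner continuous_const
  have gI₁ := integrable_mul_of_memLp hg₁.memLp hφa
  have gI₂ := integrable_mul_of_memLp hg₂.memLp hφa
  have R : ∀ {T : Finset Pt}, MemHcurl (elem T) f c →
      ∫ x in elem T, curlRes ν c (P T) x * φ x =
        (∫ x in elem T, c x * φ x) + ν * ∫ x in elem T, curlLap (P T) x * φ x := by
    intro T hf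
    have hi : Integrable (fun x => curlLap (P T) x * φ x) (vol (elem T)) :=
      (((contDiff_val _).continuous.mul hφ.smooth.continuous).integrable_of_hasCompactSupport
        hφ.compact.mul_left).integrableOn
    simp only [curlRes, add_mul, mul_assoc]
    refine (integral_add (μ := volume.restrict (elem T))
      (integrable_mul_of_memLp hf.memLp_curl (hφ.memLp _)) (hi.const_mul ν)).trans ?_
    rw [integral_const_mul]
  rw [R hf₁, R hf₂]
  have L : ∀ (T : Finset Pt) (v : Pt), ∫ x, φ x * (fderiv ℝ (val (divPoly (P T))) x v -
      inner ℝ (lapVec (P T) x) v) ∂(arc E) = ∫ x, φ x * fderiv ℝ (val (divPoly (P T))) x v ∂(arc E)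
        - ∫ x, φ x * inner ℝ (lapVec (P T) x) v ∂(arc E) := fun T v => by
    simp only [mul_sub]
    exact integral_sub (hcI (hdc _ v)) (hcI (hlc T v))
  rw [L, L] at h0
  simp only [inner_neg_right, map_neg, mul_neg, neg_mul, integral_neg] at h0
  have J : ∫ x, ((g₁ x + ν * inner ℝ (lapVec (P T₁) x) τ) -
      (g₂ x + ν * inner ℝ (lapVec (P T₂) x) τ)) * φ x ∂(arc E) =
      1 * ∫ x, g₁ x * φ x ∂(arc E) + -1 * ∫ x, g₂ x * φ x ∂(arc E) +
        ν * ∫ x, φ x * inner ℝ (lapVec (P T₁) x) τ ∂(arc E) +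
        -ν * ∫ x, φ x * inner ℝ (lapVec (P T₂) x) τ ∂(arc E) := by
    rw [← integral_four gI₁ gI₂ (hcI (hlc T₁ τ)) (hcI (hlc T₂ τ))]
    congr 1
    funext x
    ring
  have D : ∫ x, φ x * (fderiv ℝ (val (divPoly (P T₁))) x τ -
      fderiv ℝ (val (divPoly (P T₂))) x τ) ∂(arc E) =
      ∫ x, φ x * fderiv ℝ (val (divPoly (P T₁))) x τ ∂(arc E) -
      ∫ x, φ x * fderiv ℝ (val (divPoly (P T₂))) x τ ∂(arc E) := by
    simp only [mul_sub]
    exact integral_sub (hcI (hdc _ τ)) (hcI (hdc _ τ))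
  rw [J, D]
  linarith

/-! ### Integrability and norms on triangles -/

lemma memLp_of_continuous {μ : Measure Pt} [IsFiniteMeasure μ] {S : Set Pt} (hS : IsCompact S)
    (hμ : ∀ᵐ x ∂μ, x ∈ S) {g : Pt → ℝ} (hg : Continuous g) : MemLp g 2 μ := by
  obtain ⟨C, hC⟩ := hS.exists_bound_of_continuousOn hg.continuousOn
  refine MemLp.of_bound hg.aestronglyMeasurable C ?_
  filter_upwards [hμ] with x hx using hC x hx

lemma isCompact_convexHull_finset (T : Finset Pt) : IsCompact (convexHull ℝ (T : Set Pt)) :=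
  T.finite_toSet.isCompact_convexHull ℝ

lemma isFiniteMeasure_vol_elem (T : Finset Pt) : IsFiniteMeasure (vol (elem T)) := by
  refine ⟨?_⟩
  rw [vol, Measure.restrict_apply_univ]
  exact (measure_mono interior_subset).trans_lt (isCompact_convexHull_finset T).measure_lt_top

lemma memLp_val_elem (T : Finset Pt) (Q : Poly) : MemLp (val Q) 2 (vol (elem T)) := by
  have := isFiniteMeasure_vol_elem T
  refine memLp_of_continuous (isCompact_convexHull_finset T) ?_ (contDiff_val Q).continuous
  exact (ae_restrict_mem (isOpen_elem T).measurableSet).mono fun x hx => interior_subset hx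

lemma memLp_arc_of_continuous {E : Finset Pt} {M τ : Pt} {h : ℝ} (H : IsEdgeFrame E M τ h)
    {g : Pt → ℝ} (hg : Continuous g) : MemLp g 2 (arc E) := by
  have := isFiniteMeasure_arc H
  refine memLp_of_continuous (isCompact_convexHull_finset E) ?_ hg
  exact ae_restrict_mem (isCompact_convexHull_finset E).measurableSet

lemma ae_arc_mem (E : Finset Pt) : ∀ᵐ x ∂(arc E), x ∈ convexHull ℝ (E : Set Pt) :=
  ae_restrict_mem (isCompact_convexHull_finset E).measurableSet

lemma lpNorm_mono_set {F : Type*} [NormedAddCommGroup F] {g : Pt → F} {U V : Set Pt}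
    (hg : MemLp g 2 (vol V)) (hUV : U ⊆ V) : lpNorm g 2 (vol U) ≤ lpNorm g 2 (vol V) := by
  have hle : vol U ≤ vol V := Measure.restrict_mono hUV le_rfl
  rw [← toReal_eLpNorm hg.1, ← toReal_eLpNorm (hg.mono_measure hle).1]
  exact ENNReal.toReal_mono hg.2.ne (eLpNorm_mono_measure _ hle)

lemma lpNorm_mono_of_le {Y F G : Type*} [MeasurableSpace Y] {μ : Measure Y} [NormedAddCommGroup F]
    [NormedAddCommGroup G] {f : Y → F} {g : Y → G} (hf : AEStronglyMeasurable f μ)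
    (hg : MemLp g 2 μ) {C : ℝ} (hC : 0 ≤ C) (h : ∀ᵐ x ∂μ, ‖f x‖ ≤ C * ‖g x‖) :
    lpNorm f 2 μ ≤ C * lpNorm g 2 μ := by
  rw [← toReal_eLpNorm hf, ← toReal_eLpNorm hg.1]
  have h1 := eLpNorm_le_mul_eLpNorm_of_ae_le_mul h 2
  have h2 := ENNReal.toReal_mono (ENNReal.mul_ne_top ENNReal.ofReal_ne_top hg.2.ne) h1
  rwa [ENNReal.toReal_mul, ENNReal.toReal_ofReal hC] at h2

lemma sqrt_volume_le_of_subset {x : Pt} {U : Set Pt} {r : ℝ} (hr : 0 ≤ r)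
    (hU : U ⊆ Metric.closedBall x r) : √(volume.real U) ≤ √Real.pi * r := by
  have h1 : volume.real (Metric.closedBall x r) = Real.pi * r ^ 2 := by
    rw [Measure.real, EuclideanSpace.volume_closedBall_fin_two, ENNReal.toReal_mul,
      ENNReal.toReal_pow, ENNReal.toReal_ofReal hr]
    simp [mul_comm, Real.pi_pos.le]
  have h2 := measureReal_mono (μ := volume) hU (isCompact_closedBall x r).measure_lt_top.ne
  rw [h1] at h2
  calc √(volume.real U) ≤ √(Real.pi * r ^ 2) := Real.sqrt_le_sqrt h2
    _ = √Real.pi * r := by rw [Real.sqrt_mul Real.pi_pos.le, Real.sqrt_sq hr]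

/-- The Cauchy-Schwarz inequality on a subset of the plane against a bounded function that vanishes
off a disc. -/
lemma abs_integral_inner_le_disc {F : Type*} [NormedAddCommGroup F] [InnerProductSpace ℝ F]
    {U : Set Pt} {f g : Pt → F} {x : Pt} {r k : ℝ} (hf : MemLp f 2 (vol U))
    (hg : MemLp g 2 (vol U)) (hr : 0 ≤ r) (hk : 0 ≤ k) (hb : ∀ y, ‖g y‖ ≤ k)
    (h0 : ∀ y ∉ Metric.closedBall x r, g y = 0) :
    |∫ y, inner ℝ (f y) (g y) ∂(vol U)| ≤ lpNorm f 2 (vol U) * (k * (√Real.pi * r)) := by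
  have hfin : volume (Metric.closedBall x r) ≠ ⊤ := (isCompact_closedBall x r).measure_lt_top.ne
  have hle : vol U (Metric.closedBall x r) ≤ volume (Metric.closedBall x r) :=
    Measure.restrict_le_self _
  refine (abs_integral_inner_le_of_bound hf hg Metric.isClosed_closedBall.measurableSet
    (hle.trans_lt hfin.lt_top).ne hk (fun y _ => hb y) h0).trans ?_
  refine mul_le_mul_of_nonneg_left (mul_le_mul_of_nonneg_left ?_ hk) lpNorm_nonneg
  exact (Real.sqrt_le_sqrt (ENNReal.toReal_mono hfin hle)).trans
    (sqrt_volume_le_of_subset hr subset_rfl)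

lemma abs_integral_mul_le_disc {U : Set Pt} {f g : Pt → ℝ} {x : Pt} {r k : ℝ}
    (hf : MemLp f 2 (vol U)) (hg : MemLp g 2 (vol U)) (hr : 0 ≤ r) (hk : 0 ≤ k)
    (hb : ∀ y, |g y| ≤ k) (h0 : ∀ y ∉ Metric.closedBall x r, g y = 0) :
    |∫ y, f y * g y ∂(vol U)| ≤ lpNorm f 2 (vol U) * (k * (√Real.pi * r)) := by
  simpa [mul_comm] using abs_integral_inner_le_disc hf hg hr hk hb h0

lemma distPoly_nonneg (k : ℕ) (μ : Measure Pt) (g : Pt → ℝ) : 0 ≤ distPoly k μ g :=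
  Real.iInf_nonneg fun _ => lpNorm_nonneg

/-- The passage to the infimum over all polynomials, which does not need that it is attained. -/
lemma le_add_mul_distPoly {k : ℕ} {μ : Measure Pt} {g : Pt → ℝ} {X Y D : ℝ} (hD : 0 ≤ D)
    (h : ∀ q : Poly, q.totalDegree ≤ k → X ≤ Y + D * lpNorm (fun x => g x - val q x) 2 μ) :
    X ≤ Y + D * distPoly k μ g := by
  have : Nonempty {q : Poly // q.totalDegree ≤ k} := ⟨⟨0, by simp⟩⟩
  rw [distPoly, Real.mul_iInf_of_nonneg hD, ← sub_le_iff_le_add']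
  exact le_ciInf fun q => by linarith [h q.1 q.2]

lemma isTest_of_tsupport {φ : Pt → ℝ} {x : Pt} {l : ℝ} {U : Set Pt} (hφ : ContDiff ℝ ∞ φ)
    (hs : tsupport φ ⊆ Metric.closedBall x l) (hU : Metric.closedBall x l ⊆ U) : IsTest U φ :=
  ⟨hφ, (isCompact_closedBall x l).of_isClosed_subset (isClosed_tsupport _) hs, hs.trans hU⟩

lemma closedBall_half_subset_elem {T : Finset Pt} {x : Pt} {r : ℝ} (hr : 0 < r)
    (hb : Metric.closedBall x r ⊆ convexHull ℝ (T : Set Pt)) :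
    Metric.closedBall x (r / 2) ⊆ elem T :=
  (Metric.closedBall_subset_ball (by linarith)).trans
    (interior_maximal (Metric.ball_subset_closedBall.trans hb) Metric.isOpen_ball)

lemma convexHull_subset_closedBall {T : Finset Pt} {x : Pt} {r : ℝ} (hr : 0 < r)
    (hb : Metric.closedBall x r ⊆ convexHull ℝ (T : Set Pt)) :
    convexHull ℝ (T : Set Pt) ⊆ Metric.closedBall x (diam T) := fun _ hy =>
  Metric.dist_le_diam_of_mem (isCompact_convexHull_finset T).isBounded hy
    (hb (Metric.mem_closedBall_self hr.le))

lemma le_diam_of_closedBall_subset {T : Finset Pt} {x : Pt} {r : ℝ} (hr : 0 < r)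
    (hb : Metric.closedBall x r ⊆ convexHull ℝ (T : Set Pt)) : r ≤ diam T := by
  have h1 : x + r • EuclideanSpace.single 0 (1 : ℝ) ∈ Metric.closedBall x r := by
    simp [dist_eq_norm, norm_smul, abs_of_pos hr]
  have h2 := convexHull_subset_closedBall hr hb (hb h1)
  rw [Metric.mem_closedBall, dist_eq_norm, add_sub_cancel_left, norm_smul] at h2
  simpa [abs_of_pos hr] using h2

/-! ### Efficiency on triangles -/

lemma MemHcurl.memLp_curlRes {T : Finset Pt} {f : Pt → Pt} {c : Pt → ℝ} (hf : MemHcurl (elem T) f c)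
    (ν : ℝ) (P : Fin 2 → Poly) : MemLp (curlRes ν c P) 2 (vol (elem T)) :=
  hf.memLp_curl.add ((memLp_val_elem T _).const_mul ν)

lemma le_of_sq_le_mul {B X : ℝ} (hB : 0 ≤ B) (hX : 0 ≤ X) (h : B ^ 2 ≤ X * B) : B ≤ X := by
  rcases hB.eq_or_lt with h0 | h0
  · rwa [← h0]
  · nlinarith

/-- Efficiency of the curl of the residual on a triangle, for an arbitrary approximation `q`. -/
lemma exists_elem_efficiency (k : ℕ) (γ : ℝ) :
    ∃ C : ℝ, 0 < C ∧ ∀ (K : Geometry.SimplicialComplex ℝ Pt) (m : ℕ) (ν : ℝ) (f : Pt → Pt)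
      (c : Pt → ℝ) (uD : Pt → Pt) (DuD : Pt → Mat) (u : Pt → Pt) (Du : Pt → Mat) (p : Pt → ℝ)
      (uh : Pt → Pt) (Duh : Pt → Mat) (P : Finset Pt → Fin 2 → Poly),
      ShapeRegular K γ → 0 < ν → IsStokesSolution (domain K) ν f uD DuD u Du p →
      IsDiscreteVelocity K m uh Duh P → ∀ T ∈ triangles K, MemHcurl (elem T) f c →
      ν⁻¹ * diam T ^ 2 * lpNorm (curlRes ν c (P T)) 2 (vol (elem T)) ≤
        C * (lpNorm (Du - Duh) 2 (vol (elem T)) + ν⁻¹ * diam T * osc k T (curlRes ν c (P T))) := by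
  obtain ⟨A, hA, hbub⟩ := exists_cell_bubble k (2 * γ)
  have hpi := Real.pi_pos
  refine ⟨1 + 2 * |γ| * (A ^ 2 * Real.pi) + 16 * |γ| ^ 3 * (A ^ 2 * Real.pi), by positivity, ?_⟩
  intro K m ν f c uD DuD u Du p uh Duh P hK hν hS hD T hT hf
  obtain ⟨x0, r, hr, hball, hhr⟩ := hK T hT
  set h := diam T with hh
  have hrh : r ≤ h := le_diam_of_closedBall_subset hr hball
  have hh0 : 0 < h := hr.trans_le hrh
  have hγ : 0 < γ := by
    by_contra! hneg; nlinarith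
  rw [abs_of_pos hγ]
  set e := lpNorm (Du - Duh) 2 (vol (elem T)) with he
  have he0 : 0 ≤ e := lpNorm_nonneg
  set D := A ^ 2 * Real.pi with hDdef
  have hD0 : 0 < D := by positivity
  have heL : MemLp (Du - Duh) 2 (vol (elem T)) :=
    (hS.velocity.memLp_grad.sub hD.memH1.memLp_grad).mono_measure
      (Measure.restrict_mono (elem_subset_domain hT) le_rfl)
  have hRL := hf.memLp_curlRes ν (P T)
  have key : ∀ q : Poly, q.totalDegree ≤ k →
      ν⁻¹ * h ^ 2 * lpNorm (curlRes ν c (P T)) 2 (vol (elem T)) ≤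
        16 * γ ^ 3 * D * e + (1 + 2 * γ * D) * (ν⁻¹ * h ^ 2) *
          lpNorm (fun x => curlRes ν c (P T) x - val q x) 2 (vol (elem T)) := by
    intro q hq
    -- the disc of half the radius is contained in the open triangle
    obtain ⟨l, hl⟩ : ∃ l, l = r / 2 := ⟨_, rfl⟩
    have hl0 : 0 < l := by rw [hl]; positivity
    obtain ⟨φ, B, hB, hφs, hφt, -, hφq, hqB, -, hφB, hφ2⟩ := hbub x0 l q hl0 hq
    have hφT : IsTest (elem T) φ :=
      isTest_of_tsupport hφs hφt (hl ▸ closedBall_half_subset_elem hr hball)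
    have hφb : IsTest (Metric.closedBall x0 l) φ := isTest_of_tsupport hφs hφt subset_rfl
    have hqL := memLp_val_elem T q
    set R := curlRes ν c (P T) with hR
    have hRqL : MemLp (fun x => R x - val q x) 2 (vol (elem T)) := hRL.sub hqL
    set o := lpNorm (fun x => R x - val q x) 2 (vol (elem T)) with ho
    have ho0 : 0 ≤ o := lpNorm_nonneg
    have h1 : |∫ x, (R x - val q x) * φ x ∂(vol (elem T))| ≤ o * (A * B * (√Real.pi * l)) :=
      abs_integral_mul_le_disc hRqL (hφT.memLp _) hl0.le (by positivity) hφB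
        fun y hy => hφb.eq_zero hy
    have h2 : |∫ x, inner ℝ ((Du - Duh) x) (gradC (rotC φ) x) ∂(vol (elem T))| ≤
        e * (2 * (A * l⁻¹ ^ 2 * B) * (√Real.pi * l)) :=
      abs_integral_inner_le_disc heL ((isTest_gradC_rotC hφT).memLp _) hl0.le (by positivity)
        (fun y => norm_gradC_rotC_le (by positivity) fun i j => hφ2 i j y)
        fun y hy => (isTest_gradC_rotC hφb).eq_zero hy
    have h3 := elem_identity hS hD hT hf hφT
    have h4 : l ^ 2 * B ^ 2 = ∫ x, R x * φ x ∂(vol (elem T)) -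
        ∫ x, (R x - val q x) * φ x ∂(vol (elem T)) := by
      rw [← hφq, ← integral_sub (integrable_mul_of_memLp hRL (hφT.memLp _))
        (integrable_mul_of_memLp hRqL (hφT.memLp _)),
        ← setIntegral_eq_integral_of_support (U := elem T)
          fun x hx => by rw [hφT.eq_zero hx, zero_mul]]
      congr 1
      funext x; ring
    have h5 : l ^ 2 * B ^ 2 ≤ ν * (e * (2 * (A * l⁻¹ ^ 2 * B) * (√Real.pi * l))) +
        o * (A * B * (√Real.pi * l)) := by
      rw [h4, h3]
      have a := abs_le.1 h1
      have b := abs_le.1 h2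
      nlinarith
    have h6 : B ≤ A * √Real.pi * (2 * ν * e * l⁻¹ ^ 3 + o * l⁻¹) := by
      refine le_of_sq_le_mul hB (by positivity) ?_
      have h7 : B ^ 2 = l⁻¹ ^ 2 * (l ^ 2 * B ^ 2) := by field_simp
      rw [h7]
      refine (mul_le_mul_of_nonneg_left h5 (by positivity)).trans (le_of_eq ?_)
      field_simp
    -- the triangle lies in the disc of radius `h ≤ 2 γ l`, on which `q` is bounded by `A * B`
    have hq1 : lpNorm (val q) 2 (vol (elem T)) ≤ A * B * (√Real.pi * h) := by
      have hsub : elem T ⊆ Metric.closedBall x0 h :=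
        interior_subset.trans (convexHull_subset_closedBall hr hball)
      have := isFiniteMeasure_vol_elem T
      have h8 : lpNorm (val q) 2 (vol (elem T)) ≤ A * B * √((vol (elem T)).real (elem T)) := by
        have h9 : MemLp ((elem T).indicator (val q)) 2 (vol (elem T)) :=
          hqL.indicator (isOpen_elem T).measurableSet
        have h10 : lpNorm (val q) 2 (vol (elem T)) =
            lpNorm ((elem T).indicator (val q)) 2 (vol (elem T)) := by
          rw [← toReal_eLpNorm hqL.1, ← toReal_eLpNorm h9.1]
          congr 1
          refine eLpNorm_congr_ae ?_
          filter_upwards [ae_restrict_mem (isOpen_elem T).measurableSet] with x hx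
          rw [Set.indicator_of_mem hx]
        rw [h10]
        refine lpNorm_le_of_bound h9 (isOpen_elem T).measurableSet (measure_ne_top _ _)
          (by positivity) (fun x hx => ?_) fun x hx => Set.indicator_of_notMem hx _
        rw [Set.indicator_of_mem hx]
        refine hqB x (Metric.closedBall_subset_closedBall ?_ (hsub hx))
        rw [hl]; linarith
      refine h8.trans (mul_le_mul_of_nonneg_left ?_ (by positivity))
      have h11 : (vol (elem T)).real (elem T) = volume.real (elem T) := by
        simp [vol, Measure.real]
      rw [h11]
      exact sqrt_volume_le_of_subset hh0.le hsub
    have hR1 : lpNorm R 2 (vol (elem T)) ≤ lpNorm (val q) 2 (vol (elem T)) + o :=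
      lpNorm_le_lpNorm_add_lpNorm_sub' hqL (by norm_num)
    have hs : √Real.pi * √Real.pi = Real.pi := Real.mul_self_sqrt hpi.le
    have hhl : h * l⁻¹ ≤ 2 * γ := by
      rw [← div_eq_mul_inv, div_le_iff₀ hl0, hl]; linarith
    have hR2 : lpNorm R 2 (vol (elem T)) ≤ o + D * h * (2 * ν * e * l⁻¹ ^ 3 + o * l⁻¹) := by
      have : A * B * (√Real.pi * h) ≤ A * (A * √Real.pi * (2 * ν * e * l⁻¹ ^ 3 + o * l⁻¹)) *
          (√Real.pi * h) := by gcongr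
      calc _ ≤ _ := hR1
        _ ≤ A * (A * √Real.pi * (2 * ν * e * l⁻¹ ^ 3 + o * l⁻¹)) * (√Real.pi * h) + o := by
          linarith
        _ = _ := by
          rw [hDdef]
          linear_combination A ^ 2 * h * (2 * ν * e * l⁻¹ ^ 3 + o * l⁻¹) * hs
    have hhl0 : 0 ≤ h * l⁻¹ := by positivity
    have hhl3 : (h * l⁻¹) ^ 3 ≤ 8 * γ ^ 3 := by
      calc (h * l⁻¹) ^ 3 ≤ (2 * γ) ^ 3 := pow_le_pow_left₀ hhl0 hhl 3
        _ = _ := by ring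
    calc ν⁻¹ * h ^ 2 * lpNorm R 2 (vol (elem T))
        ≤ ν⁻¹ * h ^ 2 * (o + D * h * (2 * ν * e * l⁻¹ ^ 3 + o * l⁻¹)) := by gcongr
      _ = 2 * D * e * (h * l⁻¹) ^ 3 + (1 + D * (h * l⁻¹)) * (ν⁻¹ * h ^ 2) * o := by
          field_simp; ring
      _ ≤ 2 * D * e * (8 * γ ^ 3) + (1 + D * (2 * γ)) * (ν⁻¹ * h ^ 2) * o := by gcongr
      _ = _ := by ring
  have h1 := le_add_mul_distPoly (μ := vol (elem T)) (g := curlRes ν c (P T)) (by positivity) key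
  refine h1.trans ?_
  rw [osc, ← hh]
  have hd := distPoly_nonneg k (vol (elem T)) (curlRes ν c (P T))
  set d := distPoly k (vol (elem T)) (curlRes ν c (P T))
  have t1 : 0 ≤ (1 + 2 * γ * D) * e := by positivity
  have t2 : 0 ≤ 16 * γ ^ 3 * D * (ν⁻¹ * h ^ 2 * d) := by positivity
  nlinarith

/-! ### The divergence of the discrete velocity -/

lemma totalDegree_pderiv_le (i : Fin 2) (Q : Poly) :
    (MvPolynomial.pderiv i Q).totalDegree ≤ Q.totalDegree := by
  conv_lhs => rw [Q.as_sum, map_sum]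
  refine MvPolynomial.totalDegree_finsetSum_le fun s hs => ?_
  rw [MvPolynomial.pderiv_monomial]
  refine (MvPolynomial.totalDegree_monomial_le _ _).trans ?_
  refine le_trans ?_ (MvPolynomial.le_totalDegree hs)
  exact Finsupp.degree_mono tsub_le_self

lemma totalDegree_divPoly_le {m : ℕ} {P : Fin 2 → Poly} (hP : ∀ i, (P i).totalDegree ≤ m) :
    (divPoly P).totalDegree ≤ m := by
  refine (MvPolynomial.totalDegree_add _ _).trans (max_le ?_ ?_)
  · exact (totalDegree_pderiv_le _ _).trans (hP 0)
  · exact (totalDegree_pderiv_le _ _).trans (hP 1)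

lemma totalDegree_lap_le (Q : Poly) : (lap Q).totalDegree ≤ Q.totalDegree := by
  refine (MvPolynomial.totalDegree_add _ _).trans (max_le ?_ ?_)
  · exact (totalDegree_pderiv_le _ _).trans (totalDegree_pderiv_le _ _)
  · exact (totalDegree_pderiv_le _ _).trans (totalDegree_pderiv_le _ _)

lemma isFiniteMeasure_vol_domain {K : Geometry.SimplicialComplex ℝ Pt} (hK : IsTriangulation K) :
    IsFiniteMeasure (vol (domain K)) := by
  refine ⟨?_⟩
  rw [vol, Measure.restrict_apply_univ]
  refine (measure_mono interior_subset).trans_lt ?_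
  exact (hK.finite.isCompact_biUnion fun s _ => isCompact_convexHull_finset s).measure_lt_top

/-- Incompressibility is tested with mean-free functions only, so the divergence of the velocity is
constant: it is orthogonal to its deviation from its mean. -/
lemma exists_div_eq_const {K : Geometry.SimplicialComplex ℝ Pt} (hK : IsTriangulation K) {ν : ℝ}
    {f uD u : Pt → Pt} {DuD Du : Pt → Mat} {p : Pt → ℝ}
    (hS : IsStokesSolution (domain K) ν f uD DuD u Du p) :
    ∃ κ : ℝ, ∀ᵐ x ∂(vol (domain K)), divOf (Du x) = κ := by
  have := isFiniteMeasure_vol_domain hK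
  have hd : MemLp (fun x => divOf (Du x)) 2 (vol (domain K)) :=
    (memLp_coord hS.velocity.memLp_grad (0, 0)).add (memLp_coord hS.velocity.memLp_grad (1, 1))
  obtain ⟨κ, hκ⟩ : ∃ κ, κ = ⨍ x, divOf (Du x) ∂(vol (domain K)) := ⟨_, rfl⟩
  have hq : MemLp (fun x => divOf (Du x) - κ) 2 (vol (domain K)) := hd.sub (memLp_const κ)
  have hmean : ∫ x, (divOf (Du x) - κ) ∂(vol (domain K)) = 0 := by
    rw [hκ]; exact integral_sub_average _ _
  refine ⟨κ, ?_⟩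
  have h0 := hS.incompressible _ ⟨hq, hmean⟩
  have h1 : ∫ x, (divOf (Du x) - κ) * (divOf (Du x) - κ) ∂(vol (domain K)) = 0 := by
    have : ∀ x, (divOf (Du x) - κ) * (divOf (Du x) - κ) =
        (divOf (Du x) - κ) * divOf (Du x) - κ * (divOf (Du x) - κ) := fun x => by ring
    simp_rw [this]
    rw [integral_sub (integrable_mul_of_memLp hq hd) ((hq.integrable (by norm_num)).const_mul κ),
      integral_const_mul, h0, hmean]
    ring
  rw [integral_eq_zero_iff_of_nonneg (fun x => mul_self_nonneg _)
    (integrable_mul_of_memLp hq hq)] at h1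
  filter_upwards [h1] with x hx
  exact sub_eq_zero.1 (mul_self_eq_zero.1 hx)

lemma val_C (a : ℝ) (x : Pt) : val (MvPolynomial.C a) x = a := MvPolynomial.eval_C a

lemma lpNorm_divPoly_sub_le {K : Geometry.SimplicialComplex ℝ Pt} {m : ℕ} {uh : Pt → Pt}
    {Du Duh : Pt → Mat} {P : Finset Pt → Fin 2 → Poly} {κ : ℝ}
    (hDu : MemLp Du 2 (vol (domain K))) (hD : IsDiscreteVelocity K m uh Duh P)
    (hκ : ∀ᵐ x ∂(vol (domain K)), divOf (Du x) = κ) {T : Finset Pt} (hT : T ∈ triangles K) :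
    lpNorm (val (divPoly (P T) - MvPolynomial.C κ)) 2 (vol (elem T)) ≤
      2 * lpNorm (Du - Duh) 2 (vol (elem T)) := by
  have hle : vol (elem T) ≤ vol (domain K) := Measure.restrict_mono (elem_subset_domain hT) le_rfl
  refine lpNorm_mono_of_le (memLp_val_elem T _).1
    ((hDu.sub hD.memH1.memLp_grad).mono_measure hle) (by norm_num) ?_
  filter_upwards [weakGrad_eq_pd hD hT 0 0, weakGrad_eq_pd hD hT 1 1,
    (Measure.absolutelyContinuous_of_le hle).ae_le hκ] with x h0 h1 h2
  have e : val (divPoly (P T) - MvPolynomial.C κ) x =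
      -((Du - Duh) x (0, 0) + (Du - Duh) x (1, 1)) := by
    rw [val_sub, divPoly, val_add, ← pd_val, ← pd_val]
    simp only [val_C, ← h0, ← h1, Pi.sub_apply, PiLp.sub_apply]
    rw [divOf] at h2
    linarith
  rw [e, norm_neg]
  refine (norm_add_le _ _).trans ?_
  have a := PiLp.norm_apply_le ((Du - Duh) x) (0, 0)
  have b := PiLp.norm_apply_le ((Du - Duh) x) (1, 1)
  linarith

/-- An inverse estimate for the derivatives of polynomials on shape-regular triangles. -/
lemma exists_inverse_estimate (N : ℕ) (γ : ℝ) :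
    ∃ C : ℝ, 0 < C ∧ ∀ (T : Finset Pt) (x0 : Pt) (r : ℝ) (Q : Poly), 0 < r →
      Metric.closedBall x0 r ⊆ convexHull ℝ (T : Set Pt) → diam T ≤ γ * r → Q.totalDegree ≤ N →
      ∀ x ∈ convexHull ℝ (T : Set Pt), ∀ τ : Pt, ‖τ‖ = 1 →
        |fderiv ℝ (val Q) x τ| ≤ C * r⁻¹ ^ 2 * lpNorm (val Q) 2 (vol (elem T)) := by
  obtain ⟨A, hA, hbub⟩ := exists_cell_bubble N (2 * γ)
  refine ⟨8 * A, by positivity, fun T x0 r Q hr hball hγ hQ x hx τ hτ => ?_⟩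
  obtain ⟨φ, B, hB, hφs, hφt, hφ0, hφq, -, hqB, -, -⟩ := hbub x0 (r / 2) Q (by positivity) hQ
  have hφT : IsTest (elem T) φ :=
    isTest_of_tsupport hφs hφt (closedBall_half_subset_elem hr hball)
  have hqL := memLp_val_elem T Q
  set d := lpNorm (val Q) 2 (vol (elem T))
  have hd : 0 ≤ d := lpNorm_nonneg
  have h1 : (r / 2 * B) ^ 2 ≤ d ^ 2 := by
    calc (r / 2 * B) ^ 2 = ∫ x, φ x * val Q x ∂(vol (elem T)) := by
          rw [setIntegral_eq_integral_of_support (U := elem T)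
            fun x hx => by rw [hφT.eq_zero hx, zero_mul], hφq]
          ring
      _ ≤ ∫ x, val Q x * val Q x ∂(vol (elem T)) :=
          integral_mono (integrable_mul_of_memLp (hφT.memLp _) hqL)
            (integrable_mul_of_memLp hqL hqL) fun x => (hφ0 x).2.trans (by rw [sq])
      _ ≤ d * d := by
          refine (le_abs_self _).trans ?_
          simpa [sq] using abs_integral_inner_le hqL hqL
      _ = d ^ 2 := by ring
  have h2 : r / 2 * B ≤ d := (sq_le_sq₀ (by positivity) hd).1 h1
  have h3 : ∀ i, |pd i (val Q) x| ≤ 4 * A * r⁻¹ ^ 2 * d := fun i => by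
    have hx' : x ∈ Metric.closedBall x0 (2 * γ * (r / 2)) :=
      Metric.closedBall_subset_closedBall (by linarith) (convexHull_subset_closedBall hr hball hx)
    calc |pd i (val Q) x| ≤ A * (r / 2)⁻¹ * B := hqB i x hx'
      _ = 4 * A * r⁻¹ ^ 2 * (r / 2 * B) := by field_simp; ring
      _ ≤ _ := by gcongr
  have hτi : ∀ i, |τ i| ≤ 1 := fun i => hτ ▸ abs_coord_le_norm τ i
  rw [fderiv_apply_eq]
  refine (abs_add_le _ _).trans ?_
  rw [abs_mul, abs_mul]
  have a := mul_le_mul (hτi 0) (h3 0) (abs_nonneg _) zero_le_one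
  have b := mul_le_mul (hτi 1) (h3 1) (abs_nonneg _) zero_le_one
  linarith

/-! ### Efficiency on edges -/

/-- The polynomial `Δ P · τ`. -/
noncomputable def lapTangential (P : Fin 2 → Poly) (τ : Pt) : Poly :=
  MvPolynomial.C (τ 0) * lap (P 0) + MvPolynomial.C (τ 1) * lap (P 1)

lemma val_lapTangential (P : Fin 2 → Poly) (τ x : Pt) :
    val (lapTangential P τ) x = inner ℝ (lapVec P x) τ := by
  rw [lapTangential, inner_eq]
  simp [val, lapVec]
  ring

lemma totalDegree_C_mul_le (a : ℝ) (Q : Poly) :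
    (MvPolynomial.C a * Q).totalDegree ≤ Q.totalDegree :=
  (MvPolynomial.totalDegree_mul _ _).trans (by simp)

lemma totalDegree_lapTangential_le {m : ℕ} {P : Fin 2 → Poly} (hP : ∀ i, (P i).totalDegree ≤ m)
    (τ : Pt) : (lapTangential P τ).totalDegree ≤ m :=
  (MvPolynomial.totalDegree_add _ _).trans (max_le
    ((totalDegree_C_mul_le _ _).trans ((totalDegree_lap_le _).trans (hP 0)))
    ((totalDegree_C_mul_le _ _).trans ((totalDegree_lap_le _).trans (hP 1))))

lemma fderiv_val_sub_C (Q : Poly) (κ : ℝ) (x τ : Pt) :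
    fderiv ℝ (val (Q - MvPolynomial.C κ)) x τ = fderiv ℝ (val Q) x τ := by
  have : val (Q - MvPolynomial.C κ) = fun y => val Q y - κ := by
    funext y
    simp only [val_sub, val_C]
  rw [this, fderiv_sub_const]

lemma IsEdgeFrame.ae_arc {E : Finset Pt} {M τ : Pt} {h : ℝ} (H : IsEdgeFrame E M τ h)
    {p : Pt → Prop} (hp : ∀ s ∈ Set.Icc (-(h / 2)) (h / 2), p (M + s • τ)) :
    ∀ᵐ x ∂(arc E), p x := by
  filter_upwards [ae_arc_mem E] with x hx
  rw [H.convexHull_eq] at hx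
  obtain ⟨s, hs, rfl⟩ := hx
  exact hp s hs

lemma lpNorm_le_of_ae_bound {Y : Type*} [MeasurableSpace Y] {μ : Measure Y} [IsFiniteMeasure μ]
    {g : Y → ℝ} {k : ℝ} (hg : AEStronglyMeasurable g μ) (hk : 0 ≤ k) (hb : ∀ᵐ x ∂μ, |g x| ≤ k) :
    lpNorm g 2 μ ≤ k * √(μ.real Set.univ) := by
  have h1 := lpNorm_mono_of_le hg (memLp_const (1 : ℝ)) hk (hb.mono fun x hx => by
    simpa using hx)
  refine h1.trans (mul_le_mul_of_nonneg_left ?_ hk)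
  refine (lpNorm_le_of_bound (memLp_const 1) MeasurableSet.univ (measure_ne_top _ _) zero_le_one
    (fun x _ => by simp) fun x hx => absurd (Set.mem_univ x) hx).trans (by rw [one_mul])

/-- The tangential derivative of the discrete divergence is small, as the divergence of the velocity
is constant. -/
lemma exists_fderiv_divPoly_bound (m : ℕ) {γ : ℝ} (hγ : 0 < γ) :
    ∃ C : ℝ, 0 < C ∧ ∀ (K : Geometry.SimplicialComplex ℝ Pt) (ν : ℝ) (f : Pt → Pt)
      (uD : Pt → Pt) (DuD : Pt → Mat) (u : Pt → Pt) (Du : Pt → Mat) (p : Pt → ℝ)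
      (uh : Pt → Pt) (Duh : Pt → Mat) (P : Finset Pt → Fin 2 → Poly),
      IsTriangulation K → ShapeRegular K γ →
      IsStokesSolution (domain K) ν f uD DuD u Du p → IsDiscreteVelocity K m uh Duh P →
      ∀ (E T : Finset Pt) (M τ : Pt) (h : ℝ), T ∈ triangles K → E ⊆ T → IsEdgeFrame E M τ h →
      ∀ x ∈ convexHull ℝ (E : Set Pt), |fderiv ℝ (val (divPoly (P T))) x τ| ≤
        C * h⁻¹ ^ 2 * lpNorm (Du - Duh) 2 (vol (elem T)) := by
  obtain ⟨A, hA, hinv⟩ := exists_inverse_estimate m γ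
  refine ⟨2 * A * γ ^ 2, by positivity, ?_⟩
  intro K ν f uD DuD u Du p uh Duh P hK hSR hS hD E T M τ h hT hET H x hx
  obtain ⟨κ, hκ⟩ := exists_div_eq_const hK hS
  obtain ⟨x0, r, hr, hball, hhr⟩ := hSR T hT
  have hh := H.pos
  have hETc : convexHull ℝ (E : Set Pt) ⊆ convexHull ℝ (T : Set Pt) :=
    convexHull_mono (Finset.coe_subset.2 hET)
  have hhT : h ≤ γ * r := by
    rw [← H.diam_eq]
    exact (Metric.diam_mono hETc (isCompact_convexHull_finset T).isBounded).trans hhr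
  have hri : r⁻¹ ≤ γ * h⁻¹ := by
    rw [← div_eq_mul_inv, inv_eq_one_div, div_le_div_iff₀ hr hh]; linarith
  have hdeg : (divPoly (P T) - MvPolynomial.C κ).totalDegree ≤ m :=
    (MvPolynomial.totalDegree_sub _ _).trans
      (max_le (totalDegree_divPoly_le (hD.degree T hT)) (by simp))
  have h1 := hinv T x0 r _ hr hball hhr hdeg x (hETc hx) τ H.norm
  rw [fderiv_val_sub_C] at h1
  have h2 := lpNorm_divPoly_sub_le hS.velocity.memLp_grad hD hκ hT
  calc _ ≤ _ := h1
    _ ≤ A * (γ * h⁻¹) ^ 2 * (2 * lpNorm (Du - Duh) 2 (vol (elem T))) :=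
        mul_le_mul (by gcongr) h2 lpNorm_nonneg (by positivity)
    _ = _ := by ring

/-- Insertion of a bound for the size `B` of the bubble into the bound `o + A * B * √h` for the norm
of the jump. -/
lemma edge_bound_arith {A a ν h l lam o e R₁ R₂ B X s : ℝ} (hA : 0 < A) (ha : 0 < a) (hν : 0 < ν)
    (hh : 0 < h) (hl : l = h / lam) (hlam : 0 < lam) (ho : 0 ≤ o) (he : 0 ≤ e) (hR₁ : 0 ≤ R₁)
    (hR₂ : 0 ≤ R₂) (hs : 0 ≤ s)
    (hB : B ≤ l⁻¹ * A * (o * √h + ν * e * (2 * s * l⁻¹ + 2 * a * h⁻¹) + s * l * (R₁ + R₂)))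
    (hX : X ≤ o + A * B * √h) :
    ν⁻¹ * (h * √h) * X ≤ (1 + A ^ 2 * lam + A ^ 2 * lam * (2 * s * lam + 2 * a) + A ^ 2 * s) *
        (e + ν⁻¹ * h ^ 2 * R₁ + ν⁻¹ * h ^ 2 * R₂) +
      (1 + A ^ 2 * lam + A ^ 2 * lam * (2 * s * lam + 2 * a) + A ^ 2 * s) *
        (ν⁻¹ * (h * √h)) * o := by
  have hl0 : 0 < l := by rw [hl]; positivity
  have hsq : √h * √h = h := Real.mul_self_sqrt hh.le
  have hhl : h * l⁻¹ = lam := by rw [hl]; field_simp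
  have hmain : ν⁻¹ * h ^ 2 * (A * B) ≤ A ^ 2 * lam * (ν⁻¹ * (h * √h)) * o +
      A ^ 2 * lam * (2 * s * lam + 2 * a) * e +
      A ^ 2 * s * (ν⁻¹ * h ^ 2 * R₁ + ν⁻¹ * h ^ 2 * R₂) := by
    calc _ ≤ ν⁻¹ * h ^ 2 * (A * (l⁻¹ * A * (o * √h + ν * e * (2 * s * l⁻¹ +
          2 * a * h⁻¹) + s * l * (R₁ + R₂)))) := by gcongr
      _ = A ^ 2 * (h * l⁻¹) * (ν⁻¹ * (h * √h)) * o +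
          A ^ 2 * (h * l⁻¹) * (2 * s * (h * l⁻¹) + 2 * a) * e +
          A ^ 2 * s * (ν⁻¹ * h ^ 2 * R₁ + ν⁻¹ * h ^ 2 * R₂) := by
        field_simp
      _ = _ := by rw [hhl]
  have hX' : ν⁻¹ * (h * √h) * X ≤
      ν⁻¹ * (h * √h) * o + ν⁻¹ * h ^ 2 * (A * B) := by
    calc _ ≤ ν⁻¹ * (h * √h) * (o + A * B * √h) := by gcongr
      _ = ν⁻¹ * (h * √h) * o + ν⁻¹ * h * (√h * √h) * (A * B) := by ring
      _ = _ := by rw [hsq]; ring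
  refine hX'.trans ((add_le_add_right hmain _).trans ?_)
  set S := ν⁻¹ * (h * √h)
  set r₁ := ν⁻¹ * h ^ 2 * R₁
  set r₂ := ν⁻¹ * h ^ 2 * R₂
  have hS0 : 0 ≤ S * o := by positivity
  have hr : 0 ≤ r₁ + r₂ := by positivity
  have c1 : 0 ≤ A ^ 2 * lam := by positivity
  have c2 : 0 ≤ A ^ 2 * lam * (2 * s * lam + 2 * a) := by positivity
  have c3 : 0 ≤ A ^ 2 * s := by positivity
  generalize A ^ 2 * lam * (2 * s * lam + 2 * a) = k₂ at c2 ⊢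
  generalize A ^ 2 * lam = k₁ at c1 ⊢
  generalize A ^ 2 * s = k₃ at c3 ⊢
  have d1 := mul_nonneg (add_nonneg c2 c3) hS0
  have d2 := mul_nonneg (add_nonneg (add_nonneg zero_le_one c1) c3) he
  have d3 := mul_nonneg (add_nonneg (add_nonneg zero_le_one c1) c2) hr
  linarith

/-- The arithmetic that turns the tested residual identity into a bound for the size `B` of the
bubble. -/
lemma edge_bubble_arith {A a ν h l B o e R₁ R₂ s I₀ I₁ I₂ I₃ I₄ : ℝ} (hA : 0 < A) (hl : 0 < l)
    (hh : 0 < h) (hν : 0 < ν) (hB : 0 ≤ B) (ho : 0 ≤ o) (he : 0 ≤ e) (ha : 0 ≤ a) (hR₁ : 0 ≤ R₁)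
    (hR₂ : 0 ≤ R₂) (hs : 0 ≤ s) (hid : l * B ^ 2 = ν * I₁ + I₂ + I₃ + ν * I₄ - I₀)
    (b0 : |I₀| ≤ o * (A * B * √h)) (b1 : |I₁| ≤ e * (2 * (A * l⁻¹ ^ 2 * B) * (s * l)))
    (b2 : |I₂| ≤ R₁ * (A * B * (s * l))) (b3 : |I₃| ≤ R₂ * (A * B * (s * l)))
    (b4 : |I₄| ≤ A * B * (2 * a * h⁻¹ ^ 2 * e) * h) :
    B ≤ l⁻¹ * A * (o * √h + ν * e * (2 * s * l⁻¹ + 2 * a * h⁻¹) + s * l * (R₁ + R₂)) := by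
  refine le_of_sq_le_mul hB (by positivity) ?_
  have h7 : B ^ 2 = l⁻¹ * (l * B ^ 2) := by field_simp
  rw [h7, hid, mul_assoc l⁻¹ A, mul_assoc l⁻¹]
  refine mul_le_mul_of_nonneg_left ?_ (by positivity)
  have a0 := (abs_le.1 b0).1
  have a1 := mul_le_mul_of_nonneg_left (abs_le.1 b1).2 hν.le
  have a2 := (abs_le.1 b2).2
  have a3 := (abs_le.1 b3).2
  have a4 := mul_le_mul_of_nonneg_left (abs_le.1 b4).2 hν.le
  have e1 : ν * (e * (2 * (A * l⁻¹ ^ 2 * B) * (s * l))) = A * (ν * e * (2 * s * l⁻¹)) * B := by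
    field_simp
  have e4 : ν * (A * B * (2 * a * h⁻¹ ^ 2 * e) * h) = A * (ν * e * (2 * a * h⁻¹)) * B := by
    field_simp
  rw [e1] at a1
  rw [e4] at a4
  linarith

/-- The jump of the tangential residual is bounded by the error and the curl residuals of the adjacent
triangles, up to the approximation error of an arbitrary polynomial `q`. -/
lemma exists_edge_bound (k m : ℕ) {γ : ℝ} (hγ : 0 < γ) :
    ∃ C : ℝ, 0 < C ∧ ∀ (K : Geometry.SimplicialComplex ℝ Pt) (ν : ℝ) (f : Pt → Pt)
      (c : Pt → ℝ) (uD : Pt → Pt) (DuD : Pt → Mat) (u : Pt → Pt) (Du : Pt → Mat) (p : Pt → ℝ)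
      (uh : Pt → Pt) (Duh : Pt → Mat) (P : Finset Pt → Fin 2 → Poly),
      IsTriangulation K → ShapeRegular K γ → 0 < ν → MemLp f 2 (vol (domain K)) →
      IsStokesSolution (domain K) ν f uD DuD u Du p → IsDiscreteVelocity K m uh Duh P →
      ∀ (E T₁ T₂ : Finset Pt) (M τ : Pt) (h : ℝ) (g₁ g₂ : Pt → ℝ) (q : Poly),
      T₁ ∈ triangles K → T₂ ∈ triangles K → E ⊆ T₁ → E ⊆ T₂ → MemHcurl (elem T₁) f c → MemHcurl (elem T₂) f c →
      IsEdgeFrame E M τ h → IsOnSide T₁ M (nrm τ) h (h / (4 + 4 * γ)) →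
      IsOnSide T₂ M (nrm (-τ)) h (h / (4 + 4 * γ)) →
      HasTangentialTrace T₁ E τ f c g₁ → HasTangentialTrace T₂ E τ f c g₂ → q.totalDegree ≤ k →
      ν⁻¹ * (h * √h) *
          lpNorm (fun x => (g₁ x + ν * inner ℝ (lapVec (P T₁) x) τ)
            - (g₂ x + ν * inner ℝ (lapVec (P T₂) x) τ)) 2 (arc E) ≤
        C * (lpNorm (Du - Duh) 2 (vol (elem T₁ ∪ elem T₂))
          + ν⁻¹ * h ^ 2 * lpNorm (curlRes ν c (P T₁)) 2 (vol (elem T₁))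
          + ν⁻¹ * h ^ 2 * lpNorm (curlRes ν c (P T₂)) 2 (vol (elem T₂)))
        + C * (ν⁻¹ * (h * √h)) * lpNorm (fun x => g₁ x - g₂ x - val q x) 2 (arc E) := by
  obtain ⟨A, hA, hbub⟩ := exists_edge_bubble (max k m) (4 + 4 * γ)
  obtain ⟨A', hA', hinv⟩ := exists_fderiv_divPoly_bound m hγ
  have hpi := Real.pi_pos
  -- the bubble lives on a disc of half the radius of the half discs inside the triangles
  obtain ⟨lam, hlam⟩ : ∃ lam, lam = 8 + 8 * γ := ⟨_, rfl⟩
  have hlam0 : 0 < lam := by rw [hlam]; positivity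
  refine ⟨1 + A ^ 2 * lam + A ^ 2 * lam * (2 * √Real.pi * lam + 2 * A')
    + A ^ 2 * √Real.pi, by positivity, ?_⟩
  intro K ν f c uD DuD u Du p uh Duh P hK hSR hν hfL hS hD E T₁ T₂ M τ h g₁ g₂ q hT₁ hT₂ hE₁ hE₂ hf₁
    hf₂ H hO₁ hO₂ hg₁ hg₂ hq
  have hh := H.pos
  have hfin := isFiniteMeasure_arc H
  obtain ⟨l, hl⟩ : ∃ l, l = h / lam := ⟨_, rfl⟩
  have hl0 : 0 < l := by rw [hl]; positivity
  have hL : h / (4 + 4 * γ) = 2 * l := by rw [hl, hlam]; field_simp; ring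
  have hRl : (4 + 4 * γ) * l = h / 2 := by rw [hl, hlam]; field_simp; ring
  rw [hL] at hO₁ hO₂
  have hlh : 2 * l ≤ h / 2 := by rw [← hRl]; nlinarith
  set J : Pt → ℝ := fun x => (g₁ x + ν * inner ℝ (lapVec (P T₁) x) τ)
    - (g₂ x + ν * inner ℝ (lapVec (P T₂) x) τ) with hJ
  obtain ⟨Q, hQ⟩ : ∃ Q : Poly, Q = q + MvPolynomial.C ν *
    (lapTangential (P T₁) τ - lapTangential (P T₂) τ) := ⟨_, rfl⟩
  have hQv : ∀ x, val Q x = val q x + ν * (inner ℝ (lapVec (P T₁) x) τ -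
      inner ℝ (lapVec (P T₂) x) τ) := fun x => by
    rw [← val_lapTangential, ← val_lapTangential, hQ]
    simp [val]
  have hQd : Q.totalDegree ≤ max k m := by
    rw [hQ]
    refine (MvPolynomial.totalDegree_add _ _).trans (max_le_max hq ?_)
    refine (totalDegree_C_mul_le _ _).trans ((MvPolynomial.totalDegree_sub _ _).trans ?_)
    exact max_le (totalDegree_lapTangential_le (hD.degree T₁ hT₁) τ)
      (totalDegree_lapTangential_le (hD.degree T₂ hT₂) τ)
  obtain ⟨φ, B, hB, hφs, hφt, hφQ, hQB, hφB, hφ2, hφn⟩ :=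
    hbub M (rotEquiv τ H.norm) l Q hl0 hQd
  rw [rotEquiv_single_zero] at hφQ hQB hφn
  rw [rotEquiv_single_one] at hφn
  rw [hRl] at hQB
  have hφ : IsTest (Metric.ball M (2 * l)) φ :=
    isTest_of_tsupport hφs hφt (Metric.closedBall_subset_ball (by linarith))
  have hφb : IsTest (Metric.closedBall M l) φ := isTest_of_tsupport hφs hφt subset_rfl
  have hid := edge_identity hS hD hfL hT₁ hT₂ hf₁ hf₂ H hlh hO₁ hO₂ hg₁ hg₂ hφ hφn
  have hφa := hφ.memLp_arc H
  have hQL := memLp_arc_of_continuous H (contDiff_val Q).continuous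
  have hoL : MemLp (fun x => g₁ x - g₂ x - val q x) 2 (arc E) :=
    (hg₁.memLp.sub hg₂.memLp).sub (memLp_arc_of_continuous H (contDiff_val q).continuous)
  have hJQ : ∀ x, J x = (g₁ x - g₂ x - val q x) + val Q x := fun x => by
    rw [hJ, hQv]; ring
  set o := lpNorm (fun x => g₁ x - g₂ x - val q x) 2 (arc E) with ho
  set e := lpNorm (Du - Duh) 2 (vol (elem T₁ ∪ elem T₂)) with he
  set R₁ := lpNorm (curlRes ν c (P T₁)) 2 (vol (elem T₁)) with hR₁
  set R₂ := lpNorm (curlRes ν c (P T₂)) 2 (vol (elem T₂)) with hR₂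
  have ho0 : 0 ≤ o := lpNorm_nonneg
  have he0 : 0 ≤ e := lpNorm_nonneg
  have hR₁0 : 0 ≤ R₁ := lpNorm_nonneg
  have hR₂0 : 0 ≤ R₂ := lpNorm_nonneg
  -- the four contributions to the tested residual
  have b0 : |∫ x, (g₁ x - g₂ x - val q x) * φ x ∂(arc E)| ≤ o * (A * B * √h) := by
    have := abs_integral_inner_le_of_bound hoL hφa MeasurableSet.univ (measure_ne_top _ _)
      (by positivity) (fun x _ => hφB x) fun x hx => absurd (Set.mem_univ x) hx
    rw [arc_real_univ H] at this
    simpa [mul_comm] using this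
  have hsub : elem T₁ ∪ elem T₂ ⊆ domain K :=
    Set.union_subset (elem_subset_domain hT₁) (elem_subset_domain hT₂)
  have heD : MemLp (Du - Duh) 2 (vol (domain K)) :=
    hS.velocity.memLp_grad.sub hD.memH1.memLp_grad
  have heL : MemLp (Du - Duh) 2 (vol (elem T₁ ∪ elem T₂)) :=
    heD.mono_measure (Measure.restrict_mono hsub le_rfl)
  have b1 : |∫ x, inner ℝ ((Du - Duh) x) (gradC (rotC φ) x) ∂(vol (elem T₁ ∪ elem T₂))| ≤
      e * (2 * (A * l⁻¹ ^ 2 * B) * (√Real.pi * l)) :=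
    abs_integral_inner_le_disc heL ((isTest_gradC_rotC hφ).memLp _) hl0.le (by positivity)
      (fun y => norm_gradC_rotC_le (by positivity) fun i j => hφ2 i j y)
      fun y hy => (isTest_gradC_rotC hφb).eq_zero hy
  have b2 : |∫ x, curlRes ν c (P T₁) x * φ x ∂(vol (elem T₁))| ≤ R₁ * (A * B * (√Real.pi * l)) :=
    abs_integral_mul_le_disc (hf₁.memLp_curlRes _ _) (hφ.memLp _) hl0.le (by positivity) hφB
      fun y hy => hφb.eq_zero hy
  have b3 : |∫ x, curlRes ν c (P T₂) x * φ x ∂(vol (elem T₂))| ≤ R₂ * (A * B * (√Real.pi * l)) :=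
    abs_integral_mul_le_disc (hf₂.memLp_curlRes _ _) (hφ.memLp _) hl0.le (by positivity) hφB
      fun y hy => hφb.eq_zero hy
  have hdiv : ∀ {T : Finset Pt}, T ∈ triangles K → elem T ⊆ elem T₁ ∪ elem T₂ → E ⊆ T →
      ∀ x ∈ convexHull ℝ (E : Set Pt),
      |fderiv ℝ (val (divPoly (P T))) x τ| ≤ A' * h⁻¹ ^ 2 * e := fun hT hTs hET x hx =>
    (hinv K ν f uD DuD u Du p uh Duh P hK hSR hS hD E _ M τ h hT hET H x hx).trans
      (mul_le_mul_of_nonneg_left (lpNorm_mono_set heL hTs) (by positivity))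
  have b4 : |∫ x, φ x * (fderiv ℝ (val (divPoly (P T₁))) x τ -
      fderiv ℝ (val (divPoly (P T₂))) x τ) ∂(arc E)| ≤
      A * B * (2 * A' * h⁻¹ ^ 2 * e) * h := by
    rw [← arc_real_univ H, ← Real.norm_eq_abs]
    refine norm_integral_le_of_norm_le_const ?_
    filter_upwards [ae_arc_mem E] with x hx
    rw [norm_mul, arc_real_univ H]
    refine mul_le_mul (hφB x) ?_ (norm_nonneg _) (by positivity)
    refine (norm_sub_le _ _).trans ?_
    have a := hdiv hT₁ Set.subset_union_left hE₁ x hx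
    have b := hdiv hT₂ Set.subset_union_right hE₂ x hx
    simp only [Real.norm_eq_abs]
    linarith
  have hB2 : l * B ^ 2 = ∫ x, J x * φ x ∂(arc E) -
      ∫ x, (g₁ x - g₂ x - val q x) * φ x ∂(arc E) := by
    have hline := integral_line_eq_arc H hlh (F := fun x => φ x * val Q x) fun x hx => by
      rw [hφ.eq_zero hx, zero_mul]
    have hsum := integral_add (integrable_mul_of_memLp hoL hφa) (integrable_mul_of_memLp hφa hQL)
    have hpt : (fun x => J x * φ x) =
        fun x => (g₁ x - g₂ x - val q x) * φ x + φ x * val Q x := by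
      funext x
      rw [hJQ]; ring
    rw [hpt, hsum, ← hφQ, hline, add_sub_cancel_left]
  have hBl := edge_bubble_arith hA hl0 hh hν hB ho0 he0 hA'.le hR₁0 hR₂0 (Real.sqrt_nonneg Real.pi)
    (hB2.trans (by rw [hid])) b0 b1 b2 b3 b4
  have hQn : lpNorm (val Q) 2 (arc E) ≤ A * B * √h := by
    have := lpNorm_le_of_ae_bound hQL.1 (by positivity) (H.ae_arc (p := fun x => |val Q x| ≤ A * B)
      hQB)
    rwa [arc_real_univ H] at this
  have hJn : lpNorm J 2 (arc E) ≤ o + A * B * √h := by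
    have e1 : J = (fun x => g₁ x - g₂ x - val q x) + val Q := funext hJQ
    rw [e1]
    exact (lpNorm_add_le hoL (by norm_num)).trans (by linarith)
  exact edge_bound_arith hA hA' hν hh hl hlam0 ho0 he0 hR₁0 hR₂0 (Real.sqrt_nonneg _) hBl hJn

lemma ShapeRegular.pos {K : Geometry.SimplicialComplex ℝ Pt} {γ : ℝ} (hK : ShapeRegular K γ)
    {T : Finset Pt} (hT : T ∈ triangles K) : 0 < γ := by
  obtain ⟨x, r, hr, hball, hγ⟩ := hK T hT
  have := le_diam_of_closedBall_subset hr hball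
  by_contra! h
  nlinarith

lemma osc_nonneg (k : ℕ) (T : Finset Pt) (g : Pt → ℝ) : 0 ≤ osc k T g :=
  mul_nonneg Metric.diam_nonneg (distPoly_nonneg k _ g)

lemma distPoly_neg_le (k : ℕ) (μ : Measure Pt) (g : Pt → ℝ) :
    distPoly k μ (fun x => -g x) ≤ distPoly k μ g := by
  have : Nonempty {q : Poly // q.totalDegree ≤ k} := ⟨⟨0, by simp⟩⟩
  refine le_ciInf fun q => ?_
  refine (ciInf_le ⟨0, by rintro _ ⟨q, rfl⟩; exact lpNorm_nonneg⟩
    ⟨-q.1, by rw [MvPolynomial.totalDegree_neg]; exact q.2⟩).trans (le_of_eq ?_)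
  rw [← lpNorm_neg]
  congr 1
  funext x
  simp [val]
  ring

/-- The geometry of a triangle next to an edge turns the efficiency on the triangle into a bound
that is scaled with the length of the edge. -/
lemma elem_bound_at_edge {K : Geometry.SimplicialComplex ℝ Pt} {γ ν C e X o : ℝ}
    (hK : ShapeRegular K γ) (hν : 0 < ν) (hC : 0 ≤ C) {E T : Finset Pt} {M τ n : Pt} {h l : ℝ}
    (H : IsEdgeFrame E M τ h) (hT : T ∈ triangles K) (hET : E ⊆ T) (hO : IsOnSide T M n h l)
    (hX : 0 ≤ X) (ho : 0 ≤ o)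
    (hb : ν⁻¹ * diam T ^ 2 * X ≤ C * (e + ν⁻¹ * diam T * o)) :
    ν⁻¹ * h ^ 2 * X ≤ C * (e + ν⁻¹ * (γ * h) * o) := by
  have hγ := hK.pos hT
  obtain ⟨x, r, hr, hball, hd⟩ := hK T hT
  have hh := H.pos
  have h1 : h ≤ diam T := by
    rw [← H.diam_eq]
    exact Metric.diam_mono (convexHull_mono (Finset.coe_subset.2 hET))
      (isCompact_convexHull_finset T).isBounded
  have h2 : diam T ≤ γ * h := by
    have := hO.inradius_le x r hr.le hball
    nlinarith
  calc ν⁻¹ * h ^ 2 * X ≤ ν⁻¹ * diam T ^ 2 * X := by gcongr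
    _ ≤ _ := hb
    _ ≤ _ := by gcongr

/-- Efficiency on an edge whose first triangle lies on the side of the rotated tangent. -/
lemma exists_edge_efficiency_of_isOnSide (k m : ℕ) {γ : ℝ} (hγ : 0 < γ) :
    ∃ C : ℝ, 0 < C ∧ ∀ (K : Geometry.SimplicialComplex ℝ Pt) (ν : ℝ) (f : Pt → Pt)
      (c : Pt → ℝ) (uD : Pt → Pt) (DuD : Pt → Mat) (u : Pt → Pt) (Du : Pt → Mat) (p : Pt → ℝ)
      (uh : Pt → Pt) (Duh : Pt → Mat) (P : Finset Pt → Fin 2 → Poly),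
      IsTriangulation K → ShapeRegular K γ → 0 < ν → MemLp f 2 (vol (domain K)) →
      (∀ T ∈ triangles K, MemHcurl (elem T) f c) →
      IsStokesSolution (domain K) ν f uD DuD u Du p → IsDiscreteVelocity K m uh Duh P →
      ∀ (E T₁ T₂ : Finset Pt) (M τ : Pt) (h : ℝ) (g₁ g₂ : Pt → ℝ), IsInnerEdge K E T₁ T₂ →
      IsEdgeFrame E M τ h → IsOnSide T₁ M (nrm τ) h (h / (4 + 4 * γ)) →
      IsOnSide T₂ M (nrm (-τ)) h (h / (4 + 4 * γ)) →
      HasTangentialTrace T₁ E τ f c g₁ → HasTangentialTrace T₂ E τ f c g₂ →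
      ν⁻¹ * diam E ^ (3 / 2 : ℝ) *
          lpNorm (fun x => (g₁ x + ν * inner ℝ (lapVec (P T₁) x) τ)
            - (g₂ x + ν * inner ℝ (lapVec (P T₂) x) τ)) 2 (arc E) ≤
        C * (lpNorm (Du - Duh) 2 (vol (elem T₁ ∪ elem T₂))
          + ν⁻¹ * diam E * Real.sqrt (osc k T₁ (curlRes ν c (P T₁)) ^ 2
              + osc k T₂ (curlRes ν c (P T₂)) ^ 2)
          + ν⁻¹ * diam E * oscEdge k E (fun x => g₁ x - g₂ x)) := by
  obtain ⟨C₁, hC₁, hel⟩ := exists_elem_efficiency k γ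
  obtain ⟨C₂, hC₂, hed⟩ := exists_edge_bound k m hγ
  refine ⟨C₂ * (1 + 2 * C₁ + 2 * C₁ * γ), by positivity, ?_⟩
  intro K ν f c uD DuD u Du p uh Duh P hK hSR hν hfL hf hS hD E T₁ T₂ M τ h g₁ g₂ hI H hO₁ hO₂
    hg₁ hg₂
  have hh := H.pos
  have hq := le_add_mul_distPoly (D := C₂ * (ν⁻¹ * (h * √h))) (by positivity) fun q hq =>
    hed K ν f c uD DuD u Du p uh Duh P hK hSR hν hfL hS hD E T₁ T₂ M τ h g₁ g₂ q hI.mem₁ hI.mem₂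
      hI.sub₁ hI.sub₂ (hf T₁ hI.mem₁) (hf T₂ hI.mem₂) H hO₁ hO₂ hg₁ hg₂ hq
  have hsub : elem T₁ ∪ elem T₂ ⊆ domain K :=
    Set.union_subset (elem_subset_domain hI.mem₁) (elem_subset_domain hI.mem₂)
  have heL : MemLp (Du - Duh) 2 (vol (elem T₁ ∪ elem T₂)) :=
    (hS.velocity.memLp_grad.sub hD.memH1.memLp_grad).mono_measure
      (Measure.restrict_mono hsub le_rfl)
  have a₁ := elem_bound_at_edge hSR hν hC₁.le H hI.mem₁ hI.sub₁ hO₁ lpNorm_nonneg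
    (osc_nonneg k T₁ _) (hel K m ν f c uD DuD u Du p uh Duh P hSR hν hS hD T₁ hI.mem₁
      (hf T₁ hI.mem₁))
  have a₂ := elem_bound_at_edge hSR hν hC₁.le H hI.mem₂ hI.sub₂ hO₂ lpNorm_nonneg
    (osc_nonneg k T₂ _) (hel K m ν f c uD DuD u Du p uh Duh P hSR hν hS hD T₂ hI.mem₂
      (hf T₂ hI.mem₂))
  have e₁ := lpNorm_mono_set heL (Set.subset_union_left (s := elem T₁) (t := elem T₂))
  have e₂ := lpNorm_mono_set heL (Set.subset_union_right (s := elem T₁) (t := elem T₂))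
  have s₁ : osc k T₁ (curlRes ν c (P T₁)) ≤ √(osc k T₁ (curlRes ν c (P T₁)) ^ 2
      + osc k T₂ (curlRes ν c (P T₂)) ^ 2) := Real.le_sqrt_of_sq_le (by nlinarith)
  have s₂ : osc k T₂ (curlRes ν c (P T₂)) ≤ √(osc k T₁ (curlRes ν c (P T₁)) ^ 2
      + osc k T₂ (curlRes ν c (P T₂)) ^ 2) := Real.le_sqrt_of_sq_le (by nlinarith)
  have p1 : h ^ (3 / 2 : ℝ) = h * √h := by
    rw [Real.sqrt_eq_rpow, ← Real.rpow_one_add' hh.le (by norm_num)]; norm_num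
  have p2 : h ^ (1 / 2 : ℝ) = √h := (Real.sqrt_eq_rpow h).symm
  have hd := distPoly_nonneg k (arc E) fun x => g₁ x - g₂ x
  rw [oscEdge, H.diam_eq, p1, p2]
  refine hq.trans ?_
  generalize √(osc k T₁ (curlRes ν c (P T₁)) ^ 2 + osc k T₂ (curlRes ν c (P T₂)) ^ 2) = S at s₁ s₂ ⊢
  generalize distPoly k (arc E) (fun x => g₁ x - g₂ x) = d at hd ⊢
  have he : 0 ≤ lpNorm (Du - Duh) 2 (vol (elem T₁ ∪ elem T₂)) := lpNorm_nonneg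
  generalize lpNorm (Du - Duh) 2 (vol (elem T₁ ∪ elem T₂)) = e at e₁ e₂ he ⊢
  have hS0 : 0 ≤ S := (osc_nonneg k T₁ _).trans s₁
  have b₁ := a₁.trans (show _ ≤ C₁ * (e + ν⁻¹ * (γ * h) * S) by gcongr)
  have b₂ := a₂.trans (show _ ≤ C₁ * (e + ν⁻¹ * (γ * h) * S) by gcongr)
  have c1 : 0 ≤ ν⁻¹ * h * S := by positivity
  have c2 : 0 ≤ ν⁻¹ * (h * √h) * d := by positivity
  calc _ ≤ C₂ * (e + C₁ * (e + ν⁻¹ * (γ * h) * S) + C₁ * (e + ν⁻¹ * (γ * h) * S)) +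
        C₂ * (ν⁻¹ * (h * √h)) * d := by gcongr
    _ = C₂ * ((1 + 2 * C₁) * e + 2 * C₁ * γ * (ν⁻¹ * h * S) + ν⁻¹ * (h * √h) * d) := by ring
    _ ≤ C₂ * ((1 + 2 * C₁ + 2 * C₁ * γ) * e + (1 + 2 * C₁ + 2 * C₁ * γ) * (ν⁻¹ * h * S) +
        (1 + 2 * C₁ + 2 * C₁ * γ) * (ν⁻¹ * (h * √h) * d)) := by
      have k1 : 0 ≤ 2 * C₁ := by positivity
      have k2 : 0 ≤ 2 * C₁ * γ := by positivity
      have m1 := mul_nonneg k2 he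
      have m2 := mul_nonneg (add_nonneg zero_le_one k1) c1
      have m3 := mul_nonneg (add_nonneg k1 k2) c2
      exact mul_le_mul_of_nonneg_left (by linarith) hC₂.le
    _ = _ := by ring

end StokesEff

theorem mainTheorem2 (k m : ℕ) (γ : ℝ) :
    ∃ C : ℝ, 0 < C ∧
      ∀ (K : Geometry.SimplicialComplex ℝ Pt) (ν : ℝ) (f : Pt → Pt) (c : Pt → ℝ)
        (uD : Pt → Pt) (DuD : Pt → Mat) (u : Pt → Pt) (Du : Pt → Mat) (p : Pt → ℝ)
        (uh : Pt → Pt) (Duh : Pt → Mat) (P : Finset Pt → Fin 2 → Poly),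
        IsTriangulation K → ShapeRegular K γ → 0 < ν →
        MemLp f 2 (vol (domain K)) →
        (∀ T ∈ triangles K, MemHcurl (elem T) f c) →
        IsStokesSolution (domain K) ν f uD DuD u Du p →
        IsDiscreteVelocity K m uh Duh P →
        -- (a)
        (∀ T ∈ triangles K,
          ν⁻¹ * diam T ^ 2 * lpNorm (curlRes ν c (P T)) 2 (vol (elem T)) ≤
            C * (lpNorm (Du - Duh) 2 (vol (elem T))
              + ν⁻¹ * diam T * osc k T (curlRes ν c (P T)))) ∧
        -- (b)
        (∀ (E T₁ T₂ : Finset Pt) (τ : Pt) (g₁ g₂ : Pt → ℝ) (Dp : Pt → Pt),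
          IsInnerEdge K E T₁ T₂ → IsUnitTangent E τ →
          HasTangentialTrace T₁ E τ f c g₁ → HasTangentialTrace T₂ E τ f c g₂ →
          MemH1s (elem T₁) p Dp → MemH1s (elem T₂) p Dp →
          ν⁻¹ * diam E ^ (3 / 2 : ℝ) *
              lpNorm (fun x => (g₁ x + ν * inner ℝ (lapVec (P T₁) x) τ)
                - (g₂ x + ν * inner ℝ (lapVec (P T₂) x) τ)) 2 (arc E) ≤
            C * (lpNorm (Du - Duh) 2 (vol (elem T₁ ∪ elem T₂))
              + ν⁻¹ * diam E * Real.sqrt (osc k T₁ (curlRes ν c (P T₁)) ^ 2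
                  + osc k T₂ (curlRes ν c (P T₂)) ^ 2)
              + ν⁻¹ * diam E * oscEdge k E (fun x => g₁ x - g₂ x)
              + min 1 ν⁻¹ * Real.sqrt (oscVec k T₁ (fun x => f x - Dp x) ^ 2
                  + oscVec k T₂ (fun x => f x - Dp x) ^ 2))) := by
  rcases le_or_gt γ 0 with hγ | hγ
  -- shape regularity with `γ ≤ 0` leaves no triangles
  · refine ⟨1, one_pos, ?_⟩
    intro K ν f c uD DuD u Du p uh Duh P hK hSR hν hfL hf hS hD
    exact ⟨fun T hT => absurd (hSR.pos hT) hγ.not_gt,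
      fun E T₁ T₂ τ g₁ g₂ Dp hI => absurd (hSR.pos hI.mem₁) hγ.not_gt⟩
  obtain ⟨C₁, hC₁, hel⟩ := exists_elem_efficiency k γ
  obtain ⟨C₂, hC₂, hed⟩ := exists_edge_efficiency_of_isOnSide k m hγ
  refine ⟨C₁ + C₂, by positivity, ?_⟩
  intro K ν f c uD DuD u Du p uh Duh P hK hSR hν hfL hf hS hD
  refine ⟨fun T hT => ?_, fun E T₁ T₂ τ g₁ g₂ Dp hI hτ hg₁ hg₂ _ _ => ?_⟩
  · refine (hel K m ν f c uD DuD u Du p uh Duh P hSR hν hS hD T hT (hf T hT)).trans ?_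
    refine mul_le_mul_of_nonneg_right (by linarith) (add_nonneg lpNorm_nonneg ?_)
    exact mul_nonneg (mul_nonneg (inv_nonneg.2 hν.le) Metric.diam_nonneg) (osc_nonneg k T _)
  · obtain ⟨M, h, H⟩ := exists_isEdgeFrame hI.card hτ
    have hl : 0 < h / (4 + 4 * γ) := div_pos H.pos (by positivity)
    have hE0 : 0 ≤ ν⁻¹ * diam E := mul_nonneg (inv_nonneg.2 hν.le) Metric.diam_nonneg
    have hoE : 0 ≤ oscEdge k E (fun x => g₁ x - g₂ x) :=
      mul_nonneg (Real.rpow_nonneg Metric.diam_nonneg _) (distPoly_nonneg k _ _)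
    have hsum : 0 ≤ lpNorm (Du - Duh) 2 (vol (elem T₁ ∪ elem T₂))
        + ν⁻¹ * diam E * √(osc k T₁ (curlRes ν c (P T₁)) ^ 2 + osc k T₂ (curlRes ν c (P T₂)) ^ 2)
        + ν⁻¹ * diam E * oscEdge k E (fun x => g₁ x - g₂ x) :=
      add_nonneg (add_nonneg lpNorm_nonneg (mul_nonneg hE0 (Real.sqrt_nonneg _)))
        (mul_nonneg hE0 hoE)
    -- the oscillation of `f - ∇p` is nonnegative and only enlarges the right-hand side
    have hp : 0 ≤ min 1 ν⁻¹ * √(oscVec k T₁ (fun x => f x - Dp x) ^ 2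
        + oscVec k T₂ (fun x => f x - Dp x) ^ 2) := by positivity
    refine le_trans ?_ (mul_le_mul (le_add_of_nonneg_left hC₁.le)
      (le_add_of_nonneg_right hp) hsum (by positivity))
    rcases isOnSide_or hSR H hI.card hI.mem₁ hI.sub₁ with h₁ | h₁
    · have h₂ := (isOnSide_or hSR H hI.card hI.mem₂ hI.sub₂).resolve_left
        fun h₂ => not_isOnSide_both H hl hI h₁ h₂
      exact hed K ν f c uD DuD u Du p uh Duh P hK hSR hν hfL hf hS hD E T₁ T₂ M τ h g₁ g₂ hI H h₁
        h₂ hg₁ hg₂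
    -- otherwise reverse the tangent, which changes the sign of the jumps
    · have h₂ := (isOnSide_or hSR H hI.card hI.mem₂ hI.sub₂).resolve_right
        fun h₂ => not_isOnSide_both H.neg hl hI h₁ h₂
      have := hed K ν f c uD DuD u Du p uh Duh P hK hSR hν hfL hf hS hD E T₁ T₂ M (-τ) h _ _ hI
        H.neg h₁ (by rwa [neg_neg]) hg₁.neg hg₂.neg
      have hJ : (fun x => (-g₁ x + ν * inner ℝ (lapVec (P T₁) x) (-τ))
          - (-g₂ x + ν * inner ℝ (lapVec (P T₂) x) (-τ))) =
          -fun x => (g₁ x + ν * inner ℝ (lapVec (P T₁) x) τ)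
            - (g₂ x + ν * inner ℝ (lapVec (P T₂) x) τ) := by
        funext x
        simp only [inner_neg_right, Pi.neg_apply]
        ring
      have hg : (fun x => -g₁ x - -g₂ x) = fun x => -(g₁ x - g₂ x) := by
        funext x
        ring
      rw [hJ, lpNorm_neg, hg] at this
      refine this.trans ?_
      gcongr
      exact mul_le_mul_of_nonneg_left (distPoly_neg_le k _ _)
        (Real.rpow_nonneg Metric.diam_nonneg _)
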